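/- Let $E$ be a finite-dimensional Euclidean space, $n=\dim E$, let $\mathcal L$ be a finite set of linear subspaces of $E$, all of the same codimension $d\ge 1$, and let $C=\bigcup_{L\in\mathcal L}L$. Fix an itinerary $L_1,\dots,L_k\in\mathcal L$ with $L_i\neq L_{i+1}$. A trajectory realizing it is a unit-speed polygonal curve $q:\mathbb R\to E$ for which there are times $t_1<\dots<t_k$ such that $q(t)\in C$ exactly for $t\in\{t_1,\dots,t_k\}$, $q_i:=q(t_i)\in L_i$, all vertices of $q$ are among the $q_i$, and the velocities before and after $t_i$ have the same orthogonal projection to $L_i$. Represent an oriented line with unit direction $v$ by $(v,Q)$, where $Q\perp v$ is its point closest to $0$. The scattering relation $\mathcal R$ is the set of all $((v_-,Q_-),(v_+,Q_+))$, where $(v_-,Q_-)$ and $(v_+,Q_+)$ are the oriented lines containing the initial and the final ray of a trajectory realizing the itinerary. By the inner product, $(v_-,Q_-,v_+,Q_+)$ is regarded as a covector of $X=S(E_v)\times S(E_v)$, with $S(E_v)$ the unit sphere of $E$; $\mathbb R^+$ scales the $Q_\pm$, and $\mathbb PT^*X$ is the set of nonzero covectors modulo nonzero real factors. Call a trajectory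 stable if, for some points $A$ and $B$ in its open initial and final rays, every $(A',q_1',\dots,q_k',B')\in E\times L_1\times\dots\times L_k\times E$ close to $(A,q_1,\dots,q_k,B)$ has the property that the ray from $q_1'$ through $A'$, the segments $q_i'q_{i+1}'$ and the ray from $q_k'$ through $B'$ meet $C$ only in the points $q'_i$. Let $\mathcal R^\circ\subset\mathcal R$ be the part that comes from stable trajectories. Theorem. The form $\Theta=Q_-\cdot dv_--Q_+\cdot dv_+$, defined up to scaling on the smooth manifold $\mathbb PT^*X$ of dimension $4n-5$, defines a contact structure on it (its differential is nondegenerate on the nonzero covectors), provided $n\ge2$, and then the projection $\pi_-\times\pi_+:\mathbb PT^*X\to X$ is a surjective submersion with Legendrian fibres. Suppose that the itinerary has length $k>1$ (which implies $n\ge 2$). Then: (1) $\mathcal R$ does not meet the zero section; $\mathcal R$ and $\mathcal R^\circ$ are invariant under $\mathbb R^+$; and $\mathcal R/\mathbb R^+$ maps homeomorphically onto its image in $\mathbb PT^*X$. (2) $\mathcal R^\circ/\mathbb R^+$ is an embedded submanifold of $\mathbb PT^*X$ of dimension $2n-3$ which is Legendrian with respect to $\Theta$. Moreover, all of $\mathcal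 R/\mathbb R^+$ is contained in an embedded Legendrian submanifold of $\mathbb PT^*X$ of dimension $2n-3$ in which $\mathcal R^\circ/\mathbb R^+$ is open. (3) If $\mathcal R^\circ/\mathbb R^+$ is transverse to the fibre of $\pi_-\times\pi_+$ at some point (that is, no nonzero tangent vector of it there is tangent to the fibre), then its image in $S(E_v)\times S(E_v)$ is a possibly singular hypersurface, in the following sense: the image has Hausdorff dimension $2n-3$; in the connected component of $\mathcal R^\circ/\mathbb R^+$ of any point of transversality, the points of transversality are dense; and every point of transversality has a neighbourhood in $\mathcal R^\circ/\mathbb R^+$ that $\pi_-\times\pi_+$ maps injectively onto a smooth embedded hypersurface. -/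

import Mathlib

open scoped RealInnerProductSpace ContDiff Topology

namespace PointBilliard

noncomputable section

/-! ### Embedded submanifolds of a normed space -/

section Submanifold

variable {W : Type*} [NormedAddCommGroup W] [NormedSpace ℝ W]

/-- `M` is a smooth embedded `m`-dimensional submanifold of `W`: near each of its points it is the
image of a smooth immersion of an open subset of `ℝ^m` that is a homeomorphism onto its image. -/
def IsSubmanifold (m : ℕ) (M : Set W) : Prop :=
  ∀ x ∈ M, ∃ (U : Set (EuclideanSpace ℝ (Fin m))) (f : EuclideanSpace ℝ (Fin m) → W) (O : Set W),
    IsOpen U ∧ IsOpen O ∧ x ∈ O ∧ ContDiffOn ℝ ∞ f U ∧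
    (∀ u ∈ U, Function.Injective (fderiv ℝ f u)) ∧
    Topology.IsEmbedding (U.domRestrict f) ∧ f '' U = M ∩ O

/-- The tangent vectors of `M` at `x`: velocities at `x` of curves that lie in `M`. -/
def tangentVectors (M : Set W) (x : W) : Set W :=
  {ξ | ∃ γ : ℝ → W, γ 0 = x ∧ (∀ᶠ s in 𝓝 (0 : ℝ), γ s ∈ M) ∧ HasDerivAt γ ξ 0}

end Submanifold

variable {E : Type*} [NormedAddCommGroup E] [InnerProductSpace ℝ E]

/-! ### Billiard trajectories -/

/-- The collision locus `C`, the union of the collision subspaces. -/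
def collisionLocus (𝓛 : Finset (Submodule ℝ E)) : Set E :=
  {x | ∃ M ∈ 𝓛, x ∈ M}

/-- The closed time interval of the `j`-th edge of a path with vertices at the increasing times
`t 0, …, t m`: `(-∞, t 0]` for `j = 0`, `[t (j-1), t j]` for `0 < j ≤ m` and `[t m, ∞)` for
`j = m + 1`. -/
def edge {m : ℕ} (t : Fin (m + 1) → ℝ) (j : Fin (m + 2)) : Set ℝ :=
  {s | ∀ i : Fin (m + 1), (i.castSucc < j → t i ≤ s) ∧ (j ≤ i.castSucc → s ≤ t i)}

/-- `q` is a billiard trajectory that realizes the itinerary `L 0, …, L m` (of length `m + 1`),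
with collision times `t` and with velocity `u j` along its `j`-th edge. -/
structure IsTrajectory [FiniteDimensional ℝ E] (𝓛 : Finset (Submodule ℝ E)) {m : ℕ}
    (L : Fin (m + 1) → Submodule ℝ E)
    (q : ℝ → E) (t : Fin (m + 1) → ℝ) (u : Fin (m + 2) → E) : Prop where
  /-- the collision times are increasing -/
  strictMono : StrictMono t
  /-- `q` is polygonal, with vertices at most at the collision times -/
  polygonal : ∀ j, ∀ s ∈ edge t j, ∀ s' ∈ edge t j, q s' - q s = (s' - s) • u j
  /-- unit speed; in particular energy is conserved at collisions -/
  unit_speed : ∀ j, ‖u j‖ = 1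
  /-- the `i`-th collision takes place on `L i` -/
  mem : ∀ i, q (t i) ∈ L i
  /-- conservation of momentum at the `i`-th collision -/
  momentum : ∀ i, (L i).starProjection (u i.succ) = (L i).starProjection (u i.castSucc)
  /-- there are no other collisions -/
  exact : ∀ s, q s ∈ collisionLocus 𝓛 → ∃ i, s = t i

/-- Boundary data `(A, (q_0, …, q_m), B)`, with `q_i ∈ L i`, such that the path formed by the ray
from `q_0` through `A`, the segments `q_i q_{i+1}` and the ray from `q_m` through `B` meets the
collision locus only in the vertices `q_i`. -/
def cleanPaths (𝓛 : Finset (Submodule ℝ E)) {m : ℕ} (L : Fin (m + 1) → Submodule ℝ E) :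
    Set (E × ((i : Fin (m + 1)) → L i) × E) :=
  {x | (∀ s : ℝ, 0 < s → AffineMap.lineMap (x.2.1 0 : E) x.1 s ∉ collisionLocus 𝓛) ∧
    (∀ s : ℝ, 0 < s →
      AffineMap.lineMap (x.2.1 (Fin.last m) : E) x.2.2 s ∉ collisionLocus 𝓛) ∧
    ∀ i : Fin m, ∀ s ∈ Set.Ioo (0 : ℝ) 1,
      AffineMap.lineMap (x.2.1 i.castSucc : E) (x.2.1 i.succ : E) s ∉ collisionLocus 𝓛}

/-- The trajectory `q` with collision times `t` is stable: small perturbations of its vertices `q_i`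
within `L i` and of a point `A` on the initial ray and a point `B` on the final ray cause no further
collisions. -/
def IsStable (𝓛 : Finset (Submodule ℝ E)) {m : ℕ} (L : Fin (m + 1) → Submodule ℝ E)
    (q : ℝ → E) (t : Fin (m + 1) → ℝ) : Prop :=
  ∃ x ∈ interior (cleanPaths 𝓛 L), (∀ i, (x.2.1 i : E) = q (t i)) ∧
    (∃ s < t 0, x.1 = q s) ∧ ∃ s > t (Fin.last m), x.2.2 = q s

/-! ### Oriented lines and the scattering relation -/

/-- The coordinates `(v, Q)` of the oriented line through `A` with unit direction `v`; here `Q` is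
the point of the line closest to the origin. -/
def lineCoord (A v : E) : E × E := (v, A - ⟪v, A⟫ • v)

/-- The scattering relation: all pairs `((v₋, Q₋), (v₊, Q₊))` of incoming and outgoing oriented
lines of trajectories that realize the itinerary. -/
def scatteringRelation [FiniteDimensional ℝ E] (𝓛 : Finset (Submodule ℝ E)) {m : ℕ}
    (L : Fin (m + 1) → Submodule ℝ E) :
    Set ((E × E) × (E × E)) :=
  {p | ∃ q t u, IsTrajectory 𝓛 L q t u ∧
    p = (lineCoord (q (t 0)) (u 0),
      lineCoord (q (t (Fin.last m))) (u (Fin.last (m + 1))))}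

/-- The part of the scattering relation that comes from stable trajectories. -/
def stableScatteringRelation [FiniteDimensional ℝ E] (𝓛 : Finset (Submodule ℝ E)) {m : ℕ}
    (L : Fin (m + 1) → Submodule ℝ E) : Set ((E × E) × (E × E)) :=
  {p | ∃ q t u, IsTrajectory 𝓛 L q t u ∧ IsStable 𝓛 L q t ∧
    p = (lineCoord (q (t 0)) (u 0),
      lineCoord (q (t (Fin.last m))) (u (Fin.last (m + 1))))}

/-! ### The projectivized cotangent bundle of the product of the velocity spheres -/

/-- The scaling action `(v₋, Q₋, v₊, Q₊) ↦ (v₋, c Q₋, v₊, c Q₊)`. -/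
def scale (c : ℝ) (p : (E × E) × (E × E)) : (E × E) × (E × E) :=
  ((p.1.1, c • p.1.2), (p.2.1, c • p.2.2))

variable (E) in
/-- The product of the velocity spheres. -/
def sphereProd : Set (E × E) := Metric.sphere (0 : E) 1 ×ˢ Metric.sphere (0 : E) 1

variable (E) in
/-- The cotangent bundle of the product of the velocity spheres without its zero section; covectors
are identified with tangent vectors by means of the inner product. -/
def cotangentNonzero : Set ((E × E) × (E × E)) :=
  {p | (p.1.1, p.2.1) ∈ sphereProd E ∧ ⟪p.1.1, p.1.2⟫ = 0 ∧ ⟪p.2.1, p.2.2⟫ = 0 ∧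
    (p.1.2, p.2.2) ≠ 0}

variable (E) in
/-- The normed space that contains the projectivized cotangent bundle. A line in `E × E` is
represented by the orthogonal projection onto it; this is the standard embedding of real projective
space into the space of linear operators. -/
abbrev ProjAmbient : Type _ :=
  E × E × (WithLp 2 (E × E) →L[ℝ] WithLp 2 (E × E))

/-- The class `(v₋, v₊, [Q₋ : Q₊])` of a nonzero covector up to nonzero real factors. -/
def projClass (p : (E × E) × (E × E)) : ProjAmbient E :=
  (p.1.1, p.2.1,
    (Submodule.span ℝ {WithLp.toLp 2 (p.1.2, p.2.2)} :
      Submodule ℝ (WithLp 2 (E × E))).starProjection)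

variable (E) in
/-- The projectivized cotangent bundle of the product of the velocity spheres. -/
def projCotangent : Set (ProjAmbient E) := projClass '' cotangentNonzero E

/-- Two nonzero covectors have the same class if and only if they have the same base point and
differ by a nonzero real factor. -/
theorem projClass_eq_iff {p p' : (E × E) × (E × E)} (hp : p ∈ cotangentNonzero E)
    (hp' : p' ∈ cotangentNonzero E) :
    projClass p = projClass p' ↔ ∃ c : ℝ, c ≠ 0 ∧ p' = scale c p := by
  obtain ⟨⟨a, b⟩, ⟨a', b'⟩⟩ := p
  obtain ⟨⟨x, y⟩, ⟨x', y'⟩⟩ := p'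
  have h0 : (b, b') ≠ 0 := hp.2.2.2
  have h0' : (y, y') ≠ 0 := hp'.2.2.2
  simp only [projClass, scale, Prod.mk.injEq, Submodule.starProjection_inj]
  constructor
  · rintro ⟨rfl, rfl, h⟩
    rw [Submodule.span_singleton_eq_span_singleton] at h
    obtain ⟨c, hc⟩ := h
    have hc' := congrArg WithLp.ofLp hc
    simp only [WithLp.ofLp_smul, Units.smul_def, Prod.smul_mk, Prod.mk.injEq] at hc'
    exact ⟨c, c.ne_zero, ⟨rfl, hc'.1.symm⟩, rfl, hc'.2.symm⟩
  · rintro ⟨c, hc, ⟨rfl, rfl⟩, rfl, rfl⟩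
    refine ⟨rfl, rfl, ?_⟩
    rw [Submodule.span_singleton_eq_span_singleton]
    exact ⟨Units.mk0 c hc, rfl⟩

/-- The fibration `π₋ × π₊` to the product of the velocity spheres. -/
def baseProj (x : ProjAmbient E) : E × E := (x.1, x.2.1)

/-- The one-form `Θ = Q₋ · dv₋ - Q₊ · dv₊` at the covector `p`, as a function of the base components
`(δv₋, δv₊)` of a tangent vector. -/
def contactForm (p : (E × E) × (E × E)) (η : E × E) : ℝ :=
  ⟪p.1.2, η.1⟫ - ⟪p.2.2, η.2⟫

/-- The zero locus of `Θ` at the point `x` of the projectivized cotangent bundle. -/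
def contactHyperplane (x : ProjAmbient E) : Set (ProjAmbient E) :=
  {ξ | ∀ p ∈ cotangentNonzero E, projClass p = x → contactForm p (baseProj ξ) = 0}

/-- `M` is a Legendrian submanifold of the projectivized cotangent bundle, with respect to `Θ`: an
integral submanifold of the zero locus of `Θ`, of the maximal dimension `2 dim E - 3`. -/
def IsLegendrian (M : Set (ProjAmbient E)) : Prop :=
  M ⊆ projCotangent E ∧ IsSubmanifold (2 * Module.finrank ℝ E - 3) M ∧
    ∀ x ∈ M, tangentVectors M x ⊆ contactHyperplane x

/-- `M` is transverse at `x` to the fibre of `π₋ × π₊`: no nonzero tangent vector of `M` at `x` is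
tangent to the fibre. -/
def TransverseToFibre (M : Set (ProjAmbient E)) (x : ProjAmbient E) : Prop :=
  ∀ ξ ∈ tangentVectors M x, baseProj ξ = 0 → ξ = 0

/-- The image of the scattering relation in the projectivized cotangent bundle. -/
def projRelation [FiniteDimensional ℝ E] (𝓛 : Finset (Submodule ℝ E)) {m : ℕ}
    (L : Fin (m + 1) → Submodule ℝ E) : Set (ProjAmbient E) :=
  projClass '' scatteringRelation 𝓛 L

/-- The image of the stable part of the scattering relation in the projectivized cotangent
bundle. -/
def stableProjRelation [FiniteDimensional ℝ E] (𝓛 : Finset (Submodule ℝ E)) {m : ℕ}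
    (L : Fin (m + 1) → Submodule ℝ E) : Set (ProjAmbient E) :=
  projClass '' stableScatteringRelation 𝓛 L

end

end PointBilliard

open PointBilliard

/-! Fix points A and B on the two end rays. The length of the path A, q₀, …, qₘ, B is a convex
function of the vertices qᵢ ∈ L i, and conservation of momentum says that its gradient vanishes. No
edge of a trajectory is parallel to the subspace of an adjacent vertex, since otherwise the whole
edge would lie in the collision locus. Hence a critical path is the only one between its end points
(`IsBilliardPath.eq_of_endpoints`) and is nondegenerate
(`IsBilliardPath.injective_fderiv_momentumDefect`), so that nearby billiard paths form an analytic
family parametrized by (A, B) ∈ E × E (`IsBilliardPath.exists_family`). Forgetting the positions of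
A and B on their lines removes two parameters and scaling removes one. A linear slice of codimension
three in E × E therefore gives charts with 2n - 3 parameters
(`projClass_billiardCovectors_hasCharts`).

The length S(A, B) is a generating function: dS = v₊·dB - v₋·dA, and S = v₊·B - v₋·A by homogeneity,
so A·dv₋ - B·dv₊ = 0. Unit vectors vary orthogonally to themselves, so A and B may be replaced by Q₋
and Q₊, and Θ vanishes. The proof in `tangentVectors_projClass_billiardCovectors_subset` uses
minimality of the length instead of its derivative.

For an itinerary of length k > 1 the part of the path between the first and the last vertex has
positive length. This length is a function of the two end lines that is homogeneous of degree one in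
(Q₋, Q₊) (`chordLength`). It excludes the zero covector, and it shows that proportional covectors of
the relation differ by a positive factor.

Trajectories correspond to the billiard paths that avoid the collision locus off their vertices
(`scatteringRelation_eq`). Classes near that of a billiard path come from billiard paths near it
(`IsBilliardPath.eventually_exists_path_mem`), so stability, an interior condition, cuts out a
relatively open part of the Legendrian manifold of all billiard paths. Finally, all charts are
analytic: a determinant that detects transversality and is nonzero at one point of a chart is
nonzero on a dense set, and this propagates through connected components. -/

namespace PointBilliard

open Set Filter

/-! ### Analytic charts, Hausdorff dimension and points of immersion -/

section Charts

variable {P W : Type*} [NormedAddCommGroup P] [NormedSpace ℝ P]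
  [NormedAddCommGroup W] [NormedSpace ℝ W]

/-- `f` is a real analytic parametrization of `M` near `x`, and `g` is a differentiable left inverse
of `f`, defined in a neighbourhood of `x` in the ambient space. -/
structure IsChartAt (M : Set W) (x : W) (f : P → W) (g : W → P) : Prop where
  analytic : ContDiffAt ℝ ω f (g x)
  apply_center : f (g x) = x
  left_inv : ∀ᶠ u in 𝓝 (g x), f u ∈ M ∧ g (f u) = u
  differentiable : ∀ᶠ y in 𝓝 x, DifferentiableAt ℝ g y
  right_inv : ∀ᶠ y in 𝓝[M] x, f (g y) = y

/-- After shrinking to a ball, the same pair `f`, `g` is a chart at every image point. Convexity of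
the ball is what later gives connectedness and the identity theorem. -/
theorem IsChartAt.exists_ball {M : Set W} {x : W} {f : P → W} {g : W → P}
    (h : IsChartAt M x f g) {V : Set P} (hV : V ∈ 𝓝 (g x)) :
    ∃ r > 0, ∃ O : Set W, Metric.ball (g x) r ⊆ V ∧ IsOpen O ∧ x ∈ O ∧
      (∀ u ∈ Metric.ball (g x) r, ContDiffAt ℝ ω f u) ∧ (∀ y ∈ O, DifferentiableAt ℝ g y) ∧
      (∀ u ∈ Metric.ball (g x) r, f u ∈ M ∩ O ∧ g (f u) = u ∧ IsChartAt M (f u) f g) ∧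
      ∀ y ∈ M ∩ O, g y ∈ Metric.ball (g x) r ∧ f (g y) = y := by
  obtain ⟨O, hO, hOo, hxO⟩ := eventually_nhds_iff.1
    (h.differentiable.and (eventually_nhdsWithin_iff.1 h.right_inv))
  have hfO : ∀ᶠ u in 𝓝 (g x), f u ∈ O :=
    h.analytic.continuousAt.eventually_mem (by rw [h.apply_center]; exact hOo.mem_nhds hxO)
  obtain ⟨r, hr, hb⟩ := Metric.eventually_nhds_iff_ball.1
    (((h.analytic.eventually (by simp)).and h.left_inv).and (hfO.and hV))
  have hcont : ContinuousOn g O := fun y hy => (hO y hy).1.continuousAt.continuousWithinAt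
  -- Intersecting with the preimage of the ball under `g` forces the coordinates of all nearby
  -- points of `M` into the ball.
  refine ⟨r, hr, O ∩ g ⁻¹' Metric.ball (g x) r, fun u hu => (hb u hu).2.2,
    hcont.isOpen_inter_preimage hOo Metric.isOpen_ball, ⟨hxO, Metric.mem_ball_self hr⟩,
    fun u hu => (hb u hu).1.1, fun y hy => (hO y hy.1).1, fun u hu => ?_, fun y hy => ?_⟩
  · obtain ⟨⟨hf, hM, hg⟩, hO', -⟩ := hb u hu
    refine ⟨⟨hM, hO', by rwa [mem_preimage, hg]⟩, hg, by rwa [hg], by rw [hg], ?_, ?_, ?_⟩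
    · rw [hg]
      filter_upwards [Metric.isOpen_ball.mem_nhds hu] with v hv using (hb v hv).1.2
    · filter_upwards [hOo.mem_nhds hO'] with y hy using (hO y hy).1
    · filter_upwards [self_mem_nhdsWithin, mem_nhdsWithin_of_mem_nhds (hOo.mem_nhds hO')]
        with y hy hy' using (hO y hy').2 hy
  · exact ⟨hy.2.2, (hO y hy.2.1).2 hy.1⟩

theorem IsChartAt.fderiv_comp {M : Set W} {x : W} {f : P → W} {g : W → P}
    (h : IsChartAt M x f g) (η : P) : fderiv ℝ g x (fderiv ℝ f (g x) η) = η := by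
  have hf : DifferentiableAt ℝ f (g x) := h.analytic.differentiableAt (by simp)
  have hg : DifferentiableAt ℝ g (f (g x)) := by
    rw [h.apply_center]; exact h.differentiable.self_of_nhds
  have h1 : HasFDerivAt (g ∘ f) ((fderiv ℝ g (f (g x))).comp (fderiv ℝ f (g x))) (g x) :=
    hg.hasFDerivAt.comp _ hf.hasFDerivAt
  have h2 : HasFDerivAt (g ∘ f) (ContinuousLinearMap.id ℝ P) (g x) :=
    (hasFDerivAt_id _).congr_of_eventuallyEq (h.left_inv.mono fun u hu => hu.2)
  have h3 := congrArg (fun A : P →L[ℝ] P => A η) (h1.unique h2)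
  simpa [h.apply_center] using h3

/-- A curve in `M` coincides with `f ∘ g ∘ γ` near time zero, so the chain rule puts its velocity in
the range; conversely, straight lines in the parameters are mapped to curves in `M`. -/
theorem IsChartAt.tangentVectors_eq {M : Set W} {x : W} {f : P → W} {g : W → P}
    (h : IsChartAt M x f g) : tangentVectors M x = range (fderiv ℝ f (g x)) := by
  have hf : DifferentiableAt ℝ f (g x) := h.analytic.differentiableAt (by simp)
  have hg : DifferentiableAt ℝ g x := h.differentiable.self_of_nhds
  ext ξ
  constructor
  · rintro ⟨γ, rfl, hM, hγ⟩
    have h1 : HasDerivAt (g ∘ γ) (fderiv ℝ g (γ 0) ξ) 0 :=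
      hg.hasFDerivAt.comp_hasDerivAt _ hγ
    have h2 : HasDerivAt (f ∘ (g ∘ γ)) (fderiv ℝ f (g (γ 0)) (fderiv ℝ g (γ 0) ξ)) 0 :=
      hf.hasFDerivAt.comp_hasDerivAt _ h1
    have h3 : f ∘ (g ∘ γ) =ᶠ[𝓝 0] γ :=
      (tendsto_nhdsWithin_iff.2 ⟨hγ.continuousAt, hM⟩).eventually h.right_inv
    exact ⟨_, h2.unique (hγ.congr_of_eventuallyEq h3)⟩
  · rintro ⟨η, rfl⟩
    have h1 : HasDerivAt (fun s : ℝ => g x + s • η) η 0 := by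
      simpa using ((hasDerivAt_id (0 : ℝ)).smul_const η).const_add (g x)
    have h0 : g x + (0 : ℝ) • η = g x := by simp
    refine ⟨fun s => f (g x + s • η), by simp [h.apply_center], ?_, ?_⟩
    · have := h1.continuousAt.tendsto
      rw [h0] at this
      exact (this.eventually h.left_inv).mono fun s hs => hs.1
    · have hf' : HasFDerivAt f (fderiv ℝ f (g x)) (g x + (0 : ℝ) • η) := by
        rw [h0]; exact hf.hasFDerivAt
      exact hf'.comp_hasDerivAt (0 : ℝ) h1

theorem IsChartAt.inter_open {M O : Set W} {x : W} {f : P → W} {g : W → P}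
    (h : IsChartAt M x f g) (hO : IsOpen O) (hx : x ∈ O) : IsChartAt (M ∩ O) x f g where
  analytic := h.analytic
  apply_center := h.apply_center
  left_inv := by
    have := h.analytic.continuousAt.eventually_mem (s := O)
      (by rw [h.apply_center]; exact hO.mem_nhds hx)
    filter_upwards [this, h.left_inv] with u h1 h2 using ⟨⟨h2.1, h1⟩, h2.2⟩
  differentiable := h.differentiable
  right_inv := h.right_inv.filter_mono (nhdsWithin_mono _ inter_subset_left)

/-- Near each of its points, `M` has an analytic chart with `k` parameters. -/
def HasCharts (k : ℕ) (M : Set W) : Prop :=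
  ∀ x ∈ M, ∃ (f : EuclideanSpace ℝ (Fin k) → W) (g : W → EuclideanSpace ℝ (Fin k)),
    IsChartAt M x f g

theorem HasCharts.inter_open {k : ℕ} {M O : Set W} (h : HasCharts k M) (hO : IsOpen O) :
    HasCharts k (M ∩ O) := fun x hx =>
  let ⟨f, g, hfg⟩ := h x hx.1
  ⟨f, g, hfg.inter_open hO hx.2⟩

/-- Since `g` lives on an ambient neighbourhood, it yields both the injectivity of the derivative of
`f`, by the chain rule, and the continuity of the inverse of `f`. -/
theorem HasCharts.isSubmanifold {k : ℕ} {M : Set W} (h : HasCharts k M) : IsSubmanifold k M := by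
  intro x hx
  obtain ⟨f, g, hfg⟩ := h x hx
  obtain ⟨r, hr, O, -, hO, hxO, hf, hg, hleft, hright⟩ := hfg.exists_ball univ_mem
  refine ⟨Metric.ball (g x) r, f, O, Metric.isOpen_ball, hO, hxO,
    fun u hu => ((hf u hu).of_le (by simp)).contDiffWithinAt, fun u hu => ?_, ?_, ?_⟩
  · have := Function.LeftInverse.injective (hleft u hu).2.2.fderiv_comp
    rwa [(hleft u hu).2.1] at this
  · have hc : Continuous ((Metric.ball (g x) r).domRestrict f) :=
      continuousOn_iff_continuous_domRestrict.1
        fun u hu => (hf u hu).continuousAt.continuousWithinAt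
    have hc' : Continuous fun u : Metric.ball (g x) r => (⟨f u, (hleft u u.2).1.2⟩ : O) :=
      Continuous.subtype_mk hc _
    have hgc : Continuous (O.domRestrict g) :=
      continuousOn_iff_continuous_domRestrict.1
        fun y hy => (hg y hy).continuousAt.continuousWithinAt
    refine Topology.IsEmbedding.subtypeVal.comp (Topology.IsEmbedding.of_comp hc' hgc ?_)
    have : O.domRestrict g ∘ (fun u : Metric.ball (g x) r => (⟨f u, (hleft u u.2).1.2⟩ : O))
        = Subtype.val := funext fun u => (hleft u u.2).2.1
    rw [this]
    exact Topology.IsEmbedding.subtypeVal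
  · ext y
    constructor
    · rintro ⟨u, hu, rfl⟩
      exact (hleft u hu).1
    · intro hy
      exact ⟨g y, (hright y hy).1, (hright y hy).2⟩

/-- A chart that is parametrized by the kernel of a surjective linear map. -/
theorem exists_isChartAt_of_ker [FiniteDimensional ℝ P] {Z : Type*} [NormedAddCommGroup Z]
    [NormedSpace ℝ Z] [FiniteDimensional ℝ Z] {k : ℕ} (φ : P →ₗ[ℝ] Z)
    (hφ : Function.Surjective φ) (hk : Module.finrank ℝ P = k + Module.finrank ℝ Z)
    {M : Set W} {x : W} {f : P → W} {g : W → P} (hgx : g x = 0) (hf : ContDiffAt ℝ ω f 0)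
    (hfx : f 0 = x) (hleft : ∀ᶠ u in 𝓝 (0 : P), φ u = 0 → f u ∈ M ∧ g (f u) = u)
    (hg : ∀ᶠ y in 𝓝 x, DifferentiableAt ℝ g y)
    (hright : ∀ᶠ y in 𝓝[M] x, φ (g y) = 0 ∧ f (g y) = y) :
    ∃ (f' : EuclideanSpace ℝ (Fin k) → W) (g' : W → EuclideanSpace ℝ (Fin k)),
      IsChartAt M x f' g' := by
  -- A linear retraction onto the kernel, followed by an identification of the kernel with `ℝ^k`,
  -- supplies the coordinates. Nothing is lost on `M`, where `g` takes values in the kernel.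
  obtain ⟨π, hπ⟩ := Submodule.ClosedComplemented.of_finiteDimensional (𝕜 := ℝ) (LinearMap.ker φ)
  have hrank : Module.finrank ℝ (LinearMap.ker φ) = k := by
    have := φ.finrank_range_add_finrank_ker
    rw [LinearMap.range_eq_top.2 hφ, finrank_top] at this
    omega
  let e : LinearMap.ker φ ≃L[ℝ] EuclideanSpace ℝ (Fin k) :=
    ContinuousLinearEquiv.ofFinrankEq (by rw [hrank, finrank_euclideanSpace_fin])
  let i : EuclideanSpace ℝ (Fin k) →L[ℝ] P :=
    (LinearMap.ker φ).subtypeL.comp (e.symm : EuclideanSpace ℝ (Fin k) →L[ℝ] LinearMap.ker φ)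
  let p : P →L[ℝ] EuclideanSpace ℝ (Fin k) :=
    (e : LinearMap.ker φ →L[ℝ] EuclideanSpace ℝ (Fin k)).comp π
  have hi : ∀ u, φ (i u) = 0 := fun u => (e.symm u).2
  have hpi : ∀ u, p (i u) = u := fun u => by
    change e (π (e.symm u : P)) = u
    rw [hπ, e.apply_symm_apply]
  have hip : ∀ v, φ v = 0 → i (p v) = v := fun v hv => by
    change ((e.symm (e (π v)) : LinearMap.ker φ) : P) = v
    rw [e.symm_apply_apply]
    exact congrArg Subtype.val (hπ ⟨v, hv⟩)
  have hi0 : Tendsto i (𝓝 0) (𝓝 0) := by simpa using i.continuous.tendsto 0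
  refine ⟨f ∘ i, p ∘ g, ?_, ?_, ?_, ?_, ?_⟩
  · have : ContDiffAt ℝ ω f (i (p (g x))) := by simpa [hgx] using hf
    exact this.comp _ i.contDiff.contDiffAt
  · simp [hgx, hfx]
  · simp only [Function.comp_apply, hgx, map_zero]
    filter_upwards [hi0.eventually hleft] with u hu
    exact ⟨(hu (hi u)).1, by rw [(hu (hi u)).2, hpi]⟩
  · exact hg.mono fun y hy => p.differentiableAt.comp y hy
  · exact hright.mono fun y hy => by simp only [Function.comp_apply, hip _ hy.1, hy.2]

/-- An analytic immersion has a local differentiable left inverse. -/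
theorem exists_local_left_inverse [FiniteDimensional ℝ P] [FiniteDimensional ℝ W] {f : P → W}
    {u₀ : P} (hf : ContDiffAt ℝ ω f u₀) (hinj : Function.Injective (fderiv ℝ f u₀)) :
    ∃ g : W → P, ∀ᶠ u in 𝓝 u₀, ContDiffAt ℝ ω f u ∧ g (f u) = u ∧
      ∀ᶠ y in 𝓝 (f u), ContDiffAt ℝ ω g y := by
  have : CompleteSpace P := FiniteDimensional.complete ℝ P
  -- With a linear left inverse `l` of the derivative, `l ∘ f` has derivative the identity at `u₀`,
  -- and the inverse function theorem applies to it.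
  obtain ⟨l', hl'⟩ := (fderiv ℝ f u₀ : P →ₗ[ℝ] W).exists_leftInverse_of_injective
    (LinearMap.ker_eq_bot.2 hinj)
  let l : W →L[ℝ] P := LinearMap.toContinuousLinearMap l'
  have hH : ContDiffAt ℝ ω (l ∘ f) u₀ := l.contDiff.contDiffAt.comp _ hf
  have hd : HasFDerivAt (l ∘ f) ((ContinuousLinearEquiv.refl ℝ P : P ≃L[ℝ] P) : P →L[ℝ] P) u₀ := by
    have h1 := l.hasFDerivAt.comp u₀ (hf.differentiableAt (by simp)).hasFDerivAt
    convert h1 using 1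
    ext v
    exact (LinearMap.congr_fun hl' v).symm
  have hinv := hH.to_localInverse hd (by simp)
  have hleft := (hH.hasStrictFDerivAt' hd (by simp)).eventually_left_inverse
  refine ⟨hH.localInverse hd (by simp) ∘ l, ?_⟩
  have hG : ∀ᶠ y in 𝓝 (f u₀), ContDiffAt ℝ ω (hH.localInverse hd (by simp) ∘ l) y :=
    ContDiffAt.eventually (ContDiffAt.comp (f u₀) hinv l.contDiff.contDiffAt) (by simp)
  filter_upwards [hf.eventually (by simp), hleft,
    hf.continuousAt.eventually (eventually_eventually_nhds.2 hG)] with u h1 h2 h3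
  exact ⟨h1, h2, h3⟩

/-- The dimension of a set with charts is at most the number of parameters. -/
theorem HasCharts.dimH_le [FiniteDimensional ℝ W] {k : ℕ} {M : Set W} (h : HasCharts k M) :
    dimH M ≤ k := by
  have : ProperSpace W := FiniteDimensional.proper ℝ W
  by_contra! hlt
  -- A dimension above `k` would be attained in every neighbourhood of some point, whereas chart
  -- neighbourhoods lie in `C¹` images of balls of `ℝ^k`.
  obtain ⟨x, hx, hdim⟩ := exists_mem_nhdsWithin_lt_dimH_of_lt_dimH hlt
  obtain ⟨f, g, hfg⟩ := h x hx
  obtain ⟨r, hr, O, -, hO, hxO, hf, hg, hleft, hright⟩ := hfg.exists_ball univ_mem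
  have h1 := hdim (M ∩ O) (inter_mem_nhdsWithin _ (hO.mem_nhds hxO))
  have h2 : M ∩ O ⊆ f '' Metric.ball (g x) r :=
    fun y hy => ⟨g y, (hright y hy).1, (hright y hy).2⟩
  have h3 : ContDiffOn ℝ 1 f (Metric.ball (g x) r) :=
    fun u hu => ((hf u hu).of_le (by simp)).contDiffWithinAt
  have h4 := h3.dimH_image_le (convex_ball _ _) subset_rfl
  have h5 := (dimH_mono (subset_univ (Metric.ball (g x) r))).trans_eq
    (Real.dimH_univ_eq_finrank (EuclideanSpace ℝ (Fin k)))
  rw [finrank_euclideanSpace_fin] at h5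
  exact absurd (h1.trans_le ((dimH_mono h2).trans (h4.trans h5))) (lt_irrefl _)

variable {Y : Type*} [NormedAddCommGroup Y] [NormedSpace ℝ Y]

/-- The points of `M` at which `b` is injective on the tangent vectors. -/
def immersionPoints (M : Set W) (b : W →L[ℝ] Y) : Set W :=
  {y ∈ M | ∀ ξ ∈ tangentVectors M y, b ξ = 0 → ξ = 0}

theorem IsChartAt.mem_immersionPoints_iff {M : Set W} {x : W} {f : P → W} {g : W → P}
    (h : IsChartAt M x f g) (hx : x ∈ M) (b : W →L[ℝ] Y) :
    x ∈ immersionPoints M b ↔ Function.Injective (fderiv ℝ (b ∘ f) (g x)) := by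
  have hf : DifferentiableAt ℝ f (g x) := h.analytic.differentiableAt (by simp)
  have hd : fderiv ℝ (b ∘ f) (g x) = b.comp (fderiv ℝ f (g x)) :=
    (b.hasFDerivAt.comp _ hf.hasFDerivAt).fderiv
  have hfi : Function.Injective (fderiv ℝ f (g x)) :=
    Function.LeftInverse.injective h.fderiv_comp
  rw [hd, injective_iff_map_eq_zero]
  simp only [immersionPoints, mem_ofPred_eq, hx, true_and, h.tangentVectors_eq,
    forall_mem_range, ContinuousLinearMap.comp_apply]
  refine forall_congr' fun η => imp_congr_right fun _ => ?_
  exact map_eq_zero_iff _ hfi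

/-- An analytic map on a ball whose derivative is injective somewhere has an injective derivative on
a dense set. -/
theorem ball_subset_closure_injective_fderiv [FiniteDimensional ℝ P] [FiniteDimensional ℝ Y]
    {F : P → Y} {c : P} {r : ℝ} (hF : ∀ u ∈ Metric.ball c r, ContDiffAt ℝ ω F u) {u₁ : P}
    (hu₁ : u₁ ∈ Metric.ball c r) (hinj : Function.Injective (fderiv ℝ F u₁)) :
    Metric.ball c r ⊆
      closure {u ∈ Metric.ball c r | Function.Injective (fderiv ℝ F u)} := by
  -- The determinant of `l ∘ F'(u)` is analytic in `u`, equals one at `u₁` because `l` is a left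
  -- inverse there, and forces `F'(u)` to be injective wherever it does not vanish.
  obtain ⟨l, hl⟩ := (fderiv ℝ F u₁ : P →ₗ[ℝ] Y).exists_leftInverse_of_injective
    (LinearMap.ker_eq_bot.2 hinj)
  let B := Module.finBasis ℝ P
  let δ : P → ℝ := fun u => (LinearMap.toMatrix B B (l ∘ₗ (fderiv ℝ F u : P →ₗ[ℝ] Y))).det
  have hδ : AnalyticOnNhd ℝ δ (Metric.ball c r) := by
    intro u hu
    have hd : ContDiffAt ℝ ω (fderiv ℝ F) u := (hF u hu).fderiv_right (by simp)
    have hentry : ∀ i j, ContDiffAt ℝ ω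
        (fun u => LinearMap.toMatrix B B (l ∘ₗ (fderiv ℝ F u : P →ₗ[ℝ] Y)) i j) u := by
      intro i j
      simp only [LinearMap.toMatrix_apply]
      let A : Y →L[ℝ] ℝ := LinearMap.toContinuousLinearMap ((B.coord i) ∘ₗ l)
      exact A.contDiff.contDiffAt.comp u (hd.clm_apply contDiffAt_const)
    refine ContDiffAt.analyticAt ?_
    simp only [δ, Matrix.det_apply]
    refine ContDiffAt.sum fun σ _ => ContDiffAt.const_smul _ ?_
    exact contDiffAt_prod fun i _ => hentry _ _
  have hδ₁ : δ u₁ = 1 := by simp only [δ]; rw [hl]; simp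
  have hδinj : ∀ u, δ u ≠ 0 → Function.Injective (fderiv ℝ F u) := by
    intro u hu
    simp only [δ, LinearMap.det_toMatrix] at hu
    have h1 : Function.Injective (l ∘ₗ (fderiv ℝ F u : P →ₗ[ℝ] Y)) :=
      (LinearMap.equivOfDetNeZero _ hu).injective
    exact Function.Injective.of_comp (f := l) h1
  intro u hu
  by_contra hcl
  -- Off the closure `δ` vanishes on an open set, hence on the whole ball by the identity theorem,
  -- which contradicts its value at `u₁`.
  have h0 : δ =ᶠ[𝓝 u] 0 := by
    rw [mem_closure_iff_frequently, not_frequently] at hcl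
    filter_upwards [hcl, Metric.isOpen_ball.mem_nhds hu] with v hv hvb
    by_contra hne
    exact hv ⟨hvb, hδinj v hne⟩
  have := hδ.eqOn_zero_of_preconnected_of_eventuallyEq_zero
    (convex_ball c r).isPreconnected hu h0 hu₁
  rw [hδ₁] at this
  exact one_ne_zero this

/-- In the connected component of a point at which `b` is an immersion, these points are dense. -/
theorem HasCharts.connectedComponentIn_subset_closure [FiniteDimensional ℝ Y] {k : ℕ} {M : Set W}
    (h : HasCharts k M) (b : W →L[ℝ] Y) {x : W} (hx : x ∈ immersionPoints M b) :
    connectedComponentIn M x ⊆ closure (connectedComponentIn M x ∩ immersionPoints M b) := by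
  set T := immersionPoints M b with hT
  -- Each point has a connected chart neighbourhood in which the immersion points are either absent
  -- or dense.
  have hlocal : ∀ y ∈ M, ∃ O : Set W, IsOpen O ∧ y ∈ O ∧ IsPreconnected (M ∩ O) ∧
      ((T ∩ O).Nonempty → M ∩ O ⊆ closure (T ∩ O)) := by
    intro y hy
    obtain ⟨f, g, hfg⟩ := h y hy
    obtain ⟨r, hr, O, -, hO, hyO, hf, hg, hleft, hright⟩ := hfg.exists_ball univ_mem
    have himage : M ∩ O = f '' Metric.ball (g y) r := by
      ext z
      constructor
      · exact fun hz => ⟨g z, (hright z hz).1, (hright z hz).2⟩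
      · rintro ⟨u, hu, rfl⟩
        exact (hleft u hu).1
    have hfc : ContinuousOn f (Metric.ball (g y) r) :=
      fun u hu => (hf u hu).continuousAt.continuousWithinAt
    have hiff : ∀ u ∈ Metric.ball (g y) r,
        (f u ∈ T ↔ Function.Injective (fderiv ℝ (b ∘ f) u)) := by
      intro u hu
      have := (hleft u hu).2.2.mem_immersionPoints_iff (hleft u hu).1.1 b
      rwa [(hleft u hu).2.1] at this
    refine ⟨O, hO, hyO, ?_, ?_⟩
    · rw [himage]
      exact (convex_ball _ _).isPreconnected.image f hfc
    · rintro ⟨z, hzT, hzO⟩ w hw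
      obtain ⟨hz1, hz2⟩ := hright z ⟨hzT.1, hzO⟩
      obtain ⟨hw1, hw2⟩ := hright w hw
      have hcl := ball_subset_closure_injective_fderiv (F := b ∘ f)
        (fun u hu => b.contDiff.contDiffAt.comp u (hf u hu)) hz1
        ((hiff _ hz1).1 (by rwa [hz2])) hw1
      have := mem_closure_image (hf _ hw1).continuousAt hcl
      rw [hw2] at this
      refine closure_mono ?_ this
      rintro _ ⟨u, ⟨hu, hui⟩, rfl⟩
      exact ⟨(hiff u hu).2 hui, (hleft u hu).1.2⟩
  choose! O hO hyO hconn hdense using hlocal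
  set C := connectedComponentIn M x with hC
  have hCM : C ⊆ M := connectedComponentIn_subset M x
  have hxC : x ∈ C := mem_connectedComponentIn hx.1
  -- The neighbourhoods of the two kinds form two open sets that cover the component. If both met
  -- it, they would have a common point in it, and density in the first neighbourhood would produce
  -- an immersion point in the second.
  have hgood : ∀ y ∈ C, (T ∩ O y).Nonempty := by
    by_contra! hbad
    obtain ⟨y, hyC, hy⟩ := hbad
    obtain ⟨z, hzC, hz1, hz2⟩ := (isPreconnected_connectedComponentIn (x := x) (F := M))
      (⋃ y ∈ {y ∈ M | (T ∩ O y).Nonempty}, O y) (⋃ y ∈ {y ∈ M | T ∩ O y = ∅}, O y)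
      (isOpen_biUnion fun y hy => hO y hy.1) (isOpen_biUnion fun y hy => hO y hy.1)
      (fun y hy => by
        rcases (T ∩ O y).eq_empty_or_nonempty with he | hne
        · exact Or.inr (mem_biUnion (show y ∈ {y ∈ M | T ∩ O y = ∅} from ⟨hCM hy, he⟩)
            (hyO y (hCM hy)))
        · exact Or.inl (mem_biUnion (show y ∈ {y ∈ M | (T ∩ O y).Nonempty} from ⟨hCM hy, hne⟩)
            (hyO y (hCM hy))))
      ⟨x, hxC, mem_biUnion (show x ∈ {y ∈ M | (T ∩ O y).Nonempty} from
        ⟨hx.1, x, hx, hyO x hx.1⟩) (hyO x hx.1)⟩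
      ⟨y, hyC, mem_biUnion (show y ∈ {y ∈ M | T ∩ O y = ∅} from ⟨hCM hyC, hy⟩) (hyO y (hCM hyC))⟩
    simp only [mem_iUnion, exists_prop] at hz1 hz2
    obtain ⟨y₁, ⟨hy₁, hne⟩, hz1⟩ := hz1
    obtain ⟨y₂, ⟨hy₂, he⟩, hz2⟩ := hz2
    obtain ⟨w, hw2, hwT, -⟩ := mem_closure_iff.1 (hdense y₁ hy₁ hne ⟨hCM hzC, hz1⟩) _ (hO y₂ hy₂) hz2
    exact (he.subset ⟨hwT, hw2⟩ : w ∈ (∅ : Set W))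
  intro y hy
  refine closure_mono ?_ (hdense y (hCM hy) (hgood y hy) ⟨hCM hy, hyO y (hCM hy)⟩)
  intro z hz
  refine ⟨?_, hz.1⟩
  rw [hC, connectedComponentIn_eq hy]
  exact (hconn y (hCM hy)).subset_connectedComponentIn ⟨hCM hy, hyO y (hCM hy)⟩ inter_subset_left
    ⟨hz.1.1, hz.2⟩

/-- Near a point at which `b` is an immersion, `b` maps `M` injectively onto a submanifold. -/
theorem HasCharts.exists_image_isSubmanifold [FiniteDimensional ℝ Y] {k : ℕ} {M : Set W}
    (h : HasCharts k M)
    (b : W →L[ℝ] Y) {x : W} (hx : x ∈ immersionPoints M b) :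
    ∃ O : Set W, IsOpen O ∧ x ∈ O ∧ InjOn b (M ∩ O) ∧ IsSubmanifold k (b '' (M ∩ O)) ∧
      (k : ENNReal) ≤ dimH (b '' (M ∩ O)) := by
  obtain ⟨f, g, hfg⟩ := h x hx.1
  -- The pair `b ∘ f`, `G` gives charts of the image. Since `G` is locally Lipschitz and maps the
  -- image onto a ball of `ℝ^k`, it also bounds the dimension from below.
  obtain ⟨G, hG⟩ := exists_local_left_inverse (b.contDiff.contDiffAt.comp _ hfg.analytic)
    ((hfg.mem_immersionPoints_iff hx.1 b).1 hx)
  obtain ⟨r, hr, O, hV, hO, hxO, hf, hg, hleft, hright⟩ := hfg.exists_ball hG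
  have himage : M ∩ O = f '' Metric.ball (g x) r := by
    ext z
    constructor
    · exact fun hz => ⟨g z, (hright z hz).1, (hright z hz).2⟩
    · rintro ⟨u, hu, rfl⟩
      exact (hleft u hu).1
  have hcharts : HasCharts k (b '' (M ∩ O)) := by
    rw [himage]
    rintro _ ⟨_, ⟨u, hu, rfl⟩, rfl⟩
    obtain ⟨h1, h2, h3⟩ := hV hu
    rw [Function.comp_apply] at h2
    refine ⟨b ∘ f, G, by rwa [h2], by rw [h2]; rfl, ?_,
      h3.mono fun y hy => hy.differentiableAt (by simp), ?_⟩
    · rw [h2]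
      filter_upwards [Metric.isOpen_ball.mem_nhds hu] with v hv
        using ⟨⟨_, ⟨v, hv, rfl⟩, rfl⟩, (hV hv).2.1⟩
    · filter_upwards [self_mem_nhdsWithin]
      rintro _ ⟨_, ⟨v, hv, rfl⟩, rfl⟩
      have := (hV hv).2.1
      rw [Function.comp_apply] at this
      rw [this, Function.comp_apply]
  refine ⟨O, hO, hxO, ?_, hcharts.isSubmanifold, ?_⟩
  · rw [himage]
    rintro _ ⟨u, hu, rfl⟩ _ ⟨v, hv, rfl⟩ huv
    have hu' := (hV hu).2.1
    have hv' := (hV hv).2.1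
    rw [Function.comp_apply] at hu' hv'
    rw [← hu', huv, hv']
  · have hG' : G '' (b '' (M ∩ O)) = Metric.ball (g x) r := by
      rw [himage, image_image, image_image]
      exact (image_congr fun u hu => (hV hu).2.1).trans (image_id' _)
    have := FiniteDimensional.proper ℝ Y
    have h1 : dimH (G '' (b '' (M ∩ O))) ≤ dimH (b '' (M ∩ O)) := by
      refine dimH_image_le_of_locally_lipschitzOn fun y hy => ?_
      rw [himage] at hy
      obtain ⟨_, ⟨u, hu, rfl⟩, rfl⟩ := hy
      obtain ⟨C, t, ht, hC⟩ := (((hV hu).2.2.self_of_nhds).of_le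
        (show (1 : WithTop ℕ∞) ≤ ω by simp)).exists_lipschitzOnWith
      exact ⟨C, t, mem_nhdsWithin_of_mem_nhds ht, hC⟩
    rwa [hG', Real.dimH_of_mem_nhds (Metric.ball_mem_nhds _ hr), finrank_euclideanSpace_fin] at h1

end Charts

/-! ### Local sections of the projectivization; charts of the fibres -/

section Projective

variable {E : Type*} [NormedAddCommGroup E] [InnerProductSpace ℝ E]

/-- The fibre component `(Q₋, Q₊)` of a covector. -/
noncomputable def covec (p : (E × E) × (E × E)) : WithLp 2 (E × E) := WithLp.toLp 2 (p.1.2, p.2.2)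

theorem covec_scale (c : ℝ) (p : (E × E) × (E × E)) : covec (scale c p) = c • covec p := rfl

theorem inner_covec (p p' : (E × E) × (E × E)) :
    ⟪covec p, covec p'⟫ = ⟪p.1.2, p'.1.2⟫ + ⟪p.2.2, p'.2.2⟫ :=
  WithLp.prod_inner_apply _ _

theorem norm_covec_sq (p : (E × E) × (E × E)) :
    ‖covec p‖ ^ 2 = ⟪p.1.2, p.1.2⟫ + ⟪p.2.2, p.2.2⟫ := by
  rw [← real_inner_self_eq_norm_sq, inner_covec]

omit [InnerProductSpace ℝ E] in
theorem covec_ne_zero {p : (E × E) × (E × E)} : covec p ≠ 0 ↔ (p.1.2, p.2.2) ≠ 0 := by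
  rw [covec, Ne, WithLp.toLp_eq_zero]

@[fun_prop]
theorem contDiff_covec {n : WithTop ℕ∞} : ContDiff ℝ n (covec : (E × E) × (E × E) → _) := by
  have h : ContDiff ℝ n fun p : (E × E) × (E × E) => (p.1.2, p.2.2) := by fun_prop
  exact (WithLp.prodContinuousLinearEquiv 2 ℝ E E).symm.contDiff.comp h

theorem scale_scale (c c' : ℝ) (p : (E × E) × (E × E)) :
    scale c (scale c' p) = scale (c * c') p := by
  simp [scale, mul_smul]

theorem scale_one (p : (E × E) × (E × E)) : scale 1 p = p := by
  simp [scale]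

theorem projClass_scale {c : ℝ} (hc : c ≠ 0) (p : (E × E) × (E × E)) :
    projClass (scale c p) = projClass p := by
  have h := Submodule.span_singleton_smul_eq (R := ℝ) (IsUnit.mk0 c hc) (covec p)
  rw [← covec_scale] at h
  simp only [covec] at h
  simp only [projClass]
  simp only [h]
  rfl

theorem scale_mem_cotangentNonzero {c : ℝ} (hc : c ≠ 0) {p : (E × E) × (E × E)}
    (hp : p ∈ cotangentNonzero E) : scale c p ∈ cotangentNonzero E := by
  obtain ⟨h1, h2, h3, h4⟩ := hp
  refine ⟨h1, by simp [scale, inner_smul_right, h2], by simp [scale, inner_smul_right, h3], ?_⟩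
  rw [← covec_ne_zero] at h4 ⊢
  rw [covec_scale]
  exact smul_ne_zero hc h4

theorem baseProj_projClass (p : (E × E) × (E × E)) : baseProj (projClass p) = (p.1.1, p.2.1) := rfl

theorem projClass_snd_apply (p : (E × E) × (E × E)) (w : WithLp 2 (E × E)) :
    (projClass p).2.2 w = (⟪covec p, w⟫ / ‖covec p‖ ^ 2) • covec p :=
  Submodule.starProjection_singleton ℝ w

theorem contDiffAt_starProjection_span_singleton {H : Type*} [NormedAddCommGroup H]
    [InnerProductSpace ℝ H] {n : WithTop ℕ∞} {w : H} (hw : w ≠ 0) :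
    ContDiffAt ℝ n (fun w : H => (Submodule.span ℝ {w}).starProjection) w := by
  have h : (fun w : H => (Submodule.span ℝ {w}).starProjection)
      = fun w => (‖w‖ ^ 2)⁻¹ • (innerSL ℝ w).smulRight w := by
    funext w
    ext1 z
    rw [Submodule.starProjection_singleton]
    simp [smul_smul, div_eq_inv_mul]
  rw [h]
  have h1 : ContDiffAt ℝ n (fun w : H => (‖w‖ ^ 2)⁻¹) w :=
    ((contDiff_norm_sq ℝ).contDiffAt).inv (by simpa using hw)
  exact h1.smul ((innerSL ℝ).contDiff.contDiffAt.smulRight contDiffAt_id)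

theorem contDiffAt_projClass {n : WithTop ℕ∞} {p : (E × E) × (E × E)} (hp : covec p ≠ 0) :
    ContDiffAt ℝ n projClass p :=
  contDiffAt_fst.fst.prodMk (contDiffAt_snd.fst.prodMk
    ((contDiffAt_starProjection_span_singleton hp).comp p contDiff_covec.contDiffAt))

/-- The representative `p` of `y` with `⟪Q, Q₀⟫ = ‖Q₀‖ ^ 2`, where `Q₀` is the fibre component
of `p₀`. -/
noncomputable def normLift (p₀ : (E × E) × (E × E)) (y : ProjAmbient E) : (E × E) × (E × E) :=
  let κ := ‖covec p₀‖ ^ 2 / ⟪covec p₀, y.2.2 (covec p₀)⟫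
  ((y.1, κ • (y.2.2 (covec p₀)).fst), (y.2.1, κ • (y.2.2 (covec p₀)).snd))

/-- The projection onto the line of `covec p` sends `covec p₀` to a multiple of `covec p`. Thus
`normLift p₀` is a section of `projClass` over the classes not orthogonal to `covec p₀`, as in an
affine chart of projective space. -/
theorem normLift_projClass {p₀ p : (E × E) × (E × E)} (h : ⟪covec p₀, covec p⟫ ≠ 0) :
    normLift p₀ (projClass p) = scale (‖covec p₀‖ ^ 2 / ⟪covec p₀, covec p⟫) p := by
  have hp : ‖covec p‖ ≠ 0 := by
    rw [norm_ne_zero_iff]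
    rintro h0
    simp [h0] at h
  have hκ : ‖covec p₀‖ ^ 2 / ⟪covec p₀, (projClass p).2.2 (covec p₀)⟫ *
      (⟪covec p, covec p₀⟫ / ‖covec p‖ ^ 2) = ‖covec p₀‖ ^ 2 / ⟪covec p₀, covec p⟫ := by
    rw [projClass_snd_apply, inner_smul_right, real_inner_comm]
    field_simp
  simp only [normLift, scale, ← hκ]
  simp only [projClass_snd_apply, mul_smul]
  rfl

theorem normLift_projClass_self {p₀ p : (E × E) × (E × E)} (h0 : covec p₀ ≠ 0)
    (h : ⟪covec p₀, covec p⟫ = ‖covec p₀‖ ^ 2) : normLift p₀ (projClass p) = p := by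
  have : ‖covec p₀‖ ^ 2 ≠ 0 := by simpa using h0
  rw [normLift_projClass (by rwa [h]), h, div_self this, scale_one]

theorem inner_covec_ne_zero_of_projClass {p₀ p : (E × E) × (E × E)}
    (h : ⟪covec p₀, (projClass p).2.2 (covec p₀)⟫ ≠ 0) : ⟪covec p₀, covec p⟫ ≠ 0 := by
  rintro h0
  rw [projClass_snd_apply, inner_smul_right, h0, mul_zero] at h
  exact h rfl

theorem contDiffAt_normLift {n : WithTop ℕ∞} {p₀ : (E × E) × (E × E)} {y : ProjAmbient E}
    (hy : ⟪covec p₀, y.2.2 (covec p₀)⟫ ≠ 0) : ContDiffAt ℝ n (normLift p₀) y := by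
  have h1 : ContDiffAt ℝ n (fun y : ProjAmbient E => y.2.2 (covec p₀)) y := by fun_prop
  have h2 : ContDiffAt ℝ n
      (fun y : ProjAmbient E => ‖covec p₀‖ ^ 2 / ⟪covec p₀, y.2.2 (covec p₀)⟫) y :=
    contDiffAt_const.div (contDiffAt_const.inner ℝ h1) hy
  have h3 : ContDiffAt ℝ n (fun y : ProjAmbient E => (y.2.2 (covec p₀)).ofLp) y :=
    (WithLp.prodContinuousLinearEquiv 2 ℝ E E).contDiff.contDiffAt.comp y h1
  have h4 : ContDiffAt ℝ n (fun y : ProjAmbient E => (y.2.2 (covec p₀)).fst) y := h3.fst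
  have h5 : ContDiffAt ℝ n (fun y : ProjAmbient E => (y.2.2 (covec p₀)).snd) y := h3.snd
  exact (contDiffAt_fst.prodMk (h2.smul h4)).prodMk
    ((contDiffAt_fst.comp y contDiffAt_snd).prodMk (h2.smul h5))

theorem eventually_inner_projClass_ne_zero {p₀ : (E × E) × (E × E)} (h0 : covec p₀ ≠ 0) :
    ∀ᶠ y in 𝓝 (projClass p₀), ⟪covec p₀, y.2.2 (covec p₀)⟫ ≠ 0 := by
  have hc : Continuous fun y : ProjAmbient E => ⟪covec p₀, y.2.2 (covec p₀)⟫ := by fun_prop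
  refine hc.continuousAt.eventually_ne ?_
  have : ‖covec p₀‖ ≠ 0 := by simpa using h0
  rw [projClass_snd_apply, inner_smul_right, real_inner_self_eq_norm_sq]
  field_simp
  simpa using h0

section Fibre

/-- The map whose kernel parametrizes the covectors `(a, b)` over a given base point that are
normal to the fibre component `(Q₋, Q₊)`. -/
noncomputable def normalConstraint (p₀ : (E × E) × (E × E)) : E × E →ₗ[ℝ] ℝ × ℝ × ℝ :=
  ((innerₗ E p₀.1.1).comp (LinearMap.fst ℝ E E)).prod
    (((innerₗ E p₀.2.1).comp (LinearMap.snd ℝ E E)).prod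
      ((innerₗ E p₀.1.2).comp (LinearMap.fst ℝ E E) +
        (innerₗ E p₀.2.2).comp (LinearMap.snd ℝ E E)))

theorem normalConstraint_apply (p₀ : (E × E) × (E × E)) (a : E × E) :
    normalConstraint p₀ a = (⟪p₀.1.1, a.1⟫, ⟪p₀.2.1, a.2⟫, ⟪p₀.1.2, a.1⟫ + ⟪p₀.2.2, a.2⟫) := rfl

theorem cotangentNonzero.inner_self {p₀ : (E × E) × (E × E)} (h : p₀ ∈ cotangentNonzero E) :
    ⟪p₀.1.1, p₀.1.1⟫ = 1 ∧ ⟪p₀.2.1, p₀.2.1⟫ = 1 := by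
  obtain ⟨⟨h1, h2⟩, -⟩ := h
  rw [mem_sphere_zero_iff_norm] at h1 h2
  simp only at h1 h2
  exact ⟨by rw [real_inner_self_eq_norm_sq, h1, one_pow],
    by rw [real_inner_self_eq_norm_sq, h2, one_pow]⟩

theorem cotangentNonzero.covec_ne_zero {p₀ : (E × E) × (E × E)} (h : p₀ ∈ cotangentNonzero E) :
    covec p₀ ≠ 0 := PointBilliard.covec_ne_zero.2 h.2.2.2

theorem normalConstraint_surjective {p₀ : (E × E) × (E × E)} (h : p₀ ∈ cotangentNonzero E) :
    Function.Surjective (normalConstraint p₀) := by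
  obtain ⟨h1, h2⟩ := cotangentNonzero.inner_self h
  have h3 := cotangentNonzero.covec_ne_zero h
  obtain ⟨-, h4, h5, -⟩ := h
  have h6 : ⟪p₀.1.2, p₀.1.2⟫ + ⟪p₀.2.2, p₀.2.2⟫ ≠ 0 := by
    rw [← norm_covec_sq]; simpa using h3
  rintro ⟨α, β, γ⟩
  refine ⟨(α • p₀.1.1 + (γ / (⟪p₀.1.2, p₀.1.2⟫ + ⟪p₀.2.2, p₀.2.2⟫)) • p₀.1.2,
    β • p₀.2.1 + (γ / (⟪p₀.1.2, p₀.1.2⟫ + ⟪p₀.2.2, p₀.2.2⟫)) • p₀.2.2), ?_⟩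
  rw [normalConstraint_apply]
  simp only [inner_add_right, inner_smul_right, h1, h2, h4, h5, real_inner_comm p₀.1.1 p₀.1.2,
    real_inner_comm p₀.2.1 p₀.2.2]
  refine Prod.ext (by simp) (Prod.ext (by simp) ?_)
  simp only [mul_zero, zero_add]
  rw [← mul_add, div_mul_cancel₀ _ h6]

variable [FiniteDimensional ℝ E]

/-- Affine chart of projective space: classes near that of `Q₀` are represented uniquely by `Q₀ + a`
with `a` orthogonal to `Q₀`. Tangency to the two spheres imposes two further conditions on `a ∈ E ×
E`. -/
theorem projCotangent_fibre_hasCharts (hn : 2 ≤ Module.finrank ℝ E) (b : E × E) :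
    HasCharts (2 * Module.finrank ℝ E - 3) (projCotangent E ∩ baseProj ⁻¹' {b}) := by
  rintro _ ⟨⟨p₀, hp₀, rfl⟩, rfl⟩
  have h0 := cotangentNonzero.covec_ne_zero hp₀
  have hself := inner_covec p₀ p₀
  rw [real_inner_self_eq_norm_sq] at hself
  obtain ⟨-, hv1, hv2, -⟩ := id hp₀
  let cov : E × E → (E × E) × (E × E) :=
    fun a => ((p₀.1.1, p₀.1.2 + a.1), (p₀.2.1, p₀.2.2 + a.2))
  have hcov : ContDiff ℝ ω cov := by fun_prop
  have hcov0 : cov 0 = p₀ := by simp [cov]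
  have hfcont : ContDiffAt ℝ ω (fun a => projClass (cov a)) 0 :=
    ContDiffAt.comp (g := projClass) (f := cov) 0
      (by rw [hcov0]; exact contDiffAt_projClass h0) hcov.contDiffAt
  refine exists_isChartAt_of_ker (normalConstraint p₀) (normalConstraint_surjective hp₀)
    (f := fun a => projClass (cov a))
    (g := fun y => ((normLift p₀ y).1.2 - p₀.1.2, (normLift p₀ y).2.2 - p₀.2.2))
    (by simp; omega) ?_ hfcont (by rw [hcov0]) ?_ ?_ ?_
  · rw [normLift_projClass_self h0 (real_inner_self_eq_norm_sq _)]
    simp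
  · have hne : ∀ᶠ a in 𝓝 (0 : E × E), covec (cov a) ≠ 0 :=
      ((contDiff_covec (n := ω)).continuous.comp hcov.continuous).continuousAt.eventually_ne
        (by simpa [hcov0] using h0)
    filter_upwards [hne] with a ha hφ
    rw [normalConstraint_apply, Prod.mk_eq_zero, Prod.mk_eq_zero] at hφ
    obtain ⟨e1, e2, e3⟩ := hφ
    refine ⟨⟨⟨cov a, ⟨hp₀.1, ?_, ?_, covec_ne_zero.1 ha⟩, rfl⟩, ?_⟩, ?_⟩
    · simp [cov, inner_add_right, hv1, e1]
    · simp [cov, inner_add_right, hv2, e2]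
    · rw [mem_preimage, baseProj_projClass, baseProj_projClass]
      exact mem_singleton _
    · rw [normLift_projClass_self h0]
      · simp [cov]
      · rw [inner_covec, hself]
        simp only [cov, inner_add_right]
        linarith
  · filter_upwards [eventually_inner_projClass_ne_zero h0] with y hy
    have := (contDiffAt_normLift (n := 1) hy).differentiableAt (by simp)
    fun_prop
  · filter_upwards [self_mem_nhdsWithin,
      mem_nhdsWithin_of_mem_nhds (eventually_inner_projClass_ne_zero h0)]
    rintro _ ⟨⟨p, hp, rfl⟩, hb⟩ hy
    have hne := inner_covec_ne_zero_of_projClass hy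
    have hbase : p.1.1 = p₀.1.1 ∧ p.2.1 = p₀.2.1 := by
      rw [mem_preimage, baseProj_projClass, baseProj_projClass] at hb
      exact Prod.mk_inj.1 hb
    have hn0 : ‖covec p₀‖ ≠ 0 := by simpa using h0
    set κ := ‖covec p₀‖ ^ 2 / ⟪covec p₀, covec p⟫ with hκ
    have hκ0 : κ ≠ 0 := div_ne_zero (pow_ne_zero 2 hn0) hne
    have hκe : κ * (⟪p₀.1.2, p.1.2⟫ + ⟪p₀.2.2, p.2.2⟫)
        = ⟪p₀.1.2, p₀.1.2⟫ + ⟪p₀.2.2, p₀.2.2⟫ := by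
      rw [← inner_covec, ← hself, hκ, div_mul_cancel₀ _ hne]
    rw [normLift_projClass hne]
    refine ⟨?_, ?_⟩
    · rw [normalConstraint_apply]
      have e1 : ⟪p₀.1.1, p.1.2⟫ = 0 := hbase.1 ▸ hp.2.1
      have e2 : ⟪p₀.2.1, p.2.2⟫ = 0 := hbase.2 ▸ hp.2.2.1
      simp only [scale, inner_sub_right, inner_smul_right, hv1, hv2, e1, e2]
      refine Prod.ext (by simp) (Prod.ext (by simp) ?_)
      simp only [Prod.snd_zero]
      linarith
    · have : cov ((scale κ p).1.2 - p₀.1.2, (scale κ p).2.2 - p₀.2.2) = scale κ p := by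
        simp [cov, scale, hbase.1, hbase.2]
      rw [this, projClass_scale hκ0]

end Fibre

end Projective

/-! ### Charts of the projectivized cotangent bundle -/

section Total

variable {E : Type*} [NormedAddCommGroup E] [InnerProductSpace ℝ E]

/-- The component of `w` orthogonal to the unit vector `v`. -/
noncomputable def orthPart (v w : E) : E := w - ⟪v, w⟫ • v

theorem inner_orthPart {v : E} (hv : ⟪v, v⟫ = 1) (w : E) : ⟪v, orthPart v w⟫ = 0 := by
  simp [-inner_self_eq_norm_sq_to_K, orthPart, inner_sub_right, inner_smul_right, hv]

theorem inner_orthPart_of_inner_eq_zero {v Q : E} (h : ⟪v, Q⟫ = 0) (w : E) :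
    ⟪Q, orthPart v w⟫ = ⟪Q, w⟫ := by
  simp [orthPart, inner_sub_right, inner_smul_right, real_inner_comm v Q, h]

theorem differentiable_orthPart (v : E) : Differentiable ℝ (orthPart v) :=
  differentiable_id.sub (((innerSL ℝ v).differentiable).smul_const v)

/-- A parametrization of the cotangent bundle of the unit sphere near `(v, Q)`. -/
noncomputable def sphereCotangentChart (v Q : E) (a : E × E) : E × E :=
  (a.1 + √(1 - ‖a.1‖ ^ 2) • v, Q + a.2 - (⟪a.1, Q + a.2⟫ / √(1 - ‖a.1‖ ^ 2)) • v)

theorem sphereCotangentChart_zero (v Q : E) : sphereCotangentChart v Q 0 = (v, Q) := by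
  simp [sphereCotangentChart]

theorem contDiffAt_sphereCotangentChart (v Q : E) :
    ContDiffAt ℝ ω (sphereCotangentChart v Q) 0 := by
  have h1 : ContDiffAt ℝ ω (fun a : E × E => √(1 - ‖a.1‖ ^ 2)) 0 := by
    refine ContDiffAt.sqrt ?_ (by simp)
    exact contDiffAt_const.sub (contDiffAt_fst.norm_sq ℝ)
  have h2 : ContDiffAt ℝ ω (fun a : E × E => ⟪a.1, Q + a.2⟫ / √(1 - ‖a.1‖ ^ 2)) 0 :=
    (contDiffAt_fst.inner ℝ (contDiffAt_const.add contDiffAt_snd)).div h1 (by simp)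
  exact (contDiffAt_fst.add (h1.smul contDiffAt_const)).prodMk
    ((contDiffAt_const.add contDiffAt_snd).sub (h2.smul contDiffAt_const))

/-- The parts orthogonal to `v` are free coordinates; the `v`-component of the base point is fixed
by its unit norm, and that of the covector by orthogonality to the base point. -/
theorem sphereCotangentChart_spec {v Q : E} (hv : ⟪v, v⟫ = 1) (hQ : ⟪v, Q⟫ = 0) {a : E × E}
    (h1 : ⟪v, a.1⟫ = 0) (h2 : ⟪v, a.2⟫ = 0) (ha : ‖a.1‖ < 1) :
    ‖(sphereCotangentChart v Q a).1‖ = 1 ∧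
    ⟪(sphereCotangentChart v Q a).1, (sphereCotangentChart v Q a).2⟫ = 0 ∧
    orthPart v (sphereCotangentChart v Q a).1 = a.1 ∧
    orthPart v (sphereCotangentChart v Q a).2 = Q + a.2 := by
  have hpos : 0 < 1 - ‖a.1‖ ^ 2 := by nlinarith [norm_nonneg a.1]
  have hs : √(1 - ‖a.1‖ ^ 2) * √(1 - ‖a.1‖ ^ 2) = 1 - ‖a.1‖ ^ 2 := Real.mul_self_sqrt hpos.le
  have hs0 : √(1 - ‖a.1‖ ^ 2) ≠ 0 := (Real.sqrt_pos.2 hpos).ne'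
  have h1' : ⟪a.1, v⟫ = 0 := by rw [real_inner_comm]; exact h1
  have haa : ⟪a.1, a.1⟫ = ‖a.1‖ ^ 2 := real_inner_self_eq_norm_sq _
  simp only [sphereCotangentChart, orthPart]
  refine ⟨?_, ?_, ?_, ?_⟩
  · have : ‖a.1 + √(1 - ‖a.1‖ ^ 2) • v‖ ^ 2 = 1 := by
      rw [← real_inner_self_eq_norm_sq]
      simp only [inner_add_left, inner_add_right, inner_smul_left, inner_smul_right, h1, h1', hv,
        haa, conj_trivial]
      linarith
    exact (pow_eq_one_iff_of_nonneg (norm_nonneg _) two_ne_zero).1 this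
  · simp only [inner_add_left, inner_add_right, inner_sub_right, inner_smul_left,
      inner_smul_right, h1', hv, hQ, h2, conj_trivial]
    field_simp
    ring
  · simp [-inner_self_eq_norm_sq_to_K, inner_add_right, inner_smul_right, h1, hv]
  · simp [-inner_self_eq_norm_sq_to_K, inner_add_right, inner_sub_right, inner_smul_right, h2, hv,
      hQ]

/-- On the hemisphere around `v` the square root equals the positive number `⟪v, w⟫`, so orthogonal
parts invert the chart. -/
theorem sphereCotangentChart_orthPart {v Q w R : E} (hv : ⟪v, v⟫ = 1) (hw : ⟪w, w⟫ = 1)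
    (hR : ⟪w, R⟫ = 0) (hpos : 0 < ⟪v, w⟫) :
    sphereCotangentChart v Q (orthPart v w, orthPart v R - Q) = (w, R) := by
  have hn : 1 - ‖orthPart v w‖ ^ 2 = ⟪v, w⟫ ^ 2 := by
    rw [← real_inner_self_eq_norm_sq]
    simp only [orthPart, inner_sub_left, inner_sub_right, inner_smul_left, inner_smul_right, hv,
      hw, conj_trivial, real_inner_comm v w]
    ring
  have hs : √(1 - ‖orthPart v w‖ ^ 2) = ⟪v, w⟫ := by rw [hn, Real.sqrt_sq hpos.le]
  have ht : ⟪orthPart v w, orthPart v R⟫ = - (⟪v, w⟫ * ⟪v, R⟫) := by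
    simp only [orthPart, inner_sub_left, inner_sub_right, inner_smul_left, inner_smul_right, hv,
      hR, conj_trivial, real_inner_comm v w]
    ring
  simp only [sphereCotangentChart, add_sub_cancel, hs, ht]
  refine Prod.ext (by simp [orthPart]) ?_
  have : -(⟪v, w⟫ * ⟪v, R⟫) / ⟪v, w⟫ = -⟪v, R⟫ := by field_simp
  simp only [this, orthPart]
  module

/-- The constraints on the parameters of a chart of the projectivized cotangent bundle. -/
noncomputable def cotangentConstraint (p₀ : (E × E) × (E × E)) :
    (E × E) × (E × E) →ₗ[ℝ] ℝ × ℝ × ℝ × ℝ × ℝ :=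
  ((innerₗ E p₀.1.1).comp (LinearMap.fst ℝ E E ∘ₗ LinearMap.fst ℝ (E × E) (E × E))).prod
    (((innerₗ E p₀.2.1).comp (LinearMap.fst ℝ E E ∘ₗ LinearMap.snd ℝ (E × E) (E × E))).prod
      ((normalConstraint p₀).comp
        ((LinearMap.snd ℝ E E ∘ₗ LinearMap.fst ℝ (E × E) (E × E)).prod
          (LinearMap.snd ℝ E E ∘ₗ LinearMap.snd ℝ (E × E) (E × E)))))

theorem cotangentConstraint_apply (p₀ : (E × E) × (E × E)) (a : (E × E) × (E × E)) :
    cotangentConstraint p₀ a = (⟪p₀.1.1, a.1.1⟫, ⟪p₀.2.1, a.2.1⟫, ⟪p₀.1.1, a.1.2⟫,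
      ⟪p₀.2.1, a.2.2⟫, ⟪p₀.1.2, a.1.2⟫ + ⟪p₀.2.2, a.2.2⟫) := rfl

theorem cotangentConstraint_surjective {p₀ : (E × E) × (E × E)} (h : p₀ ∈ cotangentNonzero E) :
    Function.Surjective (cotangentConstraint p₀) := by
  obtain ⟨h1, h2⟩ := cotangentNonzero.inner_self h
  rintro ⟨α, β, z⟩
  obtain ⟨a, ha⟩ := normalConstraint_surjective h z
  refine ⟨((α • p₀.1.1, a.1), (β • p₀.2.1, a.2)), ?_⟩
  rw [cotangentConstraint_apply, ← ha, normalConstraint_apply]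
  simp [-inner_self_eq_norm_sq_to_K, inner_smul_right, h1, h2]

variable [FiniteDimensional ℝ E]

/-- Four constraints put the base and fibre coordinates into the tangent planes at the two base
points, and the fifth selects the representative with `⟪Q₀, Q⟫ = ‖Q₀‖ ^ 2`. -/
theorem projCotangent_hasCharts (hn : 2 ≤ Module.finrank ℝ E) :
    HasCharts (4 * Module.finrank ℝ E - 5) (projCotangent E) := by
  rintro _ ⟨p₀, hp₀, rfl⟩
  have h0 := cotangentNonzero.covec_ne_zero hp₀
  have hself := inner_covec p₀ p₀
  rw [real_inner_self_eq_norm_sq] at hself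
  obtain ⟨hs1, hs2⟩ := cotangentNonzero.inner_self hp₀
  obtain ⟨-, hv1, hv2, -⟩ := id hp₀
  let cov : (E × E) × (E × E) → (E × E) × (E × E) :=
    fun a => (sphereCotangentChart p₀.1.1 p₀.1.2 a.1, sphereCotangentChart p₀.2.1 p₀.2.2 a.2)
  have hcov : ContDiffAt ℝ ω cov 0 :=
    (ContDiffAt.comp (f := Prod.fst) (g := sphereCotangentChart p₀.1.1 p₀.1.2)
      (0 : (E × E) × (E × E)) (contDiffAt_sphereCotangentChart _ _) contDiffAt_fst).prodMk
    (ContDiffAt.comp (f := Prod.snd) (g := sphereCotangentChart p₀.2.1 p₀.2.2)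
      (0 : (E × E) × (E × E)) (contDiffAt_sphereCotangentChart _ _) contDiffAt_snd)
  have hcov0 : cov 0 = p₀ := by simp [cov, sphereCotangentChart_zero]
  have hfcont : ContDiffAt ℝ ω (fun a => projClass (cov a)) 0 :=
    ContDiffAt.comp (g := projClass) (f := cov) 0
      (by rw [hcov0]; exact contDiffAt_projClass h0) hcov
  refine exists_isChartAt_of_ker (cotangentConstraint p₀) (cotangentConstraint_surjective hp₀)
    (f := fun a => projClass (cov a))
    (g := fun y => ((orthPart p₀.1.1 (normLift p₀ y).1.1,
        orthPart p₀.1.1 (normLift p₀ y).1.2 - p₀.1.2),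
      (orthPart p₀.2.1 (normLift p₀ y).2.1, orthPart p₀.2.1 (normLift p₀ y).2.2 - p₀.2.2)))
    (by simp; omega) ?_ hfcont (by rw [hcov0]) ?_ ?_ ?_
  · rw [normLift_projClass_self h0 (real_inner_self_eq_norm_sq _)]
    simp [-inner_self_eq_norm_sq_to_K, orthPart, hs1, hs2, hv1, hv2]
  · have hne : ∀ᶠ a in 𝓝 (0 : (E × E) × (E × E)), covec (cov a) ≠ 0 :=
      (ContinuousAt.comp (g := covec) (f := cov)
        (contDiff_covec (n := ω)).continuous.continuousAt hcov.continuousAt).eventually_ne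
          (by simpa [hcov0] using h0)
    have hl1 : ∀ᶠ a in 𝓝 (0 : (E × E) × (E × E)), ‖a.1.1‖ < 1 :=
      (by fun_prop : ContinuousAt (fun a : (E × E) × (E × E) => ‖a.1.1‖) 0).eventually_lt_const
        (by simp)
    have hl2 : ∀ᶠ a in 𝓝 (0 : (E × E) × (E × E)), ‖a.2.1‖ < 1 :=
      (by fun_prop : ContinuousAt (fun a : (E × E) × (E × E) => ‖a.2.1‖) 0).eventually_lt_const
        (by simp)
    filter_upwards [hne, hl1, hl2] with a ha hl1 hl2 hφ
    simp only [cotangentConstraint_apply, Prod.mk_eq_zero] at hφ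
    obtain ⟨e1, e2, e3, e4, e5⟩ := hφ
    obtain ⟨k1, k2, k3, k4⟩ := sphereCotangentChart_spec hs1 hv1 e1 e3 hl1
    obtain ⟨l1, l2, l3, l4⟩ := sphereCotangentChart_spec hs2 hv2 e2 e4 hl2
    refine ⟨⟨cov a, ⟨⟨?_, ?_⟩, k2, l2, covec_ne_zero.1 ha⟩, rfl⟩, ?_⟩
    · rw [mem_sphere_zero_iff_norm]; exact k1
    · rw [mem_sphere_zero_iff_norm]; exact l1
    · rw [normLift_projClass_self h0]
      · simp only [cov, k3, k4, l3, l4, add_sub_cancel_left]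
      · rw [inner_covec, hself]
        simp only [cov]
        -- Pairing with `Q₀`, which is orthogonal to the base point, only sees the orthogonal part
        -- `Q₀ + a`; this is why the normalization is linear in the parameters.
        rw [← inner_orthPart_of_inner_eq_zero hv1, ← inner_orthPart_of_inner_eq_zero hv2, k4, l4,
          inner_add_right, inner_add_right]
        linarith
  · filter_upwards [eventually_inner_projClass_ne_zero h0] with y hy
    have := (contDiffAt_normLift (n := 1) hy).differentiableAt (by simp)
    have o1 := differentiable_orthPart p₀.1.1
    have o2 := differentiable_orthPart p₀.2.1
    fun_prop
  · have hp1 : ∀ᶠ y in 𝓝 (projClass p₀), 0 < ⟪p₀.1.1, y.1⟫ :=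
      (by fun_prop : Continuous fun y : ProjAmbient E => ⟪p₀.1.1, y.1⟫).continuousAt.eventually_const_lt
        (by simp only [projClass, hs1, one_pos])
    have hp2 : ∀ᶠ y in 𝓝 (projClass p₀), 0 < ⟪p₀.2.1, y.2.1⟫ :=
      (by fun_prop : Continuous fun y : ProjAmbient E => ⟪p₀.2.1, y.2.1⟫).continuousAt.eventually_const_lt
        (by simp only [projClass, hs2, one_pos])
    filter_upwards [self_mem_nhdsWithin, mem_nhdsWithin_of_mem_nhds hp1,
      mem_nhdsWithin_of_mem_nhds hp2,
      mem_nhdsWithin_of_mem_nhds (eventually_inner_projClass_ne_zero h0)]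
    rintro _ ⟨p, hp, rfl⟩ hp1 hp2 hy
    obtain ⟨ht1, ht2⟩ := cotangentNonzero.inner_self hp
    have hne := inner_covec_ne_zero_of_projClass hy
    have hn0 : ‖covec p₀‖ ≠ 0 := by simpa using h0
    set κ := ‖covec p₀‖ ^ 2 / ⟪covec p₀, covec p⟫ with hκ
    have hκ0 : κ ≠ 0 := div_ne_zero (pow_ne_zero 2 hn0) hne
    have hκe : κ * (⟪p₀.1.2, p.1.2⟫ + ⟪p₀.2.2, p.2.2⟫)
        = ⟪p₀.1.2, p₀.1.2⟫ + ⟪p₀.2.2, p₀.2.2⟫ := by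
      rw [← inner_covec, ← hself, hκ, div_mul_cancel₀ _ hne]
    obtain ⟨-, m1, m2, -⟩ := scale_mem_cotangentNonzero hκ0 hp
    rw [normLift_projClass hne, ← hκ]
    refine ⟨?_, ?_⟩
    · rw [cotangentConstraint_apply]
      simp only [inner_sub_right, inner_orthPart hs1, inner_orthPart hs2, hv1, hv2,
        inner_orthPart_of_inner_eq_zero hv1, inner_orthPart_of_inner_eq_zero hv2]
      simp only [scale, inner_smul_right]
      refine Prod.ext rfl (Prod.ext rfl (Prod.ext (by simp) (Prod.ext (by simp) ?_)))
      simp only [Prod.snd_zero]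
      linarith
    · have : cov ((orthPart p₀.1.1 (scale κ p).1.1, orthPart p₀.1.1 (scale κ p).1.2 - p₀.1.2),
          (orthPart p₀.2.1 (scale κ p).2.1, orthPart p₀.2.1 (scale κ p).2.2 - p₀.2.2))
          = scale κ p := by
        simp only [cov]
        rw [sphereCotangentChart_orthPart (w := (scale κ p).1.1) hs1 ht1 m1 hp1,
          sphereCotangentChart_orthPart (w := (scale κ p).2.1) hs2 ht2 m2 hp2]
      rw [this, projClass_scale hκ0]

end Total

/-! ### The contact structure and the Legendrian fibration -/

section Contact

variable {E : Type*} [NormedAddCommGroup E] [InnerProductSpace ℝ E]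

theorem hasDerivAt_inner_of_eventually_const {c d : ℝ → E} {c' d' : E} {k : ℝ}
    (hc : HasDerivAt c c' 0) (hd : HasDerivAt d d' 0) (h : ∀ᶠ s in 𝓝 (0 : ℝ), ⟪c s, d s⟫ = k) :
    ⟪c 0, d'⟫ + ⟪c', d 0⟫ = 0 := by
  have h1 := hc.inner ℝ hd
  have h2 : HasDerivAt (fun s => ⟪c s, d s⟫) 0 0 :=
    (hasDerivAt_const (0 : ℝ) k).congr_of_eventuallyEq h
  exact h1.unique h2

theorem hasDerivAt_components {F G : Type*} [NormedAddCommGroup F] [NormedSpace ℝ F]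
    [NormedAddCommGroup G] [NormedSpace ℝ G] {γ : ℝ → F × G} {ξ : F × G} (h : HasDerivAt γ ξ 0) :
    HasDerivAt (fun s => (γ s).1) ξ.1 0 ∧ HasDerivAt (fun s => (γ s).2) ξ.2 0 :=
  ⟨(ContinuousLinearMap.fst ℝ F G).hasFDerivAt.comp_hasDerivAt _ h,
    (ContinuousLinearMap.snd ℝ F G).hasFDerivAt.comp_hasDerivAt _ h⟩

theorem exists_hasDerivAt_comp {F G : Type*} [NormedAddCommGroup F] [NormedSpace ℝ F]
    [NormedAddCommGroup G] [NormedSpace ℝ G] {f : F → G} {γ : ℝ → F} {ξ : F} {s : ℝ}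
    (hf : ContDiffAt ℝ 1 f (γ s)) (hγ : HasDerivAt γ ξ s) :
    ∃ ζ, HasDerivAt (fun s => f (γ s)) ζ s :=
  ⟨_, (hf.differentiableAt (by simp)).hasFDerivAt.comp_hasDerivAt s hγ⟩

/-- Covectors with a given base curve. -/
theorem hasDerivAt_orthPart {c : ℝ → E} {c' Q : E} (hc : HasDerivAt c c' 0) (hQ : ⟪c 0, Q⟫ = 0) :
    HasDerivAt (fun s => orthPart (c s) Q) (-(⟪c', Q⟫ • c 0)) 0 := by
  have h1 : HasDerivAt (fun s => ⟪c s, Q⟫) ⟪c', Q⟫ 0 := by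
    simpa using hc.inner ℝ (hasDerivAt_const (0 : ℝ) Q)
  have h2 := (h1.smul hc).const_sub Q
  simpa [hQ, orthPart] using h2

theorem orthPart_of_inner_eq_zero {v Q : E} (h : ⟪v, Q⟫ = 0) : orthPart v Q = Q := by
  simp [orthPart, h]

/-- The unit sphere contains a curve with a given initial velocity. -/
theorem exists_curve_sphere {v w : E} (hv : ⟪v, v⟫ = 1) (hw : ⟪v, w⟫ = 0) :
    ∃ c : ℝ → E, c 0 = v ∧ (∀ s, ⟪c s, c s⟫ = 1) ∧ HasDerivAt c w 0 := by
  have hpos : ∀ s : ℝ, 0 < 1 + s ^ 2 * ‖w‖ ^ 2 := fun s => by positivity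
  refine ⟨fun s => (√(1 + s ^ 2 * ‖w‖ ^ 2))⁻¹ • (v + s • w), by simp, fun s => ?_, ?_⟩
  · have h1 : ⟪v + s • w, v + s • w⟫ = 1 + s ^ 2 * ‖w‖ ^ 2 := by
      rw [← real_inner_self_eq_norm_sq w]
      simp only [inner_add_left, inner_add_right, inner_smul_left, inner_smul_right, hv, hw,
        real_inner_comm v w, conj_trivial]
      ring
    rw [inner_smul_left, inner_smul_right, h1, conj_trivial, ← mul_assoc, ← mul_inv,
      Real.mul_self_sqrt (hpos s).le, inv_mul_cancel₀ (hpos s).ne']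
  · have h1 : HasDerivAt (fun s : ℝ => 1 + s ^ 2 * ‖w‖ ^ 2) 0 0 := by
      simpa using (((hasDerivAt_id (0 : ℝ)).pow 2).mul_const (‖w‖ ^ 2)).const_add 1
    have h2 := (h1.sqrt (hpos 0).ne').inv (Real.sqrt_ne_zero'.2 (hpos 0))
    have h3 : HasDerivAt (fun s : ℝ => v + s • w) w 0 := by
      simpa using ((hasDerivAt_id (0 : ℝ)).smul_const w).const_add v
    have h4 := h2.smul h3
    exact h4.congr_deriv (by simp)

theorem mem_cotangentNonzero_iff {p : (E × E) × (E × E)} : p ∈ cotangentNonzero E ↔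
    ⟪p.1.1, p.1.1⟫ = 1 ∧ ⟪p.2.1, p.2.1⟫ = 1 ∧ ⟪p.1.1, p.1.2⟫ = 0 ∧ ⟪p.2.1, p.2.2⟫ = 0 ∧
      covec p ≠ 0 := by
  have h : ∀ v : E, ⟪v, v⟫ = 1 ↔ ‖v‖ = 1 := fun v => by
    rw [real_inner_self_eq_norm_sq, pow_eq_one_iff_of_nonneg (norm_nonneg _) two_ne_zero]
  rw [h, h, covec_ne_zero]
  simp only [cotangentNonzero, sphereProd, mem_ofPred_eq, mem_prod, mem_sphere_zero_iff_norm,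
    and_assoc]

/-- Tangent vectors that move the base point; their fibre components are proportional to the base
point. -/
theorem exists_tangentVector_base {p : (E × E) × (E × E)} (hp : p ∈ cotangentNonzero E) {w w' : E}
    (hw : ⟪p.1.1, w⟫ = 0) (hw' : ⟪p.2.1, w'⟫ = 0) :
    ((w, -(⟪w, p.1.2⟫ • p.1.1)), (w', -(⟪w', p.2.2⟫ • p.2.1))) ∈
      tangentVectors (cotangentNonzero E) p := by
  obtain ⟨h1, h2, h3, h4, h5⟩ := mem_cotangentNonzero_iff.1 hp
  obtain ⟨c, hc0, hc, hcd⟩ := exists_curve_sphere h1 hw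
  obtain ⟨d, hd0, hd, hdd⟩ := exists_curve_sphere h2 hw'
  -- Carrying along the part of `Q` orthogonal to the moving base point keeps the curve in the
  -- cotangent bundle.
  have hQ := hasDerivAt_orthPart (Q := p.1.2) hcd (by rw [hc0, h3])
  have hQ' := hasDerivAt_orthPart (Q := p.2.2) hdd (by rw [hd0, h4])
  rw [hc0] at hQ
  rw [hd0] at hQ'
  have hder := (hcd.prodMk hQ).prodMk (hdd.prodMk hQ')
  have h0 : ((c 0, orthPart (c 0) p.1.2), (d 0, orthPart (d 0) p.2.2)) = p := by
    rw [hc0, hd0, orthPart_of_inner_eq_zero h3, orthPart_of_inner_eq_zero h4]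
  refine ⟨_, h0, ?_, hder⟩
  have hne : ∀ᶠ s in 𝓝 (0 : ℝ),
      covec ((c s, orthPart (c s) p.1.2), (d s, orthPart (d s) p.2.2)) ≠ 0 :=
    (ContinuousAt.comp (g := covec) (f := fun s =>
      ((c s, orthPart (c s) p.1.2), (d s, orthPart (d s) p.2.2)))
      (contDiff_covec (n := ω)).continuous.continuousAt hder.continuousAt).eventually_ne
        (by simpa [h0] using h5)
  filter_upwards [hne] with s hs
  exact mem_cotangentNonzero_iff.2 ⟨hc s, hd s, inner_orthPart (hc s) _, inner_orthPart (hd s) _, hs⟩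

/-- Tangent vectors along the fibre. -/
theorem exists_tangentVector_fibre {p : (E × E) × (E × E)} (hp : p ∈ cotangentNonzero E) {w w' : E}
    (hw : ⟪p.1.1, w⟫ = 0) (hw' : ⟪p.2.1, w'⟫ = 0) :
    ((0, w), (0, w')) ∈ tangentVectors (cotangentNonzero E) p := by
  obtain ⟨h1, h2, h3, h4, h5⟩ := mem_cotangentNonzero_iff.1 hp
  have hl : ∀ q x : E, HasDerivAt (fun s : ℝ => q + s • x) x 0 := fun q x => by
    simpa using ((hasDerivAt_id (0 : ℝ)).smul_const x).const_add q
  have hder := ((hasDerivAt_const (0 : ℝ) p.1.1).prodMk (hl p.1.2 w)).prodMk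
    ((hasDerivAt_const (0 : ℝ) p.2.1).prodMk (hl p.2.2 w'))
  have h0 : ((p.1.1, p.1.2 + (0 : ℝ) • w), (p.2.1, p.2.2 + (0 : ℝ) • w')) = p := by simp
  refine ⟨_, h0, ?_, hder⟩
  have hne : ∀ᶠ s in 𝓝 (0 : ℝ),
      covec ((p.1.1, p.1.2 + s • w), (p.2.1, p.2.2 + s • w')) ≠ 0 :=
    (ContinuousAt.comp (g := covec) (f := fun s : ℝ =>
      ((p.1.1, p.1.2 + s • w), (p.2.1, p.2.2 + s • w')))
      (contDiff_covec (n := ω)).continuous.continuousAt hder.continuousAt).eventually_ne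
        (by simpa using h5)
  filter_upwards [hne] with s hs
  exact mem_cotangentNonzero_iff.2 ⟨h1, h2, by simp [inner_add_right, inner_smul_right, h3, hw],
    by simp [inner_add_right, inner_smul_right, h4, hw'], hs⟩

/-- The differential of the contact form is nondegenerate on the nonzero covectors. -/
theorem contactForm_nondegenerate {p : (E × E) × (E × E)} (hp : p ∈ cotangentNonzero E)
    {a : (E × E) × (E × E)} (ha : a ∈ tangentVectors (cotangentNonzero E) p)
    (h : ∀ b ∈ tangentVectors (cotangentNonzero E) p,
      contactForm a (b.1.1, b.2.1) - contactForm b (a.1.1, a.2.1) = 0) : a = 0 := by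
  obtain ⟨γ, rfl, hγ, hd⟩ := ha
  obtain ⟨hd1, hd2⟩ := hasDerivAt_components hd
  obtain ⟨d1, d2⟩ := hasDerivAt_components hd1
  obtain ⟨d3, d4⟩ := hasDerivAt_components hd2
  have c1 := hasDerivAt_inner_of_eventually_const d1 d1
    (hγ.mono fun s hs => (mem_cotangentNonzero_iff.1 hs).1)
  have c2 := hasDerivAt_inner_of_eventually_const d3 d3
    (hγ.mono fun s hs => (mem_cotangentNonzero_iff.1 hs).2.1)
  have c3 := hasDerivAt_inner_of_eventually_const d1 d2
    (hγ.mono fun s hs => (mem_cotangentNonzero_iff.1 hs).2.2.1)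
  have c4 := hasDerivAt_inner_of_eventually_const d3 d4
    (hγ.mono fun s hs => (mem_cotangentNonzero_iff.1 hs).2.2.2.1)
  have e1 : ⟪(γ 0).1.1, a.1.1⟫ = 0 := by
    rw [real_inner_comm (γ 0).1.1 a.1.1] at c1; linarith
  have e2 : ⟪(γ 0).2.1, a.2.1⟫ = 0 := by
    rw [real_inner_comm (γ 0).2.1 a.2.1] at c2; linarith
  -- Testing against the vertical vector whose fibre component is the base component of `a` gives
  -- the squared norm of the latter, up to sign.
  have z1 : a.1.1 = 0 := by
    have := h _ (exists_tangentVector_fibre hp e1 (inner_zero_right _))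
    simpa [contactForm] using this
  have z2 : a.2.1 = 0 := by
    have := h _ (exists_tangentVector_fibre hp (inner_zero_right _) e2)
    simpa [contactForm] using this
  -- Once the base components vanish, the fibre components of `a` are orthogonal to the base points,
  -- so they are themselves admissible base directions for the next test.
  rw [z1, inner_zero_left, add_zero] at c3
  rw [z2, inner_zero_left, add_zero] at c4
  have z3 : a.1.2 = 0 := by
    have := h _ (exists_tangentVector_base hp c3 (inner_zero_right _))
    simpa [contactForm, z1, z2] using this
  have z4 : a.2.2 = 0 := by
    have := h _ (exists_tangentVector_base hp (inner_zero_right _) c4)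
    simpa [contactForm, z1, z2] using this
  exact Prod.ext (Prod.ext z1 z3) (Prod.ext z2 z4)

variable [FiniteDimensional ℝ E]

omit [FiniteDimensional ℝ E] in
theorem exists_ne_zero_inner_eq_zero (hn : 2 ≤ Module.finrank ℝ E) (v : E) :
    ∃ w : E, w ≠ 0 ∧ ⟪v, w⟫ = 0 := by
  by_contra! hne
  have h1 : LinearMap.ker (innerₗ E v) = ⊥ :=
    (Submodule.eq_bot_iff _).2 fun w hw => by_contra fun h => hne w h hw
  have h2 := LinearMap.finrank_le_finrank_of_injective (LinearMap.ker_eq_bot.1 h1)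
  rw [Module.finrank_self] at h2
  omega

omit [FiniteDimensional ℝ E] in
theorem baseProj_image_projCotangent (hn : 2 ≤ Module.finrank ℝ E) :
    baseProj '' projCotangent E = sphereProd E := by
  ext b
  constructor
  · rintro ⟨_, ⟨p, hp, rfl⟩, rfl⟩
    exact hp.1
  · intro hb
    obtain ⟨w, hw, hbw⟩ := exists_ne_zero_inner_eq_zero hn b.1
    refine ⟨_, ⟨((b.1, w), (b.2, 0)), ⟨hb, hbw, inner_zero_right _, ?_⟩, rfl⟩, rfl⟩
    simpa using hw

omit [FiniteDimensional ℝ E] in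
-- A tangent vector of the base is lifted to the nonzero covectors and then pushed forward by
-- `projClass`, which does not change base components.
theorem tangentVectors_sphereProd_subset {x : ProjAmbient E} (hx : x ∈ projCotangent E) :
    tangentVectors (sphereProd E) (baseProj x) ⊆
      baseProj '' tangentVectors (projCotangent E) x := by
  obtain ⟨p, hp, rfl⟩ := hx
  obtain ⟨h1, h2, h3, h4, h5⟩ := mem_cotangentNonzero_iff.1 hp
  rw [baseProj_projClass]
  rintro ξ ⟨γ, hγ0, hγ, hd⟩
  obtain ⟨d1, d2⟩ := hasDerivAt_components hd
  have hself : ∀ v : E, v ∈ Metric.sphere (0 : E) 1 → ⟪v, v⟫ = 1 := fun v hv => by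
    rw [real_inner_self_eq_norm_sq, mem_sphere_zero_iff_norm.1 hv, one_pow]
  have c1 := hasDerivAt_inner_of_eventually_const d1 d1 (hγ.mono fun s hs => hself _ hs.1)
  have c2 := hasDerivAt_inner_of_eventually_const d2 d2 (hγ.mono fun s hs => hself _ hs.2)
  simp only [hγ0] at c1 c2
  have e1 : ⟪p.1.1, ξ.1⟫ = 0 := by
    rw [real_inner_comm p.1.1 ξ.1] at c1; linarith
  have e2 : ⟪p.2.1, ξ.2⟫ = 0 := by
    rw [real_inner_comm p.2.1 ξ.2] at c2; linarith
  obtain ⟨δ, hδ0, hδ, hδd⟩ := exists_tangentVector_base hp e1 e2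
  have hc : ContDiffAt ℝ 1 projClass (δ 0) := by
    rw [hδ0]
    exact contDiffAt_projClass h5
  obtain ⟨ζ, hder⟩ := exists_hasDerivAt_comp hc hδd
  refine ⟨_, ⟨_, by rw [hδ0], hδ.mono fun s hs => ⟨_, hs, rfl⟩, hder⟩, ?_⟩
  obtain ⟨k1, k2⟩ := hasDerivAt_components hder
  obtain ⟨k2, -⟩ := hasDerivAt_components k2
  obtain ⟨l1, l2⟩ := hasDerivAt_components hδd
  exact Prod.ext (k1.unique (hasDerivAt_components l1).1) (k2.unique (hasDerivAt_components l2).1)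

/-- `Θ` only involves the velocity of the base point, which is zero along a fibre. -/
theorem projCotangent_fibre_isLegendrian (hn : 2 ≤ Module.finrank ℝ E) (b : E × E) :
    IsLegendrian (projCotangent E ∩ baseProj ⁻¹' {b}) := by
  refine ⟨inter_subset_left, (projCotangent_fibre_hasCharts hn b).isSubmanifold, ?_⟩
  rintro x - ξ ⟨γ, -, hγ, hd⟩ p - -
  obtain ⟨k1, k2⟩ := hasDerivAt_components hd
  obtain ⟨k2, -⟩ := hasDerivAt_components k2
  have e1 : ξ.1 = 0 := k1.unique ((hasDerivAt_const (0 : ℝ) b.1).congr_of_eventuallyEq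
    (hγ.mono fun s hs => congrArg Prod.fst hs.2))
  have e2 : ξ.2.1 = 0 := k2.unique ((hasDerivAt_const (0 : ℝ) b.2).congr_of_eventuallyEq
    (hγ.mono fun s hs => congrArg Prod.snd hs.2))
  simp [contactForm, baseProj, e1, e2]

end Contact

/-! ### The length of a path and the uniqueness of billiard paths -/

section Paths

variable {E : Type*} [NormedAddCommGroup E] [InnerProductSpace ℝ E]

theorem contDiffAt_normalize {n : WithTop ℕ∞} {e : E} (he : e ≠ 0) :
    ContDiffAt ℝ n (fun x : E => ‖x‖⁻¹ • x) e :=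
  ((contDiffAt_norm ℝ he).inv (norm_ne_zero_iff.2 he)).smul contDiffAt_id

/-- The derivative of the normalization `x ↦ x / ‖x‖` is positive semidefinite, and its kernel is
spanned by the base point. -/
theorem fderiv_normalize_nonneg {e : E} (he : e ≠ 0) (η : E) :
    0 ≤ ⟪fderiv ℝ (fun x : E => ‖x‖⁻¹ • x) e η, η⟫ ∧
      (⟪fderiv ℝ (fun x : E => ‖x‖⁻¹ • x) e η, η⟫ = 0 → ∃ c : ℝ, η = c • e) := by
  have hN := ((contDiffAt_normalize (n := 1) he).differentiableAt (by simp)).hasFDerivAt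
  set N' := fderiv ℝ (fun x : E => ‖x‖⁻¹ • x) e
  have hn := ((contDiffAt_norm ℝ (n := 1) he).differentiableAt (by simp)).hasFDerivAt
  set n' := fderiv ℝ (norm : E → ℝ) e
  have hne : ‖e‖ ≠ 0 := norm_ne_zero_iff.2 he
  -- Differentiate `x = ‖x‖ • (x / ‖x‖)`. The factor of unit norm varies orthogonally to `e`, so
  -- pairing `η` with `N' η` leaves `‖e‖ * ‖N' η‖ ^ 2`.
  have h1 : η = ‖e‖ • N' η + n' η • (‖e‖⁻¹ • e) := by
    have h2 := hn.smul hN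
    have h3 : HasFDerivAt ((norm : E → ℝ) • fun x : E => ‖x‖⁻¹ • x) (ContinuousLinearMap.id ℝ E) e := by
      refine (hasFDerivAt_id e).congr_of_eventuallyEq (Eventually.of_forall fun x => ?_)
      by_cases hx : x = 0
      · simp [hx]
      · simp [smul_smul, mul_inv_cancel₀ (norm_ne_zero_iff.2 hx)]
    have h4 := congrArg (fun A : E →L[ℝ] E => A η) (h3.unique h2)
    simpa using h4
  have h2 : ⟪N' η, e⟫ = 0 := by
    have h3 := hN.inner ℝ hN
    have h4 : HasFDerivAt (fun x : E => ⟪‖x‖⁻¹ • x, ‖x‖⁻¹ • x⟫) (0 : E →L[ℝ] ℝ) e := by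
      refine (hasFDerivAt_const (1 : ℝ) e).congr_of_eventuallyEq ?_
      filter_upwards [isOpen_ne.mem_nhds he] with x hx
      have hx' : ‖x‖ ≠ 0 := norm_ne_zero_iff.2 hx
      simp only [inner_smul_left, inner_smul_right, real_inner_self_eq_norm_sq, conj_trivial]
      field_simp
    have h5 := congrArg (fun A : E →L[ℝ] ℝ => A η) (h4.unique h3)
    simp only [ContinuousLinearMap.comp_apply, ContinuousLinearMap.prod_apply,
      fderivInnerCLM_apply, _root_.zero_apply, inner_smul_left, inner_smul_right,
      conj_trivial, real_inner_comm (N' η) e] at h5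
    have h6 : ‖e‖⁻¹ * ⟪N' η, e⟫ = 0 := by linarith
    exact (mul_eq_zero.1 h6).resolve_left (inv_ne_zero hne)
  have h3 : ⟪N' η, η⟫ = ‖e‖ * ‖N' η‖ ^ 2 := by
    rw [congrArg (fun z => ⟪N' η, z⟫) h1]
    rw [inner_add_right, inner_smul_right, inner_smul_right, inner_smul_right, h2,
      real_inner_self_eq_norm_sq]
    ring
  rw [h3]
  refine ⟨by positivity, fun h => ⟨n' η * ‖e‖⁻¹, ?_⟩⟩
  have h4 : N' η = 0 := by
    have := (mul_eq_zero.1 h).resolve_left hne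
    simpa using this
  rw [mul_smul]
  simpa [h4] using h1

variable {m : ℕ} (L : Fin (m + 1) → Submodule ℝ E)

/-- Boundary data `(A, (q₀, …, qₘ), B)` of a path with vertices `qᵢ ∈ L i`. -/
abbrev PathData : Type _ := E × ((i : Fin (m + 1)) → L i) × E

variable {L}

/-- The points `A, q₀, …, qₘ, B` of a path. -/
noncomputable def vertex : Fin (m + 3) → PathData L →L[ℝ] E :=
  Fin.cons (ContinuousLinearMap.fst ℝ _ _)
    (Fin.snoc (fun i : Fin (m + 1) => (L i).subtypeL.comp ((ContinuousLinearMap.proj i).comp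
      ((ContinuousLinearMap.fst ℝ _ _).comp (ContinuousLinearMap.snd ℝ _ _))))
      ((ContinuousLinearMap.snd ℝ _ _).comp (ContinuousLinearMap.snd ℝ _ _)))

theorem vertex_zero (x : PathData L) : vertex 0 x = x.1 := rfl

theorem vertex_succ_castSucc (x : PathData L) (i : Fin (m + 1)) :
    vertex i.succ.castSucc x = x.2.1 i := by
  rw [← Fin.succ_castSucc]
  simp [vertex]

theorem vertex_castSucc_succ (x : PathData L) (i : Fin (m + 1)) :
    vertex i.castSucc.succ x = x.2.1 i := by
  rw [Fin.succ_castSucc, vertex_succ_castSucc]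

theorem vertex_last (x : PathData L) : vertex (Fin.last (m + 2)) x = x.2.2 := by
  rw [← Fin.succ_last]
  simp [vertex]

/-- The edges of a path, as vectors. -/
noncomputable def edgeVec (j : Fin (m + 2)) : PathData L →L[ℝ] E :=
  vertex j.succ - vertex j.castSucc

theorem edgeVec_apply (j : Fin (m + 2)) (x : PathData L) :
    edgeVec j x = vertex j.succ x - vertex j.castSucc x := rfl

theorem contDiff_edgeVec {n : WithTop ℕ∞} (j : Fin (m + 2)) :
    ContDiff ℝ n (fun x : PathData L => edgeVec j x) := by
  fun_prop

theorem hasFDerivAt_edgeVec (j : Fin (m + 2)) (x : PathData L) :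
    HasFDerivAt (fun x : PathData L => edgeVec j x) (edgeVec j) x := by
  apply ContinuousLinearMap.hasFDerivAt

/-- Summation by parts, which moves differences from the vertices to the weights. -/
theorem sum_inner_edgeVec (w : Fin (m + 2) → E) (x : PathData L) :
    ∑ j, ⟪w j, edgeVec j x⟫ = ⟪w (Fin.last (m + 1)), x.2.2⟫ - ⟪w 0, x.1⟫ +
      ∑ i : Fin (m + 1), ⟪w i.castSucc - w i.succ, (x.2.1 i : E)⟫ := by
  simp only [edgeVec_apply, inner_sub_right, Finset.sum_sub_distrib, inner_sub_left]
  rw [Fin.sum_univ_castSucc (fun j => ⟪w j, vertex j.succ x⟫),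
    Fin.sum_univ_succ (fun j => ⟪w j, vertex j.castSucc x⟫)]
  simp only [vertex_castSucc_succ, vertex_succ_castSucc, Fin.succ_last, vertex_last,
    Fin.castSucc_zero, vertex_zero]
  ring

/-- The direction of the `j`-th edge. -/
noncomputable def direction (j : Fin (m + 2)) (x : PathData L) : E :=
  ‖edgeVec j x‖⁻¹ • edgeVec j x

/-- Only an inequality, because an edge of length zero has direction `0` by the convention `0⁻¹ =
0`. -/
theorem norm_direction_le (j : Fin (m + 2)) (x : PathData L) : ‖direction j x‖ ≤ 1 := by
  rw [direction, norm_smul, norm_inv, norm_norm]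
  exact inv_mul_le_one

theorem norm_direction {j : Fin (m + 2)} {x : PathData L} (h : edgeVec j x ≠ 0) :
    ‖direction j x‖ = 1 := by
  rw [direction, norm_smul, norm_inv, norm_norm, inv_mul_cancel₀ (norm_ne_zero_iff.2 h)]

theorem norm_smul_direction (j : Fin (m + 2)) (x : PathData L) :
    ‖edgeVec j x‖ • direction j x = edgeVec j x := by
  by_cases h : edgeVec j x = 0
  · simp [h]
  · rw [direction, smul_inv_smul₀ (norm_ne_zero_iff.2 h)]

theorem inner_direction_edgeVec (j : Fin (m + 2)) (x : PathData L) :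
    ⟪direction j x, edgeVec j x⟫ = ‖edgeVec j x‖ := by
  by_cases h : edgeVec j x = 0
  · simp [h]
  · rw [direction, inner_smul_left, real_inner_self_eq_norm_sq, conj_trivial, sq,
      inv_mul_cancel_left₀ (norm_ne_zero_iff.2 h)]

/-- The length of a path. -/
noncomputable def pathLength (x : PathData L) : ℝ := ∑ j, ‖edgeVec j x‖

variable [FiniteDimensional ℝ E]

/-- A path that satisfies the conservation laws at its vertices and none of whose edges is parallel
to the subspace of an adjacent vertex. -/
structure IsBilliardPath (x : PathData L) : Prop where
  notMem_castSucc : ∀ i : Fin (m + 1), edgeVec i.castSucc x ∉ L i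
  notMem_succ : ∀ i : Fin (m + 1), edgeVec i.succ x ∉ L i
  momentum : ∀ i : Fin (m + 1),
    (L i).starProjection (direction i.succ x) = (L i).starProjection (direction i.castSucc x)

theorem inner_eq_of_starProjection_eq {K : Submodule ℝ E} {a b : E}
    (h : K.starProjection a = K.starProjection b) {ξ : E} (hξ : ξ ∈ K) : ⟪a, ξ⟫ = ⟪b, ξ⟫ := by
  rw [← Submodule.starProjection_eq_self_iff.2 hξ, ← Submodule.inner_starProjection_left_eq_right,
    ← Submodule.inner_starProjection_left_eq_right, h]

theorem IsBilliardPath.edgeVec_ne_zero {x : PathData L} (hx : IsBilliardPath x)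
    (j : Fin (m + 2)) : edgeVec j x ≠ 0 := by
  refine Fin.lastCases ?_ (fun i => ?_) j
  · rw [← Fin.succ_last]
    exact fun h => hx.notMem_succ (Fin.last m) (h ▸ zero_mem _)
  · exact fun h => hx.notMem_castSucc i (h ▸ zero_mem _)

/-- Momentum conservation makes the jump of the direction at a vertex orthogonal to `L i`, so the
vertex terms of the summation by parts vanish. The directions of `x` thus calibrate the length
functional: the sum depends only on the end points of `y`. -/
theorem IsBilliardPath.sum_inner_direction {x : PathData L} (hx : IsBilliardPath x)
    (y : PathData L) : ∑ j, ⟪direction j x, edgeVec j y⟫ =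
      ⟪direction (Fin.last (m + 1)) x, y.2.2⟫ - ⟪direction 0 x, y.1⟫ := by
  rw [sum_inner_edgeVec, add_eq_left]
  refine Finset.sum_eq_zero fun i _ => ?_
  rw [inner_sub_left, inner_eq_of_starProjection_eq (hx.momentum i) (y.2.1 i).2, sub_self]

theorem IsBilliardPath.pathLength_eq {x : PathData L} (hx : IsBilliardPath x) :
    pathLength x = ⟪direction (Fin.last (m + 1)) x, x.2.2⟫ - ⟪direction 0 x, x.1⟫ := by
  rw [← hx.sum_inner_direction x]
  simp only [inner_direction_edgeVec, pathLength]

omit [FiniteDimensional ℝ E] in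
theorem inner_direction_le (x y : PathData L) (j : Fin (m + 2)) :
    ⟪direction j x, edgeVec j y⟫ ≤ ‖edgeVec j y‖ :=
  (real_inner_le_norm _ _).trans (mul_le_of_le_one_left (norm_nonneg _) (norm_direction_le j x))

/-- Cauchy–Schwarz on each edge turns the calibration into a lower bound for the length of every
competitor, attained by `x` itself. This is the convexity of the length. -/
theorem IsBilliardPath.le_pathLength {x : PathData L} (hx : IsBilliardPath x) (y : PathData L) :
    ⟪direction (Fin.last (m + 1)) x, y.2.2⟫ - ⟪direction 0 x, y.1⟫ ≤ pathLength y := by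
  rw [← hx.sum_inner_direction y]
  exact Finset.sum_le_sum fun j _ => inner_direction_le x y j

/-- A billiard path is determined by its end points. -/
theorem IsBilliardPath.eq_of_endpoints {x y : PathData L} (hx : IsBilliardPath x)
    (hy : IsBilliardPath y) (hA : x.1 = y.1) (hB : x.2.2 = y.2.2) : x = y := by
  have hle : pathLength y ≤ pathLength x := by
    rw [hy.pathLength_eq, ← hA, ← hB]
    exact hy.le_pathLength x
  have hsum : ∑ j, (‖edgeVec j y‖ - ⟪direction j x, edgeVec j y⟫) = 0 := by
    have := hx.le_pathLength y
    rw [← hA, ← hB, ← hx.pathLength_eq] at this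
    rw [Finset.sum_sub_distrib, hx.sum_inner_direction, ← hA, ← hB, ← hx.pathLength_eq]
    exact sub_eq_zero.2 (le_antisymm hle this)
  rw [Finset.sum_eq_zero_iff_of_nonneg
    fun j _ => sub_nonneg.2 (inner_direction_le x y j)] at hsum
  -- The two lengths agree, so Cauchy–Schwarz is an equality on every edge.
  have hpar : ∀ j, edgeVec j y = ‖edgeVec j y‖ • direction j x := by
    intro j
    have h1 := sub_eq_zero.1 (hsum j (Finset.mem_univ j))
    have h2 : ⟪direction j x, edgeVec j y⟫ = ‖direction j x‖ * ‖edgeVec j y‖ := by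
      rw [norm_direction (hx.edgeVec_ne_zero j), one_mul, h1]
    rw [inner_eq_norm_mul_iff_real, norm_direction (hx.edgeVec_ne_zero j), one_smul] at h2
    exact h2.symm
  -- Induction from `A`: if the paths agree up to a vertex, their next vertices differ by an element
  -- of `L i` parallel to an edge of `x` that is not in `L i`, hence by zero.
  have hvert : ∀ j : Fin (m + 3), vertex j x = vertex j y := by
    intro j
    induction j using Fin.induction with
    | zero => exact hA
    | succ j ih =>
      revert ih
      refine Fin.lastCases (fun _ => ?_) (fun i ih => ?_) j
      · rw [Fin.succ_last, vertex_last, vertex_last, hB]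
      · have h1 : vertex i.castSucc.succ y - vertex i.castSucc.succ x =
            ((‖edgeVec i.castSucc y‖ - ‖edgeVec i.castSucc x‖) * ‖edgeVec i.castSucc x‖⁻¹) •
              edgeVec i.castSucc x := by
          have h2 := hpar i.castSucc
          have h3 := norm_smul_direction i.castSucc x
          rw [mul_smul, ← direction, sub_smul, ← h2, h3, edgeVec_apply, edgeVec_apply, ih]
          abel
        have hmem : vertex i.castSucc.succ y - vertex i.castSucc.succ x ∈ L i := by
          rw [vertex_castSucc_succ, vertex_castSucc_succ]
          exact sub_mem (y.2.1 i).2 (x.2.1 i).2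
        rw [h1] at hmem
        have h0 : (‖edgeVec i.castSucc y‖ - ‖edgeVec i.castSucc x‖) *
            ‖edgeVec i.castSucc x‖⁻¹ = 0 := by
          by_contra hne
          exact hx.notMem_castSucc i (((L i).smul_mem_iff hne).1 hmem)
        rw [h0, zero_smul, sub_eq_zero] at h1
        exact h1.symm
  refine Prod.ext hA (Prod.ext (funext fun i => Subtype.ext ?_) hB)
  rw [← vertex_succ_castSucc, ← vertex_succ_castSucc, hvert]

end Paths

/-! ### Nondegeneracy and the local family of billiard paths -/

section Family

variable {E : Type*} [NormedAddCommGroup E] [InnerProductSpace ℝ E] {m : ℕ}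
  {L : Fin (m + 1) → Submodule ℝ E}

theorem contDiffAt_direction {n : WithTop ℕ∞} {j : Fin (m + 2)} {x : PathData L}
    (h : edgeVec j x ≠ 0) : ContDiffAt ℝ n (direction j) x :=
  ContDiffAt.comp (g := fun e : E => ‖e‖⁻¹ • e) x (contDiffAt_normalize h)
    (contDiff_edgeVec j).contDiffAt

theorem fderiv_direction {j : Fin (m + 2)} {x : PathData L} (h : edgeVec j x ≠ 0)
    (ξ : PathData L) :
    fderiv ℝ (direction j) x ξ = fderiv ℝ (fun e : E => ‖e‖⁻¹ • e) (edgeVec j x) (edgeVec j ξ) := by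
  have h1 := ((contDiffAt_normalize (n := 1) h).differentiableAt (by simp)).hasFDerivAt
  have h2 : HasFDerivAt (direction j) _ x := h1.comp x (hasFDerivAt_edgeVec j x)
  rw [h2.fderiv]
  rfl

variable [FiniteDimensional ℝ E]

/-- The failure of conservation of momentum at the vertices, together with the end points. -/
noncomputable def momentumDefect (x : PathData L) : PathData L :=
  (x.1, fun i => (L i).orthogonalProjectionOnto (direction i.succ x - direction i.castSucc x), x.2.2)

theorem momentumDefect_eq_zero_iff {x : PathData L} : (momentumDefect x).2.1 = 0 ↔
    ∀ i : Fin (m + 1),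
      (L i).starProjection (direction i.succ x) = (L i).starProjection (direction i.castSucc x) := by
  simp only [momentumDefect, funext_iff, Pi.zero_apply]
  refine forall_congr' fun i => ?_
  rw [← sub_eq_zero (b := (L i).starProjection _), ← map_sub, Submodule.starProjection_apply,
    ZeroMemClass.coe_eq_zero]

theorem IsBilliardPath.contDiffAt_momentumDefect {n : WithTop ℕ∞} {x : PathData L}
    (hx : IsBilliardPath x) : ContDiffAt ℝ n (momentumDefect : PathData L → PathData L) x := by
  refine contDiffAt_fst.prodMk (ContDiffAt.prodMk ?_ (contDiffAt_snd.snd))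
  refine contDiffAt_pi.2 fun i => ?_
  exact ((L i).orthogonalProjectionOnto).contDiff.contDiffAt.comp x
    ((contDiffAt_direction (hx.edgeVec_ne_zero _)).sub
      (contDiffAt_direction (hx.edgeVec_ne_zero _)))

theorem IsBilliardPath.fderiv_momentumDefect {x : PathData L} (hx : IsBilliardPath x)
    (ξ : PathData L) : fderiv ℝ (momentumDefect : PathData L → PathData L) x ξ =
      (ξ.1, fun i => (L i).orthogonalProjectionOnto
        (fderiv ℝ (direction i.succ) x ξ - fderiv ℝ (direction i.castSucc) x ξ), ξ.2.2) := by
  have hd : ∀ j, HasFDerivAt (direction j) (fderiv ℝ (direction j) x) x := fun j =>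
    ((contDiffAt_direction (n := 1) (hx.edgeVec_ne_zero j)).differentiableAt
      (by simp)).hasFDerivAt
  have h1 : HasFDerivAt (fun x : PathData L => fun i => (L i).orthogonalProjectionOnto
      (direction i.succ x - direction i.castSucc x)) (ContinuousLinearMap.pi fun i =>
        ((L i).orthogonalProjectionOnto).comp
          (fderiv ℝ (direction i.succ) x - fderiv ℝ (direction i.castSucc) x)) x :=
    hasFDerivAt_pi.2 fun i =>
      ((L i).orthogonalProjectionOnto).hasFDerivAt.comp x ((hd _).sub (hd _))
  have h2 : HasFDerivAt (momentumDefect : PathData L → PathData L) _ x :=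
    hasFDerivAt_fst.prodMk (h1.prodMk (hasFDerivAt_snd.comp x hasFDerivAt_snd))
  rw [h2.fderiv]
  rfl

/-- The length functional is nondegenerate at a billiard path. -/
theorem IsBilliardPath.injective_fderiv_momentumDefect {x : PathData L} (hx : IsBilliardPath x) :
    Function.Injective (fderiv ℝ (momentumDefect : PathData L → PathData L) x) := by
  rw [injective_iff_map_eq_zero]
  intro ξ hξ
  rw [hx.fderiv_momentumDefect, Prod.mk_eq_zero, Prod.mk_eq_zero] at hξ
  obtain ⟨hA, hq, hB⟩ := hξ
  -- This sum is the second variation of the length along `ξ`. By summation by parts it vanishes,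
  -- and each term is nonnegative, so `ξ` stretches every edge along itself; the induction that
  -- proved uniqueness then gives `ξ = 0`.
  have hsum : ∑ j, ⟪fderiv ℝ (direction j) x ξ, edgeVec j ξ⟫ = 0 := by
    rw [sum_inner_edgeVec, hA, hB, inner_zero_right, inner_zero_right, sub_zero, zero_add]
    refine Finset.sum_eq_zero fun i _ => ?_
    have h1 := congrFun hq i
    simp only [Pi.zero_apply, map_sub, sub_eq_zero] at h1
    have h2 := congrArg (Subtype.val : L i → E) h1
    rw [Submodule.coe_orthogonalProjectionOnto_apply, Submodule.coe_orthogonalProjectionOnto_apply] at h2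
    rw [inner_sub_left, inner_eq_of_starProjection_eq h2 (ξ.2.1 i).2, sub_self]
  have hnn := fun j => fderiv_normalize_nonneg (hx.edgeVec_ne_zero j) (edgeVec j ξ)
  simp only [← fderiv_direction (hx.edgeVec_ne_zero _)] at hnn
  rw [Finset.sum_eq_zero_iff_of_nonneg fun j _ => (hnn j).1] at hsum
  have hpar : ∀ j, ∃ c : ℝ, edgeVec j ξ = c • edgeVec j x :=
    fun j => (hnn j).2 (hsum j (Finset.mem_univ j))
  have hvert : ∀ j : Fin (m + 3), vertex j ξ = 0 := by
    intro j
    induction j using Fin.induction with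
    | zero => exact hA
    | succ j ih =>
      revert ih
      refine Fin.lastCases (fun _ => ?_) (fun i ih => ?_) j
      · rw [Fin.succ_last, vertex_last, hB]
      · obtain ⟨c, hc⟩ := hpar i.castSucc
        rw [edgeVec_apply _ ξ, ih, sub_zero] at hc
        have hmem : vertex i.castSucc.succ ξ ∈ L i := by
          rw [vertex_castSucc_succ]
          exact (ξ.2.1 i).2
        rw [hc] at hmem ⊢
        by_cases h0 : c = 0
        · rw [h0, zero_smul]
        · exact absurd (((L i).smul_mem_iff h0).1 hmem) (hx.notMem_castSucc i)
  refine Prod.ext hA (Prod.ext (funext fun i => Subtype.ext ?_) hB)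
  rw [← vertex_succ_castSucc, hvert]
  rfl

/-- The billiard paths near a given one form an analytic family that is parametrized by the end
points. -/
theorem IsBilliardPath.exists_family {x₀ : PathData L} (hx₀ : IsBilliardPath x₀) :
    ∃ h : E × E → PathData L, ContDiffAt ℝ ω h (x₀.1, x₀.2.2) ∧ h (x₀.1, x₀.2.2) = x₀ ∧
      ∀ᶠ c in 𝓝 (x₀.1, x₀.2.2), (h c).1 = c.1 ∧ (h c).2.2 = c.2 ∧ IsBilliardPath (h c) := by
  have : CompleteSpace (PathData L) := FiniteDimensional.complete ℝ _
  let D : PathData L ≃L[ℝ] PathData L := (LinearEquiv.ofInjectiveEndo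
    (fderiv ℝ (momentumDefect : PathData L → PathData L) x₀ : PathData L →ₗ[ℝ] PathData L)
    hx₀.injective_fderiv_momentumDefect).toContinuousLinearEquiv
  have hΨ := hx₀.contDiffAt_momentumDefect (n := ω)
  have hD : HasFDerivAt (momentumDefect : PathData L → PathData L)
      (D : PathData L →L[ℝ] PathData L) x₀ :=
    (hΨ.differentiableAt (by simp)).hasFDerivAt
  have hstrict := hΨ.hasStrictFDerivAt' hD (by simp)
  let G := hΨ.localInverse hD (by simp)
  have hG : ContDiffAt ℝ ω G (momentumDefect x₀) := hΨ.to_localInverse hD (by simp)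
  have hright : ∀ᶠ y in 𝓝 (momentumDefect x₀), momentumDefect (G y) = y :=
    hstrict.eventually_right_inverse
  have hG0 : G (momentumDefect x₀) = x₀ := hstrict.localInverse_apply_image
  have hΨ0 : momentumDefect x₀ = (x₀.1, 0, x₀.2.2) :=
    Prod.ext rfl (Prod.ext (momentumDefect_eq_zero_iff.2 hx₀.momentum) rfl)
  rw [hΨ0] at hG hright hG0
  -- Paths with end points A, B and conserved momentum are the preimages of `(A, 0, B)` under
  -- `momentumDefect`.
  let i : E × E → PathData L := fun c => (c.1, 0, c.2)
  have hi : ContDiff ℝ ω i := contDiff_fst.prodMk (contDiff_const.prodMk contDiff_snd)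
  have hh : ContDiffAt ℝ ω (fun c => G (i c)) (x₀.1, x₀.2.2) :=
    ContDiffAt.comp (g := G) (f := i) _ hG hi.contDiffAt
  refine ⟨fun c => G (i c), hh, hG0, ?_⟩
  have hedge : ∀ (j : Fin (m + 2)) (i' : Fin (m + 1)), edgeVec j x₀ ∉ L i' →
      ∀ᶠ c in 𝓝 (x₀.1, x₀.2.2), edgeVec j (G (i c)) ∉ L i' := by
    intro j i' hj
    have hcont : ContinuousAt (fun c => edgeVec j (G (i c))) (x₀.1, x₀.2.2) :=
      (edgeVec j).continuous.continuousAt.comp hh.continuousAt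
    refine hcont.eventually_mem (s := (L i' : Set E)ᶜ) ?_
    refine ((L i').closed_of_finiteDimensional.isOpen_compl).mem_nhds ?_
    change edgeVec j (G (i (x₀.1, x₀.2.2))) ∉ L i'
    rwa [show G (i (x₀.1, x₀.2.2)) = x₀ from hG0]
  filter_upwards [hi.continuous.continuousAt.eventually hright,
    eventually_all.2 fun i' => hedge _ _ (hx₀.notMem_castSucc i'),
    eventually_all.2 fun i' => hedge _ _ (hx₀.notMem_succ i')] with c h1 h2 h3
  refine ⟨congrArg Prod.fst h1, congrArg (fun x : PathData L => x.2.2) h1, h2, h3, ?_⟩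
  exact momentumDefect_eq_zero_iff.1 (congrArg (fun x : PathData L => x.2.1) h1)

end Family

/-! ### Points on oriented lines and the normalization of covectors -/

section Lines

variable {E : Type*} [NormedAddCommGroup E] [InnerProductSpace ℝ E]

/-- The point of the line `w = (v, Q)` in the hyperplane `⟪v₀, ·⟫ = α`. -/
noncomputable def slideTo (v₀ : E) (α : ℝ) (w : E × E) : E :=
  w.2 + ((α - ⟪v₀, w.2⟫) / ⟪v₀, w.1⟫) • w.1

theorem inner_slideTo {v₀ : E} {α : ℝ} {w : E × E} (h : ⟪v₀, w.1⟫ ≠ 0) :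
    ⟪v₀, slideTo v₀ α w⟫ = α := by
  rw [slideTo, inner_add_right, inner_smul_right, div_mul_cancel₀ _ h]
  ring

theorem slideTo_eq {v₀ A v Q : E} {α t : ℝ} (h : ⟪v₀, v⟫ ≠ 0) (hA : A = Q + t • v)
    (hα : ⟪v₀, A⟫ = α) : slideTo v₀ α (v, Q) = A := by
  have : (α - ⟪v₀, Q⟫) / ⟪v₀, v⟫ = t := by
    rw [← hα, hA, inner_add_right, inner_smul_right]
    field_simp
    ring
  rw [slideTo, this, hA]

theorem contDiffAt_slideTo {n : WithTop ℕ∞} {v₀ : E} {α : ℝ} {w : E × E} (h : ⟪v₀, w.1⟫ ≠ 0) :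
    ContDiffAt ℝ n (slideTo v₀ α) w := by
  have h1 : ContDiffAt ℝ n (fun w : E × E => ⟪v₀, w.1⟫) w := contDiffAt_const.inner ℝ contDiffAt_fst
  have h2 : ContDiffAt ℝ n (fun w : E × E => ⟪v₀, w.2⟫) w := contDiffAt_const.inner ℝ contDiffAt_snd
  exact contDiffAt_snd.add (((contDiffAt_const.sub h2).div h1 h).smul contDiffAt_fst)

/-- The numerator of the factor by which the covector `P` has to be scaled so that its lines meet
the reference hyperplanes in points `A`, `B` with `⟪Q₀₋, A⟫ + ⟪Q₀₊, B⟫ = ‖Q₀‖ ^ 2`. -/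
noncomputable def sliceNum (p₀ : (E × E) × (E × E)) (α β : ℝ) (P : (E × E) × (E × E)) : ℝ :=
  ‖covec p₀‖ ^ 2 - α / ⟪p₀.1.1, P.1.1⟫ * ⟪p₀.1.2, P.1.1⟫ - β / ⟪p₀.2.1, P.2.1⟫ * ⟪p₀.2.2, P.2.1⟫

/-- The denominator of the factor described at `sliceNum`. -/
noncomputable def sliceDen (p₀ P : (E × E) × (E × E)) : ℝ :=
  (⟪p₀.1.2, P.1.2⟫ - ⟪p₀.1.1, P.1.2⟫ / ⟪p₀.1.1, P.1.1⟫ * ⟪p₀.1.2, P.1.1⟫) +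
    (⟪p₀.2.2, P.2.2⟫ - ⟪p₀.2.1, P.2.2⟫ / ⟪p₀.2.1, P.2.1⟫ * ⟪p₀.2.2, P.2.1⟫)

theorem sliceNum_self {p₀ : (E × E) × (E × E)} (h : p₀ ∈ cotangentNonzero E) (α β : ℝ) :
    sliceNum p₀ α β p₀ = ‖covec p₀‖ ^ 2 := by
  obtain ⟨h1, h2, h3, h4, -⟩ := mem_cotangentNonzero_iff.1 h
  simp only [sliceNum, h1, h2, real_inner_comm p₀.1.1 p₀.1.2, real_inner_comm p₀.2.1 p₀.2.2, h3, h4]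
  ring

theorem sliceDen_self {p₀ : (E × E) × (E × E)} (h : p₀ ∈ cotangentNonzero E) :
    sliceDen p₀ p₀ = ‖covec p₀‖ ^ 2 := by
  obtain ⟨h1, h2, h3, h4, -⟩ := mem_cotangentNonzero_iff.1 h
  simp only [sliceDen, h3, h4, norm_covec_sq]
  ring

theorem sliceNum_scale (p₀ P : (E × E) × (E × E)) (α β c : ℝ) :
    sliceNum p₀ α β (scale c P) = sliceNum p₀ α β P := rfl

theorem sliceDen_scale (p₀ P : (E × E) × (E × E)) (c : ℝ) :
    sliceDen p₀ (scale c P) = c * sliceDen p₀ P := by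
  simp only [sliceDen, scale, inner_smul_right]
  ring

theorem contDiffAt_sliceNum {n : WithTop ℕ∞} {p₀ P : (E × E) × (E × E)} {α β : ℝ}
    (h : ⟪p₀.1.1, P.1.1⟫ ≠ 0) (h' : ⟪p₀.2.1, P.2.1⟫ ≠ 0) :
    ContDiffAt ℝ n (sliceNum p₀ α β) P := by
  have hi : ∀ (v : E) (l : (E × E) × (E × E) →L[ℝ] E),
      ContDiffAt ℝ n (fun P : (E × E) × (E × E) => ⟪v, l P⟫) P :=
    fun v l => contDiffAt_const.inner ℝ l.contDiff.contDiffAt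
  have d1 := hi p₀.1.1 (.comp (.fst ℝ E E) (.fst ℝ (E × E) (E × E)))
  have d2 := hi p₀.1.2 (.comp (.fst ℝ E E) (.fst ℝ (E × E) (E × E)))
  have d3 := hi p₀.2.1 (.comp (.fst ℝ E E) (.snd ℝ (E × E) (E × E)))
  have d4 := hi p₀.2.2 (.comp (.fst ℝ E E) (.snd ℝ (E × E) (E × E)))
  exact (contDiffAt_const.sub ((contDiffAt_const.div d1 h).mul d2)).sub
    ((contDiffAt_const.div d3 h').mul d4)

theorem contDiffAt_sliceDen {n : WithTop ℕ∞} {p₀ P : (E × E) × (E × E)}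
    (h : ⟪p₀.1.1, P.1.1⟫ ≠ 0) (h' : ⟪p₀.2.1, P.2.1⟫ ≠ 0) :
    ContDiffAt ℝ n (sliceDen p₀) P := by
  have hi : ∀ (v : E) (l : (E × E) × (E × E) →L[ℝ] E),
      ContDiffAt ℝ n (fun P : (E × E) × (E × E) => ⟪v, l P⟫) P :=
    fun v l => contDiffAt_const.inner ℝ l.contDiff.contDiffAt
  have d1 := hi p₀.1.1 (.comp (.fst ℝ E E) (.fst ℝ (E × E) (E × E)))
  have d2 := hi p₀.1.2 (.comp (.fst ℝ E E) (.fst ℝ (E × E) (E × E)))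
  have d3 := hi p₀.2.1 (.comp (.fst ℝ E E) (.snd ℝ (E × E) (E × E)))
  have d4 := hi p₀.2.2 (.comp (.fst ℝ E E) (.snd ℝ (E × E) (E × E)))
  have d5 := hi p₀.1.1 (.comp (.snd ℝ E E) (.fst ℝ (E × E) (E × E)))
  have d6 := hi p₀.1.2 (.comp (.snd ℝ E E) (.fst ℝ (E × E) (E × E)))
  have d7 := hi p₀.2.1 (.comp (.snd ℝ E E) (.snd ℝ (E × E) (E × E)))
  have d8 := hi p₀.2.2 (.comp (.snd ℝ E E) (.snd ℝ (E × E) (E × E)))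
  exact (d6.sub ((d5.div d1 h).mul d2)).add (d8.sub ((d7.div d3 h').mul d4))

/-- The multiple of `P` whose lines meet the reference hyperplanes in points `A`, `B` with
`⟪Q₀₋, A⟫ + ⟪Q₀₊, B⟫ = ‖Q₀‖ ^ 2`. -/
noncomputable def sliceScale (p₀ : (E × E) × (E × E)) (α β : ℝ) (P : (E × E) × (E × E)) :
    (E × E) × (E × E) :=
  scale (sliceNum p₀ α β P / sliceDen p₀ P) P

/-- The pair of points in which the lines of `P` meet the reference hyperplanes. -/
noncomputable def slicePoint (p₀ : (E × E) × (E × E)) (α β : ℝ) (P : (E × E) × (E × E)) : E × E :=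
  (slideTo p₀.1.1 α P.1, slideTo p₀.2.1 β P.2)

theorem sliceScale_self {p₀ : (E × E) × (E × E)} (h : p₀ ∈ cotangentNonzero E) (α β : ℝ) :
    sliceScale p₀ α β p₀ = p₀ := by
  have h0 : ‖covec p₀‖ ^ 2 ≠ 0 := by simpa using cotangentNonzero.covec_ne_zero h
  rw [sliceScale, sliceNum_self h, sliceDen_self h, div_self h0, scale_one]

theorem contDiffAt_sliceScale {n : WithTop ℕ∞} {p₀ P : (E × E) × (E × E)} {α β : ℝ}
    (h : ⟪p₀.1.1, P.1.1⟫ ≠ 0) (h' : ⟪p₀.2.1, P.2.1⟫ ≠ 0) (hD : sliceDen p₀ P ≠ 0) :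
    ContDiffAt ℝ n (sliceScale p₀ α β) P := by
  have hc := (contDiffAt_sliceNum (n := n) (α := α) (β := β) h h').div
    (contDiffAt_sliceDen h h') hD
  exact (contDiffAt_fst.fst.prodMk (hc.smul contDiffAt_fst.snd)).prodMk
    (contDiffAt_snd.fst.prodMk (hc.smul contDiffAt_snd.snd))

theorem contDiffAt_slicePoint {n : WithTop ℕ∞} {p₀ P : (E × E) × (E × E)} {α β : ℝ}
    (h : ⟪p₀.1.1, P.1.1⟫ ≠ 0) (h' : ⟪p₀.2.1, P.2.1⟫ ≠ 0) :
    ContDiffAt ℝ n (slicePoint p₀ α β) P :=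
  (ContDiffAt.comp (f := Prod.fst) P (contDiffAt_slideTo h) contDiffAt_fst).prodMk
    (ContDiffAt.comp (f := Prod.snd) P (contDiffAt_slideTo h') contDiffAt_snd)

theorem inner_slicePoint_sliceScale {p₀ P : (E × E) × (E × E)} {α β : ℝ}
    (hD : sliceDen p₀ P ≠ 0) :
    ⟪p₀.1.2, (slicePoint p₀ α β (sliceScale p₀ α β P)).1⟫ +
      ⟪p₀.2.2, (slicePoint p₀ α β (sliceScale p₀ α β P)).2⟫ = ‖covec p₀‖ ^ 2 := by
  have h1 : sliceNum p₀ α β P / sliceDen p₀ P * sliceDen p₀ P = sliceNum p₀ α β P :=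
    div_mul_cancel₀ _ hD
  set c := sliceNum p₀ α β P / sliceDen p₀ P with hc
  simp only [slicePoint, sliceScale, ← hc, scale, slideTo, inner_add_right, inner_smul_right]
  rw [sliceNum, sliceDen] at h1
  linear_combination h1

/-- A covector is recovered from the points in which its lines meet the reference hyperplanes. -/
theorem slice_unique {p₀ P : (E × E) × (E × E)} {α β l t t' : ℝ} {A B : E} (hl : l ≠ 0)
    (h : ⟪p₀.1.1, P.1.1⟫ ≠ 0) (h' : ⟪p₀.2.1, P.2.1⟫ ≠ 0) (hN : sliceNum p₀ α β P ≠ 0)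
    (hA : A = P.1.2 + t • P.1.1) (hB : B = P.2.2 + t' • P.2.1)
    (hα : ⟪p₀.1.1, A⟫ = α) (hβ : ⟪p₀.2.1, B⟫ = β)
    (hQ : ⟪p₀.1.2, A⟫ + ⟪p₀.2.2, B⟫ = ‖covec p₀‖ ^ 2) :
    slicePoint p₀ α β (sliceScale p₀ α β (scale l P)) = (A, B) := by
  have e1 := slideTo_eq h hA hα
  have e2 := slideTo_eq h' hB hβ
  -- For the multiple `c P` the normalization of A and B is the linear equation `c * sliceDen =
  -- sliceNum`; by hypothesis `c = 1` solves it.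
  have hDN : sliceDen p₀ P = sliceNum p₀ α β P := by
    rw [← e1, ← e2] at hQ
    simp only [slideTo, inner_add_right, inner_smul_right] at hQ
    rw [sliceNum, sliceDen]
    linear_combination hQ
  have hs : sliceScale p₀ α β (scale l P) = P := by
    rw [sliceScale, sliceNum_scale, sliceDen_scale, scale_scale, hDN]
    have : sliceNum p₀ α β P / (l * sliceNum p₀ α β P) * l = 1 := by field_simp
    rw [this, scale_one]
  rw [hs]
  exact Prod.ext e1 e2

/-- The point in which the line `w = (v, Q)` meets the subspace `K`. -/
noncomputable def hitPoint (K : Submodule ℝ E) [K.HasOrthogonalProjection] (w : E × E) : E :=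
  w.2 - (⟪w.2 - K.starProjection w.2, w.1⟫ / ⟪w.1 - K.starProjection w.1, w.1⟫) • w.1

theorem inner_sub_starProjection_ne_zero {K : Submodule ℝ E} [K.HasOrthogonalProjection] {v : E}
    (hv : v ∉ K) : ⟪v - K.starProjection v, v⟫ ≠ 0 := by
  have h1 : ⟪v - K.starProjection v, K.starProjection v⟫ = 0 :=
    Submodule.inner_left_of_mem_orthogonal (Submodule.starProjection_apply_mem K v)
      (K.sub_starProjection_mem_orthogonal v)
  have h2 : ⟪v - K.starProjection v, v⟫ = ‖v - K.starProjection v‖ ^ 2 := by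
    rw [← real_inner_self_eq_norm_sq, inner_sub_right _ v, h1, sub_zero]
  rw [h2]
  refine pow_ne_zero 2 (norm_ne_zero_iff.2 fun h0 => hv ?_)
  exact Submodule.starProjection_eq_self_iff.1 (sub_eq_zero.1 h0).symm

/-- The component of `Q + t v` orthogonal to `K` vanishes, and pairing it with `v` determines `t`,
because `v ∉ K`. -/
theorem hitPoint_eq {K : Submodule ℝ E} [K.HasOrthogonalProjection] {q v Q : E} {t : ℝ}
    (hv : v ∉ K) (hq : q ∈ K) (h : q = Q + t • v) : hitPoint K (v, Q) = q := by
  have h1 := inner_sub_starProjection_ne_zero hv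
  have h2 : Q - K.starProjection Q = -t • (v - K.starProjection v) := by
    have h3 := Submodule.starProjection_eq_self_iff.2 hq
    rw [h, map_add, map_smul] at h3
    rw [smul_sub, neg_smul, neg_smul, sub_neg_eq_add, ← sub_eq_zero]
    rw [← sub_eq_zero] at h3
    rw [← neg_eq_zero, ← h3]
    module
  simp only [hitPoint, h2, inner_smul_left, conj_trivial, mul_div_cancel_right₀ _ h1, h]
  module

theorem continuousAt_hitPoint {K : Submodule ℝ E} [K.HasOrthogonalProjection] {w : E × E}
    (hv : w.1 ∉ K) : ContinuousAt (hitPoint K) w := by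
  have h1 : ContinuousAt (fun w : E × E => ⟪w.2 - K.starProjection w.2, w.1⟫) w := by fun_prop
  have h2 : ContinuousAt (fun w : E × E => ⟪w.1 - K.starProjection w.1, w.1⟫) w := by fun_prop
  exact continuousAt_snd.sub ((h1.div h2 (inner_sub_starProjection_ne_zero hv)).smul
    continuousAt_fst)

theorem hitPoint_smul (K : Submodule ℝ E) [K.HasOrthogonalProjection] (v Q : E) (c : ℝ) :
    hitPoint K (v, c • Q) = c • hitPoint K (v, Q) := by
  simp only [hitPoint, map_smul, ← smul_sub, inner_smul_left, conj_trivial, mul_div_assoc]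
  rw [mul_smul, ← smul_sub]

end Lines

/-! ### The end lines of a path and the chord length -/

section EndLines

variable {E : Type*} [NormedAddCommGroup E] [InnerProductSpace ℝ E] {m : ℕ}
  {L : Fin (m + 1) → Submodule ℝ E}

theorem edgeVec_zero (x : PathData L) : edgeVec 0 x = x.2.1 0 - x.1 := by
  rw [edgeVec_apply, Fin.castSucc_zero, vertex_zero, ← Fin.castSucc_zero, vertex_castSucc_succ]

theorem edgeVec_last (x : PathData L) :
    edgeVec (Fin.last (m + 1)) x = x.2.2 - x.2.1 (Fin.last m) := by
  rw [edgeVec_apply, Fin.succ_last, vertex_last, ← Fin.succ_last, vertex_succ_castSucc]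

theorem edgeVec_castSucc_succ (x : PathData L) (i : Fin m) :
    edgeVec i.castSucc.succ x = x.2.1 i.succ - x.2.1 i.castSucc := by
  rw [edgeVec_apply, vertex_succ_castSucc, Fin.succ_castSucc, vertex_castSucc_succ]

/-- To check a property of all edges, check the first, the last, and the intermediate ones. -/
theorem forall_edge {p : Fin (m + 2) → Prop} (h0 : p 0) (hl : p (Fin.last (m + 1)))
    (hm : ∀ i : Fin m, p i.castSucc.succ) (j : Fin (m + 2)) : p j := by
  refine Fin.cases h0 (fun i => ?_) j
  refine Fin.lastCases ?_ hm i
  rwa [Fin.succ_last]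

theorem direction_eq_of_pos_smul {x y : PathData L} {j : Fin (m + 2)} {c : ℝ} (hc : 0 < c)
    (h : edgeVec j y = c • edgeVec j x) : direction j y = direction j x := by
  rw [direction, h, norm_smul, Real.norm_of_nonneg hc.le, mul_inv, smul_smul, mul_right_comm,
    inv_mul_cancel₀ hc.ne', one_mul, direction]

theorem vertex_eq_add_direction (x : PathData L) :
    (x.2.1 0 : E) = x.1 + ‖edgeVec 0 x‖ • direction 0 x := by
  rw [norm_smul_direction, edgeVec_zero]
  abel

theorem endpoint_eq_add_direction (x : PathData L) : x.2.2 = (x.2.1 (Fin.last m) : E) +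
    ‖edgeVec (Fin.last (m + 1)) x‖ • direction (Fin.last (m + 1)) x := by
  rw [norm_smul_direction, edgeVec_last]
  abel

/-- The oriented lines that contain the first and the last edge of a path. -/
noncomputable def endLines (x : PathData L) : (E × E) × (E × E) :=
  (lineCoord x.1 (direction 0 x), lineCoord x.2.2 (direction (Fin.last (m + 1)) x))

theorem lineCoord_add_smul {A v : E} (hv : ‖v‖ = 1) (t : ℝ) :
    lineCoord (A + t • v) v = lineCoord A v := by
  simp only [lineCoord, inner_add_right, inner_smul_right, real_inner_self_eq_norm_sq, hv]
  refine Prod.ext rfl ?_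
  module

theorem eq_lineCoord_add (A v : E) : A = (lineCoord A v).2 + ⟪v, A⟫ • (lineCoord A v).1 := by
  simp [lineCoord]

theorem lineCoord_smul (c : ℝ) (A v : E) : lineCoord (c • A) v = (v, c • (lineCoord A v).2) := by
  simp [lineCoord, inner_smul_right, smul_sub, mul_smul]

/-- The intermediate edges are those of `x`, and the first and the last edge lie on the lines of the
first and the last edge of `x`. -/
theorem edgeVec_slide (x : PathData L) {a b : ℝ} (hx : ∀ j, edgeVec j x ≠ 0) (ha : 0 < a)
    (hb : 0 < b) (j : Fin (m + 2)) : ∃ c : ℝ, 0 < c ∧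
      edgeVec j ((x.2.1 0 : E) - a • direction 0 x, x.2.1,
        (x.2.1 (Fin.last m) : E) + b • direction (Fin.last (m + 1)) x) = c • edgeVec j x := by
  induction j using forall_edge with
  | h0 =>
    refine ⟨a * ‖edgeVec 0 x‖⁻¹, mul_pos ha (inv_pos.2 (norm_pos_iff.2 (hx _))),
      ?_⟩
    rw [edgeVec_zero, sub_sub_cancel, mul_smul, direction]
  | hl =>
    refine ⟨b * ‖edgeVec (Fin.last (m + 1)) x‖⁻¹, mul_pos hb (inv_pos.2 (norm_pos_iff.2 (hx _))),
      ?_⟩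
    rw [edgeVec_last, add_sub_cancel_left, mul_smul, direction]
  | hm i => exact ⟨1, one_pos, by rw [edgeVec_castSucc_succ, edgeVec_castSucc_succ, one_smul]⟩

theorem contDiffAt_endLines {n : WithTop ℕ∞} {x : PathData L} (hx : ∀ j, edgeVec j x ≠ 0) :
    ContDiffAt ℝ n endLines x := by
  have h : ∀ {f g : PathData L → E}, ContDiffAt ℝ n f x → ContDiffAt ℝ n g x →
      ContDiffAt ℝ n (fun x => lineCoord (f x) (g x)) x := fun hf hg =>
    hg.prodMk (hf.sub ((hg.inner ℝ hf).smul hg))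
  exact (h contDiffAt_fst (contDiffAt_direction (hx _))).prodMk
    (h contDiffAt_snd.snd (contDiffAt_direction (hx _)))

variable [FiniteDimensional ℝ E]

theorem IsBilliardPath.of_edgeVec_eq_smul {x y : PathData L} (hx : IsBilliardPath x)
    (h : ∀ j, ∃ c : ℝ, 0 < c ∧ edgeVec j y = c • edgeVec j x) :
    IsBilliardPath y ∧ ∀ j, direction j y = direction j x := by
  have hd : ∀ j, direction j y = direction j x := fun j =>
    let ⟨_, hc, hj⟩ := h j
    direction_eq_of_pos_smul hc hj
  refine ⟨⟨fun i hi => ?_, fun i hi => ?_, fun i => ?_⟩, hd⟩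
  · obtain ⟨c, hc, hj⟩ := h i.castSucc
    rw [hj, (L i).smul_mem_iff hc.ne'] at hi
    exact hx.notMem_castSucc i hi
  · obtain ⟨c, hc, hj⟩ := h i.succ
    rw [hj, (L i).smul_mem_iff hc.ne'] at hi
    exact hx.notMem_succ i hi
  · rw [hd, hd, hx.momentum i]

/-- The end points may be moved freely along the end rays, which accounts for two of the three
parameters lost in passing from end points to classes. -/
theorem IsBilliardPath.slide {x : PathData L} (hx : IsBilliardPath x) {a b : ℝ} (ha : 0 < a)
    (hb : 0 < b) : ∃ y : PathData L, IsBilliardPath y ∧ endLines y = endLines x ∧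
      y.2.1 = x.2.1 ∧ y.1 = (x.2.1 0 : E) - a • direction 0 x ∧
      y.2.2 = (x.2.1 (Fin.last m) : E) + b • direction (Fin.last (m + 1)) x := by
  obtain ⟨h1, h2⟩ := hx.of_edgeVec_eq_smul (edgeVec_slide x hx.edgeVec_ne_zero ha hb)
  refine ⟨_, h1, ?_, rfl, rfl, rfl⟩
  rw [endLines, endLines, h2, h2]
  have n0 := norm_direction (hx.edgeVec_ne_zero 0)
  have nl := norm_direction (hx.edgeVec_ne_zero (Fin.last (m + 1)))
  have e1 : (x.2.1 0 : E) - a • direction 0 x =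
      x.1 + (‖edgeVec 0 x‖ - a) • direction 0 x := by
    conv_lhs => rw [vertex_eq_add_direction x]
    module
  have e2 : x.2.2 = ((x.2.1 (Fin.last m) : E) + b • direction (Fin.last (m + 1)) x) +
      (‖edgeVec (Fin.last (m + 1)) x‖ - b) • direction (Fin.last (m + 1)) x := by
    conv_lhs => rw [endpoint_eq_add_direction x]
    module
  refine Prod.ext ?_ ?_
  · simp only [e1, lineCoord_add_smul n0]
  · conv_rhs => rw [e2]
    simp only [lineCoord_add_smul nl]

theorem IsBilliardPath.smul {x : PathData L} (hx : IsBilliardPath x) {c : ℝ} (hc : 0 < c) :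
    IsBilliardPath (c • x) ∧ endLines (c • x) = scale c (endLines x) := by
  obtain ⟨h1, h2⟩ := hx.of_edgeVec_eq_smul (y := c • x) fun j => ⟨c, hc, map_smul _ _ _⟩
  refine ⟨h1, ?_⟩
  rw [endLines, h2, h2, Prod.smul_fst, Prod.smul_snd, Prod.smul_snd, lineCoord_smul,
    lineCoord_smul]
  rfl

theorem IsBilliardPath.direction_zero_notMem {x : PathData L} (hx : IsBilliardPath x) :
    direction 0 x ∉ L 0 := by
  rw [direction, (L 0).smul_mem_iff (inv_ne_zero (norm_ne_zero_iff.2 (hx.edgeVec_ne_zero 0)))]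
  exact hx.notMem_castSucc 0

theorem IsBilliardPath.direction_last_notMem {x : PathData L} (hx : IsBilliardPath x) :
    direction (Fin.last (m + 1)) x ∉ L (Fin.last m) := by
  rw [direction, (L _).smul_mem_iff (inv_ne_zero (norm_ne_zero_iff.2 (hx.edgeVec_ne_zero _)))]
  exact hx.notMem_succ (Fin.last m)

theorem IsBilliardPath.hitPoint_fst {x : PathData L} (hx : IsBilliardPath x) :
    hitPoint (L 0) (endLines x).1 = x.2.1 0 := by
  refine hitPoint_eq hx.direction_zero_notMem (x.2.1 0).2
    (t := ⟪direction 0 x, x.1⟫ + ‖edgeVec 0 x‖) ?_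
  rw [vertex_eq_add_direction]
  module

theorem IsBilliardPath.hitPoint_snd {x : PathData L} (hx : IsBilliardPath x) :
    hitPoint (L (Fin.last m)) (endLines x).2 = x.2.1 (Fin.last m) := by
  refine hitPoint_eq hx.direction_last_notMem (x.2.1 (Fin.last m)).2
    (t := ⟪direction (Fin.last (m + 1)) x, x.2.2⟫ - ‖edgeVec (Fin.last (m + 1)) x‖) ?_
  have := endpoint_eq_add_direction x
  rw [← sub_eq_iff_eq_add] at this
  rw [← this]
  module

/-- The length of the part of a billiard path between the first and the last vertex, as a function
of the lines of its first and last edge. -/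
noncomputable def chordLength (L : Fin (m + 1) → Submodule ℝ E) (p : (E × E) × (E × E)) : ℝ :=
  ⟪p.2.1, hitPoint (L (Fin.last m)) p.2⟫ - ⟪p.1.1, hitPoint (L 0) p.1⟫

theorem chordLength_scale (c : ℝ) (p : (E × E) × (E × E)) :
    chordLength L (scale c p) = c * chordLength L p := by
  simp only [chordLength, scale, hitPoint_smul, inner_smul_right]
  ring

/-- Subtracting the first and the last edge from the length formula leaves the intermediate edges,
of which there is at least one when `0 < m`. -/
theorem IsBilliardPath.chordLength_pos {x : PathData L} (hx : IsBilliardPath x) (hm : 0 < m) :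
    0 < chordLength L (endLines x) := by
  have h1 := hx.pathLength_eq
  have h2 : ⟪direction 0 x, (x.2.1 0 : E)⟫ = ⟪direction 0 x, x.1⟫ + ‖edgeVec 0 x‖ := by
    have := inner_direction_edgeVec 0 x
    rw [edgeVec_zero, inner_sub_right, ← edgeVec_zero] at this
    linarith
  have h3 : ⟪direction (Fin.last (m + 1)) x, (x.2.1 (Fin.last m) : E)⟫ =
      ⟪direction (Fin.last (m + 1)) x, x.2.2⟫ - ‖edgeVec (Fin.last (m + 1)) x‖ := by
    have := inner_direction_edgeVec (Fin.last (m + 1)) x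
    rw [edgeVec_last, inner_sub_right, ← edgeVec_last] at this
    linarith
  have h4 : pathLength x = ‖edgeVec 0 x‖ + (∑ i : Fin m, ‖edgeVec i.castSucc.succ x‖ +
      ‖edgeVec (Fin.last (m + 1)) x‖) := by
    rw [pathLength, Fin.sum_univ_succ, Fin.sum_univ_castSucc, Fin.succ_last]
  have h5 : 0 < ∑ i : Fin m, ‖edgeVec i.castSucc.succ x‖ :=
    Finset.sum_pos (fun i _ => norm_pos_iff.2 (hx.edgeVec_ne_zero _)) ⟨⟨0, hm⟩, Finset.mem_univ _⟩
  rw [chordLength, hx.hitPoint_fst, hx.hitPoint_snd]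
  change 0 < ⟪direction (Fin.last (m + 1)) x, (x.2.1 (Fin.last m) : E)⟫ -
    ⟪direction 0 x, (x.2.1 0 : E)⟫
  linarith

theorem IsBilliardPath.continuousAt_chordLength {x : PathData L} (hx : IsBilliardPath x) :
    ContinuousAt (chordLength L) (endLines x) := by
  have h1 : ContinuousAt (fun p : (E × E) × (E × E) => hitPoint (L 0) p.1) (endLines x) :=
    ContinuousAt.comp (f := Prod.fst) (continuousAt_hitPoint hx.direction_zero_notMem)
      continuousAt_fst
  have h2 : ContinuousAt (fun p : (E × E) × (E × E) => hitPoint (L (Fin.last m)) p.2)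
      (endLines x) :=
    ContinuousAt.comp (f := Prod.snd) (continuousAt_hitPoint hx.direction_last_notMem)
      continuousAt_snd
  exact (continuousAt_snd.fst.inner h2).sub (continuousAt_fst.fst.inner h1)

/-- A zero covector would be fixed by scaling with `0`, so its chord length would be zero by
homogeneity. -/
theorem IsBilliardPath.endLines_mem {x : PathData L} (hx : IsBilliardPath x) (hm : 0 < m) :
    endLines x ∈ cotangentNonzero E := by
  have hn : ∀ {v : E}, ‖v‖ = 1 → ⟪v, v⟫ = 1 := fun hv => by
    rw [real_inner_self_eq_norm_sq, hv, one_pow]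
  have hl : ∀ {A v : E}, ‖v‖ = 1 → ⟪v, A - ⟪v, A⟫ • v⟫ = 0 := fun {A v} hv => by
    rw [inner_sub_right, inner_smul_right, hn hv, mul_one, sub_self]
  have n0 := norm_direction (hx.edgeVec_ne_zero 0)
  have nl := norm_direction (hx.edgeVec_ne_zero (Fin.last (m + 1)))
  refine mem_cotangentNonzero_iff.2 ⟨hn n0, hn nl, hl n0, hl nl, fun h0 => ?_⟩
  have h1 : scale 0 (endLines x) = endLines x := by
    have h2 : ((endLines x).1.2, (endLines x).2.2) = 0 :=
      not_not.1 fun h => covec_ne_zero.2 h h0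
    rw [Prod.mk_eq_zero] at h2
    exact Prod.ext (Prod.ext rfl (by simp [scale, h2.1])) (Prod.ext rfl (by simp [scale, h2.2]))
  have h2 := hx.chordLength_pos hm
  rw [← h1, chordLength_scale, zero_mul] at h2
  exact lt_irrefl _ h2

end EndLines

/-! ### Normalized billiard paths representing nearby classes -/

section LegendrianChart

variable {E : Type*} [NormedAddCommGroup E] [InnerProductSpace ℝ E] [FiniteDimensional ℝ E] {m : ℕ}
  {L : Fin (m + 1) → Submodule ℝ E}

/-- The pairs of oriented lines that contain the first and the last edge of a billiard path. -/
def billiardCovectors (L : Fin (m + 1) → Submodule ℝ E) : Set ((E × E) × (E × E)) :=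
  {p | ∃ x : PathData L, IsBilliardPath x ∧ endLines x = p}

theorem scale_mem_billiardCovectors {c : ℝ} (hc : 0 < c) {p : (E × E) × (E × E)}
    (hp : p ∈ billiardCovectors L) : scale c p ∈ billiardCovectors L := by
  obtain ⟨x, hx, rfl⟩ := hp
  exact ⟨_, (hx.smul hc).1, (hx.smul hc).2⟩

/-- The two positivity conditions place `A` before the first vertex and `B` after the last one, so
that sliding the end points there reverses no edge. -/
theorem exists_path_through {p : (E × E) × (E × E)} (hp : p ∈ billiardCovectors L) {A B : E}
    {t t' : ℝ} (hA : A = p.1.2 + t • p.1.1) (hB : B = p.2.2 + t' • p.2.1)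
    (ha : 0 < ⟪p.1.1, hitPoint (L 0) p.1 - A⟫)
    (hb : 0 < ⟪p.2.1, B - hitPoint (L (Fin.last m)) p.2⟫) :
    ∃ y : PathData L, IsBilliardPath y ∧ endLines y = p ∧ y.1 = A ∧ y.2.2 = B := by
  obtain ⟨x, hx, rfl⟩ := hp
  obtain ⟨y, hy1, hy2, -, hy3, hy4⟩ := hx.slide ha hb
  have n0 := norm_direction (hx.edgeVec_ne_zero 0)
  have nl := norm_direction (hx.edgeVec_ne_zero (Fin.last (m + 1)))
  have key : ∀ {z v : E} {s : ℝ}, ‖v‖ = 1 → z = s • v → ⟪v, z⟫ • v = z := by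
    rintro z v s hv rfl
    rw [inner_smul_right, real_inner_self_eq_norm_sq, hv, one_pow, mul_one]
  refine ⟨y, hy1, hy2, ?_, ?_⟩
  · rw [hy3, hx.hitPoint_fst]
    refine sub_eq_iff_eq_add.2 (eq_add_of_sub_eq' (key n0
      (s := ⟪direction 0 x, x.1⟫ + ‖edgeVec 0 x‖ - t) ?_).symm)
    rw [hA, vertex_eq_add_direction]
    simp only [endLines, lineCoord]
    module
  · rw [hy4, hx.hitPoint_snd]
    refine eq_sub_iff_add_eq'.1 (key nl
      (s := t' - (⟪direction (Fin.last (m + 1)) x, x.2.2⟫ -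
        ‖edgeVec (Fin.last (m + 1)) x‖)) ?_)
    have := endpoint_eq_add_direction x
    rw [← sub_eq_iff_eq_add] at this
    rw [hB, ← this]
    simp only [endLines, lineCoord]
    module

/-- The normalized representative of a class near the class of `endLines x₀`. -/
noncomputable def sliceLift (x₀ : PathData L) (y : ProjAmbient E) : (E × E) × (E × E) :=
  sliceScale (endLines x₀) ⟪direction 0 x₀, x₀.1⟫ ⟪direction (Fin.last (m + 1)) x₀, x₀.2.2⟫
    (normLift (endLines x₀) y)

/-- End points of a billiard path that represents a class near the class of `endLines x₀`. -/
noncomputable def sliceEndpoints (x₀ : PathData L) (y : ProjAmbient E) : E × E :=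
  slicePoint (endLines x₀) ⟪direction 0 x₀, x₀.1⟫ ⟪direction (Fin.last (m + 1)) x₀, x₀.2.2⟫
    (sliceLift x₀ y)

variable {x₀ : PathData L}

theorem IsBilliardPath.normLift_self (hx : IsBilliardPath x₀) (hm : 0 < m) :
    normLift (endLines x₀) (projClass (endLines x₀)) = endLines x₀ :=
  normLift_projClass_self (cotangentNonzero.covec_ne_zero (hx.endLines_mem hm))
    (real_inner_self_eq_norm_sq _)

theorem IsBilliardPath.contDiffAt_normLift_self (hx : IsBilliardPath x₀) (hm : 0 < m) :
    ContDiffAt ℝ ω (normLift (endLines x₀)) (projClass (endLines x₀)) :=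
  contDiffAt_normLift (eventually_inner_projClass_ne_zero
    (cotangentNonzero.covec_ne_zero (hx.endLines_mem hm))).self_of_nhds

theorem IsBilliardPath.sliceLift_self (hx : IsBilliardPath x₀) (hm : 0 < m) :
    sliceLift x₀ (projClass (endLines x₀)) = endLines x₀ := by
  rw [sliceLift, hx.normLift_self hm, sliceScale_self (hx.endLines_mem hm)]

theorem IsBilliardPath.inner_ne_zero (hx : IsBilliardPath x₀) (hm : 0 < m) :
    ⟪(endLines x₀).1.1, (endLines x₀).1.1⟫ ≠ 0 ∧ ⟪(endLines x₀).2.1, (endLines x₀).2.1⟫ ≠ 0 ∧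
      sliceDen (endLines x₀) (endLines x₀) ≠ 0 := by
  obtain ⟨h1, h2, -, -, h3⟩ := mem_cotangentNonzero_iff.1 (hx.endLines_mem hm)
  rw [h1, h2, sliceDen_self (hx.endLines_mem hm)]
  exact ⟨one_ne_zero, one_ne_zero, by simpa using h3⟩

theorem IsBilliardPath.contDiffAt_sliceLift (hx : IsBilliardPath x₀) (hm : 0 < m) :
    ContDiffAt ℝ ω (sliceLift x₀) (projClass (endLines x₀)) := by
  obtain ⟨h1, h2, h3⟩ := hx.inner_ne_zero hm
  refine ContDiffAt.comp (f := normLift (endLines x₀)) _ ?_ (hx.contDiffAt_normLift_self hm)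
  rw [hx.normLift_self hm]
  exact contDiffAt_sliceScale h1 h2 h3

theorem IsBilliardPath.contDiffAt_sliceEndpoints (hx : IsBilliardPath x₀) (hm : 0 < m) :
    ContDiffAt ℝ ω (sliceEndpoints x₀) (projClass (endLines x₀)) := by
  obtain ⟨h1, h2, -⟩ := hx.inner_ne_zero hm
  refine ContDiffAt.comp (f := sliceLift x₀) _ ?_ (hx.contDiffAt_sliceLift hm)
  rw [hx.sliceLift_self hm]
  exact contDiffAt_slicePoint h1 h2

theorem IsBilliardPath.sliceEndpoints_self (hx : IsBilliardPath x₀) (hm : 0 < m) :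
    sliceEndpoints x₀ (projClass (endLines x₀)) = (x₀.1, x₀.2.2) := by
  obtain ⟨h1, h2, -⟩ := hx.inner_ne_zero hm
  rw [sliceEndpoints, hx.sliceLift_self hm]
  exact Prod.ext (slideTo_eq h1 (eq_lineCoord_add _ _) rfl)
    (slideTo_eq h2 (eq_lineCoord_add _ _) rfl)

theorem IsBilliardPath.inner_endpoints (hx : IsBilliardPath x₀) (hm : 0 < m) :
    ⟪(endLines x₀).1.2, x₀.1⟫ + ⟪(endLines x₀).2.2, x₀.2.2⟫ = ‖covec (endLines x₀)‖ ^ 2 := by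
  have h := inner_slicePoint_sliceScale (α := ⟪direction 0 x₀, x₀.1⟫)
    (β := ⟪direction (Fin.last (m + 1)) x₀, x₀.2.2⟫) (hx.inner_ne_zero hm).2.2
  have hE := hx.sliceEndpoints_self hm
  rw [sliceEndpoints, sliceLift, hx.normLift_self hm] at hE
  rwa [hE] at h

/-- Only the class is assumed to be near, not the path. A path is found by normalizing the covector
and sliding its end points to the reference hyperplanes; they lie on the correct sides of the end
vertices by continuity. -/
theorem IsBilliardPath.eventually_exists_path (hx : IsBilliardPath x₀) (hm : 0 < m) :
    ∀ᶠ y in 𝓝[projClass '' billiardCovectors L] (projClass (endLines x₀)),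
      ∃ x : PathData L, IsBilliardPath x ∧ projClass (endLines x) = y ∧
        (x.1, x.2.2) = sliceEndpoints x₀ y ∧
        normalConstraint (endLines x₀) (sliceEndpoints x₀ y - (x₀.1, x₀.2.2)) = 0 := by
  set p₀ := endLines x₀ with hp₀
  set y₀ := projClass p₀ with hy₀
  have hp₀m := hx.endLines_mem hm
  have h0 := cotangentNonzero.covec_ne_zero hp₀m
  obtain ⟨d1, d2, d3⟩ := hx.inner_ne_zero hm
  have hN0 := hx.normLift_self hm
  have hN := (hx.contDiffAt_normLift_self hm).continuousAt
  have hS0 := hx.sliceLift_self hm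
  have hS := (hx.contDiffAt_sliceLift hm).continuousAt
  have hE0 := hx.sliceEndpoints_self hm
  have hE := (hx.contDiffAt_sliceEndpoints hm).continuousAt
  have c1 : ∀ᶠ y in 𝓝 y₀, 0 < chordLength L (normLift p₀ y) := by
    refine (ContinuousAt.comp (g := chordLength L) (f := normLift p₀)
      (by rw [hN0]; exact hx.continuousAt_chordLength) hN).eventually_const_lt ?_
    rw [Function.comp_apply, hN0]
    exact hx.chordLength_pos hm
  have c2 : ∀ᶠ y in 𝓝 y₀, 0 < chordLength L (sliceLift x₀ y) := by
    refine (ContinuousAt.comp (g := chordLength L) (f := sliceLift x₀)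
      (by rw [hS0]; exact hx.continuousAt_chordLength) hS).eventually_const_lt ?_
    rw [Function.comp_apply, hS0]
    exact hx.chordLength_pos hm
  have c3 : ∀ᶠ y in 𝓝 y₀, 0 <
      ⟪(sliceLift x₀ y).1.1, hitPoint (L 0) (sliceLift x₀ y).1 - (sliceEndpoints x₀ y).1⟫ := by
    have h1 : ContinuousAt (fun y => hitPoint (L 0) (sliceLift x₀ y).1) y₀ :=
      ContinuousAt.comp (g := hitPoint (L 0)) (f := fun y => (sliceLift x₀ y).1)
        (by rw [hS0]; exact continuousAt_hitPoint hx.direction_zero_notMem) hS.fst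
    refine (hS.fst.fst.inner (h1.sub hE.fst)).eventually_const_lt ?_
    simp only [Pi.sub_apply]
    rw [hS0, hE0, hx.hitPoint_fst]
    change 0 < ⟪direction 0 x₀, (x₀.2.1 0 : E) - x₀.1⟫
    rw [← edgeVec_zero, inner_direction_edgeVec]
    exact norm_pos_iff.2 (hx.edgeVec_ne_zero _)
  have c4 : ∀ᶠ y in 𝓝 y₀, 0 <
      ⟪(sliceLift x₀ y).2.1, (sliceEndpoints x₀ y).2 -
        hitPoint (L (Fin.last m)) (sliceLift x₀ y).2⟫ := by
    have h1 : ContinuousAt (fun y => hitPoint (L (Fin.last m)) (sliceLift x₀ y).2) y₀ :=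
      ContinuousAt.comp (g := hitPoint (L (Fin.last m))) (f := fun y => (sliceLift x₀ y).2)
        (by rw [hS0]; exact continuousAt_hitPoint hx.direction_last_notMem) hS.snd
    refine (hS.snd.fst.inner (hE.snd.sub h1)).eventually_const_lt ?_
    simp only [Pi.sub_apply]
    rw [hS0, hE0, hx.hitPoint_snd]
    change 0 < ⟪direction (Fin.last (m + 1)) x₀, x₀.2.2 - (x₀.2.1 (Fin.last m) : E)⟫
    rw [← edgeVec_last, inner_direction_edgeVec]
    exact norm_pos_iff.2 (hx.edgeVec_ne_zero _)
  have c5 : ∀ᶠ y in 𝓝 y₀, ⟪p₀.1.1, (normLift p₀ y).1.1⟫ ≠ 0 := by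
    refine (continuousAt_const.inner hN.fst.fst).eventually_ne ?_
    rwa [hN0]
  have c6 : ∀ᶠ y in 𝓝 y₀, ⟪p₀.2.1, (normLift p₀ y).2.1⟫ ≠ 0 := by
    refine (continuousAt_const.inner hN.snd.fst).eventually_ne ?_
    rwa [hN0]
  have c7 : ∀ᶠ y in 𝓝 y₀, sliceDen p₀ (normLift p₀ y) ≠ 0 := by
    refine (ContinuousAt.comp (g := sliceDen p₀) (f := normLift p₀) (by
      rw [hN0]; exact (contDiffAt_sliceDen (n := 0) d1 d2).continuousAt) hN).eventually_ne ?_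
    rwa [Function.comp_apply, hN0]
  filter_upwards [self_mem_nhdsWithin, mem_nhdsWithin_of_mem_nhds c1,
    mem_nhdsWithin_of_mem_nhds c2, mem_nhdsWithin_of_mem_nhds c3, mem_nhdsWithin_of_mem_nhds c4,
    mem_nhdsWithin_of_mem_nhds c5, mem_nhdsWithin_of_mem_nhds c6, mem_nhdsWithin_of_mem_nhds c7,
    mem_nhdsWithin_of_mem_nhds (eventually_inner_projClass_ne_zero h0)]
  rintro _ ⟨p, hp, rfl⟩ e1 e2 e3 e4 e5 e6 e7 e8
  have hne := inner_covec_ne_zero_of_projClass e8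
  have hpos : 0 < chordLength L p := by
    obtain ⟨x, hx', rfl⟩ := hp
    exact hx'.chordLength_pos hm
  -- The normalizing factor is positive, because the chord length is positive both before and after
  -- scaling; only positive multiples are known to be billiard covectors.
  have hlift : ∃ c : ℝ, 0 < c ∧ sliceLift x₀ (projClass p) = scale c p := by
    refine ⟨_, ?_, by rw [sliceLift, ← hp₀, normLift_projClass hne, sliceScale, scale_scale]⟩
    rw [sliceLift, ← hp₀, normLift_projClass hne, sliceScale, scale_scale,
      chordLength_scale] at e2
    exact pos_of_mul_pos_left e2 hpos.le
  obtain ⟨c, hc, hlift⟩ := hlift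
  obtain ⟨x, hx1, hx2, hx3, hx4⟩ := exists_path_through
    (p := sliceLift x₀ (projClass p)) (hlift ▸ scale_mem_billiardCovectors hc hp) rfl rfl e3 e4
  refine ⟨x, hx1, by rw [hx2, hlift, projClass_scale hc.ne'], Prod.ext hx3 hx4, ?_⟩
  have hi := inner_slicePoint_sliceScale (p₀ := p₀) (P := normLift p₀ (projClass p))
    (α := ⟪direction 0 x₀, x₀.1⟫) (β := ⟪direction (Fin.last (m + 1)) x₀, x₀.2.2⟫) e7
  have hi0 := hx.inner_endpoints hm
  rw [normalConstraint_apply, Prod.fst_sub, Prod.snd_sub]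
  simp only [inner_sub_right]
  refine Prod.ext (sub_eq_zero.2 (inner_slideTo (w := (sliceLift x₀ (projClass p)).1) e5))
    (Prod.ext (sub_eq_zero.2 (inner_slideTo (w := (sliceLift x₀ (projClass p)).2) e6)) ?_)
  change ⟪p₀.1.2, (sliceEndpoints x₀ (projClass p)).1⟫ - ⟪p₀.1.2, x₀.1⟫ +
    (⟪p₀.2.2, (sliceEndpoints x₀ (projClass p)).2⟫ - ⟪p₀.2.2, x₀.2.2⟫) = 0
  have hi' : ⟪p₀.1.2, (sliceEndpoints x₀ (projClass p)).1⟫ +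
    ⟪p₀.2.2, (sliceEndpoints x₀ (projClass p)).2⟫ = ‖covec p₀‖ ^ 2 := hi
  linarith

end LegendrianChart

/-! ### The billiard covectors form a Legendrian manifold -/

section LegendrianRelation

variable {E : Type*} [NormedAddCommGroup E] [InnerProductSpace ℝ E] [FiniteDimensional ℝ E] {m : ℕ}
  {L : Fin (m + 1) → Submodule ℝ E} {x₀ : PathData L}

/-- Classes near that of `endLines x₀` are represented by billiard paths near `x₀`. -/
theorem IsBilliardPath.eventually_exists_path_mem (hx : IsBilliardPath x₀) (hm : 0 < m)
    {V : Set (PathData L)} (hV : V ∈ 𝓝 x₀) :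
    ∀ᶠ y in 𝓝[projClass '' billiardCovectors L] (projClass (endLines x₀)),
      ∃ x ∈ V, IsBilliardPath x ∧ projClass (endLines x) = y := by
  obtain ⟨h, hcont, h0, hev⟩ := hx.exists_family
  have hE : Tendsto (sliceEndpoints x₀)
      (𝓝[projClass '' billiardCovectors L] (projClass (endLines x₀))) (𝓝 (x₀.1, x₀.2.2)) := by
    have := (hx.contDiffAt_sliceEndpoints hm).continuousAt.tendsto
    rw [hx.sliceEndpoints_self hm] at this
    exact this.mono_left nhdsWithin_le_nhds
  have hV' : ∀ᶠ c in 𝓝 (x₀.1, x₀.2.2), h c ∈ V :=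
    hcont.continuousAt.eventually_mem (by rwa [h0])
  filter_upwards [hx.eventually_exists_path hm, hE.eventually hev, hE.eventually hV']
  rintro y ⟨x, hx1, hx2, hx3, -⟩ ⟨e1, e2, e3⟩ e4
  -- Uniqueness for given end points identifies `x`, whose vertices were not known to be close to
  -- those of `x₀`, with a member of the continuous family.
  have : x = h (sliceEndpoints x₀ y) := by
    refine hx1.eq_of_endpoints e3 ?_ ?_
    · rw [e1, ← hx3]
    · rw [e2, ← hx3]
  exact ⟨x, this ▸ e4, hx1, hx2⟩

/-- The coordinates are displacements of the end points of `x₀`. Two constraints keep them in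
hyperplanes transverse to the end lines, the third fixes the scale: scaling moves `⟪Q₋, A⟫ + ⟪Q₊,
B⟫` away from its value `‖Q‖ ^ 2`, which is not zero. -/
theorem projClass_billiardCovectors_hasCharts (hn : 2 ≤ Module.finrank ℝ E) (hm : 0 < m) :
    HasCharts (2 * Module.finrank ℝ E - 3) (projClass '' billiardCovectors L) := by
  rintro _ ⟨_, ⟨x₀, hx, rfl⟩, rfl⟩
  obtain ⟨h, hcont, h0, hev⟩ := hx.exists_family
  set p₀ := endLines x₀ with hp₀
  set c₀ : E × E := (x₀.1, x₀.2.2) with hc₀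
  have hp₀m := hx.endLines_mem hm
  have hcov0 := cotangentNonzero.covec_ne_zero hp₀m
  obtain ⟨d1, d2, d3⟩ := hx.inner_ne_zero hm
  have hE0 := hx.sliceEndpoints_self hm
  have hE := hx.contDiffAt_sliceEndpoints hm
  let α := ⟪direction 0 x₀, x₀.1⟫
  let β := ⟪direction (Fin.last (m + 1)) x₀, x₀.2.2⟫
  have hF : ContDiffAt ℝ ω (fun c => endLines (h c)) c₀ :=
    ContDiffAt.comp (g := endLines) (f := h) c₀
      (by rw [h0]; exact contDiffAt_endLines hx.edgeVec_ne_zero) hcont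
  have hF0 : endLines (h c₀) = p₀ := by rw [h0]
  have htr : Tendsto (fun a : E × E => c₀ + a) (𝓝 0) (𝓝 c₀) := by
    have : Continuous fun a : E × E => c₀ + a := by fun_prop
    simpa using this.tendsto 0
  refine exists_isChartAt_of_ker (normalConstraint p₀) (normalConstraint_surjective hp₀m)
    (f := fun a => projClass (endLines (h (c₀ + a)))) (g := fun y => sliceEndpoints x₀ y - c₀)
    (by simp; omega) ?_ ?_ ?_ ?_ ?_ ?_
  · rw [hE0, sub_self]
  · refine ContDiffAt.comp (g := projClass) (f := fun a => endLines (h (c₀ + a))) 0 ?_ ?_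
    · rw [add_zero, hF0]
      exact contDiffAt_projClass hcov0
    · refine ContDiffAt.comp (g := fun c => endLines (h c)) (f := fun a => c₀ + a) 0 ?_
        (contDiffAt_const.add contDiffAt_id)
      rwa [add_zero]
  · simp only [add_zero, hF0]
  · have k1 : ∀ᶠ c in 𝓝 c₀, ⟪p₀.1.1, (endLines (h c)).1.1⟫ ≠ 0 :=
      (continuousAt_const.inner hF.continuousAt.fst.fst).eventually_ne (by rwa [hF0])
    have k2 : ∀ᶠ c in 𝓝 c₀, ⟪p₀.2.1, (endLines (h c)).2.1⟫ ≠ 0 :=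
      (continuousAt_const.inner hF.continuousAt.snd.fst).eventually_ne (by rwa [hF0])
    have k3 : ∀ᶠ c in 𝓝 c₀, sliceNum p₀ α β (endLines (h c)) ≠ 0 := by
      refine (ContinuousAt.comp (g := sliceNum p₀ α β) (f := fun c => endLines (h c)) (by
        rw [hF0]; exact (contDiffAt_sliceNum (n := 0) d1 d2).continuousAt)
        hF.continuousAt).eventually_ne ?_
      rw [Function.comp_apply, hF0, sliceNum_self hp₀m]
      simpa using hcov0
    have k4 : ∀ᶠ c in 𝓝 c₀, ⟪covec p₀, covec (endLines (h c))⟫ ≠ 0 := by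
      refine (continuousAt_const.inner (ContinuousAt.comp (g := covec)
        (f := fun c => endLines (h c)) (contDiff_covec (n := 0)).continuous.continuousAt
        hF.continuousAt)).eventually_ne ?_
      rw [Function.comp_apply, hF0, real_inner_self_eq_norm_sq]
      simpa using hcov0
    filter_upwards [htr.eventually (hev.and (k1.and (k2.and (k3.and k4))))]
    rintro a ⟨⟨e1, e2, e3⟩, k1, k2, k3, k4⟩ hφ
    rw [normalConstraint_apply, Prod.mk_eq_zero, Prod.mk_eq_zero] at hφ
    obtain ⟨f1, f2, f3⟩ := hφ
    refine ⟨⟨_, ⟨_, e3, rfl⟩, rfl⟩, ?_⟩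
    have hl : ‖covec p₀‖ ^ 2 / ⟪covec p₀, covec (endLines (h (c₀ + a)))⟫ ≠ 0 :=
      div_ne_zero (by simpa using hcov0) k4
    have hi0 := hx.inner_endpoints hm
    -- The factor `l` is the one by which `normLift` rescales the covector; the slice normalization
    -- undoes it and returns the end points.
    have hs := slice_unique (p₀ := p₀) (α := α) (β := β) (A := (c₀ + a).1) (B := (c₀ + a).2)
      (t := ⟪direction 0 (h (c₀ + a)), (h (c₀ + a)).1⟫)
      (t' := ⟪direction (Fin.last (m + 1)) (h (c₀ + a)), (h (c₀ + a)).2.2⟫)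
      hl k1 k2 k3
      (by rw [← e1]; exact eq_lineCoord_add _ _) (by rw [← e2]; exact eq_lineCoord_add _ _)
      (by rw [Prod.fst_add, inner_add_right, f1, add_zero]; rfl)
      (by rw [Prod.snd_add, inner_add_right, f2, add_zero]; rfl)
      (by rw [Prod.fst_add, Prod.snd_add, inner_add_right, inner_add_right]; linarith)
    rw [sub_eq_iff_eq_add', sliceEndpoints, sliceLift, normLift_projClass k4]
    exact hs
  · filter_upwards [hE.eventually (by simp)] with y hy
    exact (hy.differentiableAt (by simp)).sub_const c₀
  · have hE' : Tendsto (sliceEndpoints x₀)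
        (𝓝[projClass '' billiardCovectors L] (projClass p₀)) (𝓝 c₀) := by
      have := hE.continuousAt.tendsto
      rw [hE0] at this
      exact this.mono_left nhdsWithin_le_nhds
    filter_upwards [hx.eventually_exists_path hm, hE'.eventually hev]
    rintro y ⟨x, hx1, hx2, hx3, hx4⟩ ⟨e1, e2, e3⟩
    refine ⟨hx4, ?_⟩
    have : x = h (sliceEndpoints x₀ y) := by
      refine hx1.eq_of_endpoints e3 ?_ ?_
      · rw [e1, ← hx3]
      · rw [e2, ← hx3]
    rw [add_sub_cancel, ← this, hx2]

omit [FiniteDimensional ℝ E] in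
theorem contactForm_scale (c : ℝ) (p : (E × E) × (E × E)) (η : E × E) :
    contactForm (scale c p) η = c * contactForm p η := by
  simp only [contactForm, scale, inner_smul_left, conj_trivial]
  ring

/-- The length functional generates the relation, so the relation is isotropic. -/
theorem tangentVectors_projClass_billiardCovectors_subset (hm : 0 < m) {y : ProjAmbient E}
    (hy : y ∈ projClass '' billiardCovectors L) :
    tangentVectors (projClass '' billiardCovectors L) y ⊆ contactHyperplane y := by
  obtain ⟨_, ⟨x₀, hx, rfl⟩, rfl⟩ := hy
  rintro ξ ⟨γ, hγ0, hγ, hd⟩ p hp hpy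
  have hp₀m := hx.endLines_mem hm
  obtain ⟨h1, h2, -, -, -⟩ := mem_cotangentNonzero_iff.1 hp₀m
  obtain ⟨c, -, rfl⟩ := (projClass_eq_iff hp₀m hp).1 hpy.symm
  rw [contactForm_scale]
  refine mul_eq_zero_of_right c ?_
  obtain ⟨g1, g2⟩ := hasDerivAt_components hd
  obtain ⟨g2, -⟩ := hasDerivAt_components g2
  obtain ⟨ζ, hζ⟩ := exists_hasDerivAt_comp (f := sliceEndpoints x₀) (γ := γ)
    (by rw [hγ0]; exact (hx.contDiffAt_sliceEndpoints hm).of_le (by simp)) hd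
  obtain ⟨z1, z2⟩ := hasDerivAt_components hζ
  have hev : ∀ᶠ s in 𝓝 (0 : ℝ), ∃ x : PathData L, IsBilliardPath x ∧
      projClass (endLines x) = γ s ∧ (x.1, x.2.2) = sliceEndpoints x₀ (γ s) := by
    have ht : Tendsto γ (𝓝 0)
        (𝓝[projClass '' billiardCovectors L] (projClass (endLines x₀))) := by
      rw [← hγ0]
      exact tendsto_nhdsWithin_iff.2 ⟨hd.continuousAt, hγ⟩
    exact (ht.eventually (hx.eventually_exists_path hm)).mono
      fun s ⟨x, e1, e2, e3, _⟩ => ⟨x, e1, e2, e3⟩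
  have hunit : ∀ᶠ s in 𝓝 (0 : ℝ), ⟪(γ s).1, (γ s).1⟫ = 1 ∧ ⟪(γ s).2.1, (γ s).2.1⟫ = 1 := by
    filter_upwards [hev]
    rintro s ⟨x, hx1, hx2, -⟩
    obtain ⟨k1, k2, -⟩ := mem_cotangentNonzero_iff.1 (hx1.endLines_mem hm)
    rw [← hx2]
    exact ⟨k1, k2⟩
  have c1 := hasDerivAt_inner_of_eventually_const g1 g1 (hunit.mono fun s hs => hs.1)
  have c2 := hasDerivAt_inner_of_eventually_const g2 g2 (hunit.mono fun s hs => hs.2)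
  have hE0 := hx.sliceEndpoints_self hm
  have hder := (((g2.sub_const (direction (Fin.last (m + 1)) x₀)).inner ℝ z2).sub
    ((g1.sub_const (direction 0 x₀)).inner ℝ z1))
  have hγ1 : (γ 0).1 = direction 0 x₀ := by rw [hγ0]; rfl
  have hγ2 : (γ 0).2.1 = direction (Fin.last (m + 1)) x₀ := by rw [hγ0]; rfl
  -- This is the length of the path at time `s` minus its lower bound by the calibration of `x₀`. It
  -- is nonnegative and vanishes at `s = 0`.
  have hmin : IsLocalMin (fun s => ⟪(γ s).2.1 - direction (Fin.last (m + 1)) x₀,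
      (sliceEndpoints x₀ (γ s)).2⟫ - ⟪(γ s).1 - direction 0 x₀,
      (sliceEndpoints x₀ (γ s)).1⟫) 0 := by
    filter_upwards [hev]
    rintro s ⟨x, hx1, hx2, hx3⟩
    have e1 := hx1.pathLength_eq
    have e2 := hx.le_pathLength x
    have f1 : (γ s).1 = direction 0 x := by rw [← hx2]; rfl
    have f2 : (γ s).2.1 = direction (Fin.last (m + 1)) x := by rw [← hx2]; rfl
    rw [hγ1, hγ2, sub_self, sub_self, inner_zero_left, inner_zero_left, sub_zero, f1, f2, ← hx3,
      inner_sub_left, inner_sub_left]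
    linarith
  -- At `s = 0` both differences of velocities are zero, so the derivatives of the end points drop
  -- out and `⟪δv₊, B⟫ = ⟪δv₋, A⟫` remains.
  have hzero := hmin.hasDerivAt_eq_zero hder
  rw [hγ1, hγ2, sub_self, sub_self, inner_zero_left, inner_zero_left, zero_add, zero_add, hγ0,
    hE0] at hzero
  rw [hγ1, real_inner_comm (direction 0 x₀) ξ.1] at c1
  rw [hγ2, real_inner_comm (direction (Fin.last (m + 1)) x₀) ξ.2.1] at c2
  -- Velocities vary orthogonally to themselves, so A and B can be replaced by `Q₋` and `Q₊`.
  have f1 : ⟪direction 0 x₀, ξ.1⟫ = 0 := by linarith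
  have f2 : ⟪direction (Fin.last (m + 1)) x₀, ξ.2.1⟫ = 0 := by linarith
  simp only [contactForm, endLines, lineCoord, baseProj, inner_sub_left, inner_smul_left, f1, f2,
    mul_zero, sub_zero]
  rw [real_inner_comm x₀.1, real_inner_comm x₀.2.2] at hzero
  linarith

theorem billiardCovectors_subset (hm : 0 < m) : billiardCovectors L ⊆ cotangentNonzero E := by
  rintro _ ⟨x, hx, rfl⟩
  exact hx.endLines_mem hm

theorem projClass_billiardCovectors_isLegendrian (hn : 2 ≤ Module.finrank ℝ E) (hm : 0 < m) :
    IsLegendrian (projClass '' billiardCovectors L) :=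
  ⟨image_mono (billiardCovectors_subset hm),
    (projClass_billiardCovectors_hasCharts hn hm).isSubmanifold,
    fun _ hy => tangentVectors_projClass_billiardCovectors_subset hm hy⟩

end LegendrianRelation

/-! ### The time intervals of the edges -/

section Edges

variable {m : ℕ} {t : Fin (m + 1) → ℝ}

theorem mem_edge_zero (ht : StrictMono t) {s : ℝ} : s ∈ edge t 0 ↔ s ≤ t 0 := by
  refine ⟨fun h => (h 0).2 (Fin.zero_le _), fun h i => ⟨fun hi => absurd hi (by simp), fun _ => ?_⟩⟩
  exact h.trans (ht.monotone (Fin.zero_le i))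

theorem mem_edge_last (ht : StrictMono t) {s : ℝ} :
    s ∈ edge t (Fin.last (m + 1)) ↔ t (Fin.last m) ≤ s := by
  refine ⟨fun h => (h (Fin.last m)).1 (Fin.castSucc_lt_last _), fun h i => ⟨fun _ => ?_, fun hi => ?_⟩⟩
  · exact (ht.monotone (Fin.le_last i)).trans h
  · exact absurd hi (not_le.2 (Fin.castSucc_lt_last i))

theorem mem_edge_castSucc_succ (ht : StrictMono t) {s : ℝ} (i : Fin m) :
    s ∈ edge t i.castSucc.succ ↔ t i.castSucc ≤ s ∧ s ≤ t i.succ := by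
  refine ⟨fun h => ⟨(h i.castSucc).1 Fin.castSucc_lt_succ, (h i.succ).2 ?_⟩,
    fun h k => ⟨fun hk => ?_, fun hk => ?_⟩⟩
  · rw [Fin.succ_castSucc]
  · exact (ht.monotone (Fin.castSucc_lt_succ_iff.1 hk)).trans h.1
  · rw [Fin.succ_castSucc, Fin.castSucc_le_castSucc_iff] at hk
    exact h.2.trans (ht.monotone hk)

theorem mem_edge_castSucc (ht : StrictMono t) (i : Fin (m + 1)) : t i ∈ edge t i.castSucc :=
  fun _ => ⟨fun h => ht.monotone (Fin.castSucc_lt_castSucc_iff.1 h).le,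
    fun h => ht.monotone (Fin.castSucc_le_castSucc_iff.1 h)⟩

theorem mem_edge_succ (ht : StrictMono t) (i : Fin (m + 1)) : t i ∈ edge t i.succ :=
  fun _ => ⟨fun h => ht.monotone (Fin.castSucc_lt_succ_iff.1 h),
    fun h => ht.monotone (Fin.succ_le_castSucc_iff.1 h).le⟩

theorem exists_mem_edge_forall_ne (ht : StrictMono t) (j : Fin (m + 2)) :
    ∃ s ∈ edge t j, ∀ i, s ≠ t i := by
  induction j using forall_edge with
  | h0 =>
    refine ⟨t 0 - 1, (mem_edge_zero ht).2 (by linarith), fun i => ?_⟩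
    have := ht.monotone (Fin.zero_le i)
    exact ne_of_lt (by linarith)
  | hl =>
    refine ⟨t (Fin.last m) + 1, (mem_edge_last ht).2 (by linarith), fun i => ?_⟩
    have := ht.monotone (Fin.le_last i)
    exact ne_of_gt (by linarith)
  | hm i =>
    have h := ht (Fin.castSucc_lt_succ (i := i))
    refine ⟨(t i.castSucc + t i.succ) / 2,
      (mem_edge_castSucc_succ ht i).2 ⟨by linarith, by linarith⟩, fun k => ?_⟩
    rcases le_or_gt k i.castSucc with hk | hk
    · have := ht.monotone hk
      exact ne_of_gt (by linarith)
    · have := ht.monotone (Fin.castSucc_lt_iff_succ_le.1 hk)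
      exact ne_of_lt (by linarith)

theorem exists_mem_edge (ht : StrictMono t) (s : ℝ) : ∃ j, s ∈ edge t j := by
  by_cases h : ∀ i, s ≤ t i
  · exact ⟨0, (mem_edge_zero ht).2 (h 0)⟩
  · push Not at h
    obtain ⟨i, hi, hmax⟩ := (Finset.univ.filter fun i => t i < s).exists_max_image id
      (by obtain ⟨i, hi⟩ := h; exact ⟨i, by simpa using hi⟩)
    simp only [Finset.mem_filter, Finset.mem_univ, true_and, id] at hi hmax
    refine ⟨i.succ, fun k => ⟨fun hk => ?_, fun hk => ?_⟩⟩
    · exact (ht.monotone (Fin.castSucc_lt_succ_iff.1 hk)).trans hi.le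
    · by_contra hlt
      exact absurd (hmax k (not_le.1 hlt)) (not_le.2 (Fin.succ_le_castSucc_iff.1 hk))

/-- Different edges meet at most in a common end point. -/
theorem eq_of_mem_edge_of_mem_edge (ht : StrictMono t) {j j' : Fin (m + 2)} (hj : j < j') {s : ℝ}
    (h : s ∈ edge t j) (h' : s ∈ edge t j') :
    ∃ i : Fin (m + 1), j = i.castSucc ∧ j' = i.succ ∧ s = t i := by
  obtain ⟨i, rfl⟩ := Fin.exists_castSucc_eq.2 (Fin.ne_last_of_lt hj)
  have h1 : s = t i := le_antisymm ((h i).2 le_rfl) ((h' i).1 hj)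
  refine ⟨i, rfl, ?_, h1⟩
  by_contra hne
  have h2 : i.succ < j' := lt_of_le_of_ne (Fin.castSucc_lt_iff_succ_le.1 hj) (Ne.symm hne)
  obtain ⟨k, hk⟩ := Fin.exists_castSucc_eq.2 (Fin.ne_last_of_lt h2)
  have h3 := (h' k).1 (hk ▸ h2)
  have h4 : t i < t k := ht (Fin.castSucc_lt_castSucc_iff.1 (hk ▸ Fin.castSucc_lt_succ))
  linarith

end Edges

/-! ### Trajectories and billiard paths -/

section Trajectories

variable {E : Type*} [NormedAddCommGroup E] [InnerProductSpace ℝ E] [FiniteDimensional ℝ E] {m : ℕ}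
  {𝓛 : Finset (Submodule ℝ E)} {L : Fin (m + 1) → Submodule ℝ E}
  {q : ℝ → E} {t : Fin (m + 1) → ℝ} {u : Fin (m + 2) → E}

/-- The velocity of a trajectory is never parallel to the subspace of an adjacent collision. -/
theorem IsTrajectory.velocity_notMem (hL : ∀ i, L i ∈ 𝓛) (h : IsTrajectory 𝓛 L q t u)
    {j : Fin (m + 2)} {i : Fin (m + 1)} (hi : t i ∈ edge t j) : u j ∉ L i := by
  intro hu
  -- A velocity in `L i` would keep the whole edge in the collision locus, also at this time, which
  -- is not a collision time.
  obtain ⟨s, hs, hne⟩ := exists_mem_edge_forall_ne h.strictMono j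
  have h1 := h.polygonal j (t i) hi s hs
  have h2 : q s ∈ L i := by
    rw [sub_eq_iff_eq_add.1 h1]
    exact add_mem ((L i).smul_mem _ hu) (h.mem i)
  obtain ⟨k, hk⟩ := h.exact s ⟨L i, hL i, h2⟩
  exact hne k hk

/-- The boundary data of a trajectory, with end points at the times `s₀` and `s₁`. -/
def IsTrajectory.pathData (h : IsTrajectory 𝓛 L q t u) (s₀ s₁ : ℝ) : PathData L :=
  (q s₀, fun i => ⟨q (t i), h.mem i⟩, q s₁)

theorem IsTrajectory.edgeVec_pathData (h : IsTrajectory 𝓛 L q t u) {s₀ s₁ : ℝ} (h₀ : s₀ < t 0)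
    (h₁ : t (Fin.last m) < s₁) (j : Fin (m + 2)) :
    ∃ c : ℝ, 0 < c ∧ edgeVec j (h.pathData s₀ s₁) = c • u j := by
  induction j using forall_edge with
  | h0 =>
    refine ⟨t 0 - s₀, sub_pos.2 h₀, ?_⟩
    rw [edgeVec_zero]
    exact h.polygonal 0 s₀ ((mem_edge_zero h.strictMono).2 h₀.le) (t 0)
      ((mem_edge_zero h.strictMono).2 le_rfl)
  | hl =>
    refine ⟨s₁ - t (Fin.last m), sub_pos.2 h₁, ?_⟩
    rw [edgeVec_last]
    exact h.polygonal _ _ ((mem_edge_last h.strictMono).2 le_rfl) s₁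
      ((mem_edge_last h.strictMono).2 h₁.le)
  | hm i =>
    have hlt := h.strictMono (Fin.castSucc_lt_succ (i := i))
    refine ⟨t i.succ - t i.castSucc, sub_pos.2 hlt, ?_⟩
    rw [edgeVec_castSucc_succ]
    exact h.polygonal _ _ ((mem_edge_castSucc_succ h.strictMono i).2 ⟨le_rfl, hlt.le⟩) _
      ((mem_edge_castSucc_succ h.strictMono i).2 ⟨hlt.le, le_rfl⟩)

theorem IsTrajectory.isBilliardPath (hL : ∀ i, L i ∈ 𝓛) (h : IsTrajectory 𝓛 L q t u) {s₀ s₁ : ℝ}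
    (h₀ : s₀ < t 0) (h₁ : t (Fin.last m) < s₁) : IsBilliardPath (h.pathData s₀ s₁) ∧
      endLines (h.pathData s₀ s₁) = (lineCoord (q (t 0)) (u 0),
        lineCoord (q (t (Fin.last m))) (u (Fin.last (m + 1)))) := by
  have hd : ∀ j, direction j (h.pathData s₀ s₁) = u j := by
    intro j
    obtain ⟨c, hc, hj⟩ := h.edgeVec_pathData h₀ h₁ j
    rw [direction, hj, norm_smul, Real.norm_of_nonneg hc.le, h.unit_speed, mul_one,
      inv_smul_smul₀ hc.ne']
  refine ⟨⟨fun i hi => ?_, fun i hi => ?_, fun i => ?_⟩, ?_⟩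
  · obtain ⟨c, hc, hj⟩ := h.edgeVec_pathData h₀ h₁ i.castSucc
    rw [hj, (L i).smul_mem_iff hc.ne'] at hi
    exact h.velocity_notMem hL (mem_edge_castSucc h.strictMono i) hi
  · obtain ⟨c, hc, hj⟩ := h.edgeVec_pathData h₀ h₁ i.succ
    rw [hj, (L i).smul_mem_iff hc.ne'] at hi
    exact h.velocity_notMem hL (mem_edge_succ h.strictMono i) hi
  · rw [hd, hd, h.momentum]
  · have e1 := h.polygonal 0 (t 0) ((mem_edge_zero h.strictMono).2 le_rfl) s₀
      ((mem_edge_zero h.strictMono).2 h₀.le)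
    have e2 := h.polygonal _ _ ((mem_edge_last h.strictMono).2 le_rfl) s₁
      ((mem_edge_last h.strictMono).2 h₁.le)
    rw [sub_eq_iff_eq_add'] at e1 e2
    rw [endLines, hd, hd, ← lineCoord_add_smul (A := q (t 0)) (h.unit_speed 0) (s₀ - t 0), ← e1,
      ← lineCoord_add_smul (A := q (t (Fin.last m))) (h.unit_speed _) (s₁ - t (Fin.last m)), ← e2]
    rfl

/-- A point of an end ray or a segment is `q` at the affinely interpolated time, which stays on the
same edge and is not a collision time. -/
theorem IsTrajectory.pathData_mem_cleanPaths (h : IsTrajectory 𝓛 L q t u) {s₀ s₁ : ℝ}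
    (h₀ : s₀ < t 0) (h₁ : t (Fin.last m) < s₁) : h.pathData s₀ s₁ ∈ cleanPaths 𝓛 L := by
  have key : ∀ j, ∀ a ∈ edge t j, ∀ b ∈ edge t j, ∀ r : ℝ, AffineMap.lineMap a b r ∈ edge t j →
      (∀ i, AffineMap.lineMap a b r ≠ t i) →
      AffineMap.lineMap (q a) (q b) r ∉ collisionLocus 𝓛 := by
    intro j a ha b hb r hr hne hmem
    have e1 := h.polygonal j a ha b hb
    have e2 := h.polygonal j a ha _ hr
    have e3 : AffineMap.lineMap (q a) (q b) r = q (AffineMap.lineMap a b r) := by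
      rw [sub_eq_iff_eq_add] at e2
      rw [e2, AffineMap.lineMap_apply_module', AffineMap.lineMap_apply_module', e1,
        add_sub_cancel_right, smul_eq_mul, mul_smul]
    obtain ⟨i, hi⟩ := h.exact _ (e3 ▸ hmem)
    exact hne i hi
  refine ⟨fun r hr => ?_, fun r hr => ?_, fun i r hr => ?_⟩
  · have hlt : AffineMap.lineMap (t 0) s₀ r < t 0 := by
      rw [AffineMap.lineMap_apply_module', smul_eq_mul]
      nlinarith
    exact key 0 (t 0) ((mem_edge_zero h.strictMono).2 le_rfl) s₀
      ((mem_edge_zero h.strictMono).2 h₀.le) r ((mem_edge_zero h.strictMono).2 hlt.le)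
      fun i => (hlt.trans_le (h.strictMono.monotone (Fin.zero_le i))).ne
  · have hlt : t (Fin.last m) < AffineMap.lineMap (t (Fin.last m)) s₁ r := by
      rw [AffineMap.lineMap_apply_module', smul_eq_mul]
      nlinarith
    exact key _ _ ((mem_edge_last h.strictMono).2 le_rfl) s₁
      ((mem_edge_last h.strictMono).2 h₁.le) r ((mem_edge_last h.strictMono).2 hlt.le)
      fun i => ((h.strictMono.monotone (Fin.le_last i)).trans_lt hlt).ne'
  · have ht := h.strictMono (Fin.castSucc_lt_succ (i := i))
    have h1 : t i.castSucc < AffineMap.lineMap (t i.castSucc) (t i.succ) r := by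
      rw [AffineMap.lineMap_apply_module', smul_eq_mul]
      nlinarith [hr.1]
    have h2 : AffineMap.lineMap (t i.castSucc) (t i.succ) r < t i.succ := by
      rw [AffineMap.lineMap_apply_module', smul_eq_mul]
      nlinarith [hr.2]
    refine key _ _ ((mem_edge_castSucc_succ h.strictMono i).2 ⟨le_rfl, ht.le⟩) _
      ((mem_edge_castSucc_succ h.strictMono i).2 ⟨ht.le, le_rfl⟩) r
      ((mem_edge_castSucc_succ h.strictMono i).2 ⟨h1.le, h2.le⟩) fun k hk => ?_
    rw [hk] at h1 h2
    have k1 := Fin.castSucc_lt_iff_succ_le.1 (h.strictMono.lt_iff_lt.1 h1)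
    exact (h.strictMono.lt_iff_lt.1 h2).not_ge k1

/-- A path that meets the collision locus only in its vertices is part of a trajectory. -/
theorem IsBilliardPath.exists_isTrajectory {x : PathData L}
    (hx : IsBilliardPath x) (hc : x ∈ cleanPaths 𝓛 L) :
    ∃ q t, IsTrajectory 𝓛 L q t (fun j => direction j x) ∧ (∀ i, q (t i) = x.2.1 i) ∧
      (∃ s < t 0, x.1 = q s) ∧ ∃ s > t (Fin.last m), x.2.2 = q s := by
  -- Unit speed: the first collision is at time zero, and the gaps are the lengths of the
  -- intermediate edges.
  let t : Fin (m + 1) → ℝ := Fin.partialSum fun i : Fin m => ‖edgeVec i.castSucc.succ x‖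
  have hsucc : ∀ i : Fin m, t i.succ = t i.castSucc + ‖edgeVec i.castSucc.succ x‖ :=
    fun i => Fin.partialSum_succ _ i
  have hnorm : ∀ j, 0 < ‖edgeVec j x‖ := fun j => norm_pos_iff.2 (hx.edgeVec_ne_zero j)
  have ht : StrictMono t := Fin.strictMono_iff_lt_succ.2 fun i => by
    rw [hsucc]
    linarith [hnorm i.castSucc.succ]
  -- Motion along the full line of each edge. Consecutive motions agree at the common collision
  -- time, so `q` below does not depend on the edge chosen for a time.
  let a : Fin (m + 2) → ℝ → E := Fin.cases (fun s => (x.2.1 0 : E) + (s - t 0) • direction 0 x)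
    (fun i s => (x.2.1 i : E) + (s - t i) • direction i.succ x)
  have ha0 : ∀ s, a 0 s = (x.2.1 0 : E) + (s - t 0) • direction 0 x := fun s => rfl
  have has : ∀ (i : Fin (m + 1)) s, a i.succ s = (x.2.1 i : E) + (s - t i) • direction i.succ x :=
    fun i s => rfl
  have hsub : ∀ j s s', a j s' - a j s = (s' - s) • direction j x := by
    intro j s s'
    refine Fin.cases ?_ (fun i => ?_) j
    · rw [ha0, ha0]; module
    · rw [has, has]; module
  have hat_succ : ∀ i : Fin (m + 1), a i.succ (t i) = x.2.1 i := fun i => by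
    rw [has, sub_self, zero_smul, add_zero]
  have hat_castSucc : ∀ i : Fin (m + 1), a i.castSucc (t i) = x.2.1 i := by
    intro i
    refine Fin.cases ?_ (fun i => ?_) i
    · rw [Fin.castSucc_zero, ha0, sub_self, zero_smul, add_zero]
    · rw [← Fin.succ_castSucc, has, hsucc, add_sub_cancel_left, norm_smul_direction,
        edgeVec_castSucc_succ]
      abel
  choose j hj using exists_mem_edge ht
  let q : ℝ → E := fun s => a (j s) s
  have hq : ∀ k s, s ∈ edge t k → q s = a k s := by
    intro k s hs
    rcases lt_trichotomy (j s) k with hlt | heq | hlt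
    · obtain ⟨i, e1, e2, e3⟩ := eq_of_mem_edge_of_mem_edge ht hlt (hj s) hs
      change a (j s) s = a k s
      rw [e1, e2, e3, hat_succ, hat_castSucc]
    · rw [← heq]
    · obtain ⟨i, e1, e2, e3⟩ := eq_of_mem_edge_of_mem_edge ht hlt hs (hj s)
      change a (j s) s = a k s
      rw [e1, e2, e3, hat_succ, hat_castSucc]
  have hqt : ∀ i, q (t i) = x.2.1 i := fun i => by
    rw [hq _ _ (mem_edge_succ ht i), hat_succ]
  have hlast : ∀ s, a (Fin.last (m + 1)) s = (x.2.1 (Fin.last m) : E) +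
      (s - t (Fin.last m)) • direction (Fin.last (m + 1)) x := fun s => by
    rw [← Fin.succ_last, has]
  refine ⟨q, t, ⟨ht, fun k s hs s' hs' => ?_, fun k => norm_direction (hx.edgeVec_ne_zero k),
    fun i => ?_, hx.momentum, fun s hs => ?_⟩, hqt, ?_, ?_⟩
  · rw [hq k s hs, hq k s' hs', hsub]
  · rw [hqt]
    exact (x.2.1 i).2
  -- An additional collision would lie in the interior of an edge. Dividing the time elapsed since
  -- the vertex, or remaining until it on the first edge, by the edge length gives the parameter
  -- that contradicts `cleanPaths`.
  · by_contra! hne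
    obtain ⟨hc1, hc2, hc3⟩ := hc
    have hjs := hj s
    have hqs : q s = a (j s) s := rfl
    revert hjs hqs
    generalize j s = k
    induction k using forall_edge with
    | h0 =>
      intro hjs hqs
      have hlt : s < t 0 := lt_of_le_of_ne ((mem_edge_zero ht).1 hjs) (hne 0)
      refine hc1 ((t 0 - s) * ‖edgeVec 0 x‖⁻¹)
        (mul_pos (sub_pos.2 hlt) (inv_pos.2 (hnorm 0))) ?_
      convert hs using 1
      rw [hqs, ha0, AffineMap.lineMap_apply_module', mul_smul, ← neg_sub (x.2.1 0 : E) x.1,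
        ← edgeVec_zero, smul_neg, ← direction]
      module
    | hl =>
      intro hjs hqs
      have hlt : t (Fin.last m) < s := lt_of_le_of_ne ((mem_edge_last ht).1 hjs) (hne _).symm
      refine hc2 ((s - t (Fin.last m)) * ‖edgeVec (Fin.last (m + 1)) x‖⁻¹)
        (mul_pos (sub_pos.2 hlt) (inv_pos.2 (hnorm _))) ?_
      convert hs using 1
      rw [hqs, hlast, AffineMap.lineMap_apply_module', mul_smul, ← edgeVec_last, ← direction]
      module
    | hm i =>
      intro hjs hqs
      obtain ⟨h1, h2⟩ := (mem_edge_castSucc_succ ht i).1 hjs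
      have h1' : t i.castSucc < s := lt_of_le_of_ne h1 (hne _).symm
      have h2' : s < t i.succ := lt_of_le_of_ne h2 (hne _)
      rw [hsucc] at h2'
      refine hc3 i ((s - t i.castSucc) * ‖edgeVec i.castSucc.succ x‖⁻¹)
        ⟨mul_pos (sub_pos.2 h1') (inv_pos.2 (hnorm _)), ?_⟩ ?_
      · rw [mul_inv_lt_iff₀ (hnorm _)]
        linarith
      · convert hs using 1
        rw [hqs, has, AffineMap.lineMap_apply_module', mul_smul, ← edgeVec_castSucc_succ,
          ← direction]
        module
  · refine ⟨t 0 - ‖edgeVec 0 x‖, by linarith [hnorm 0], ?_⟩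
    rw [hq 0 _ ((mem_edge_zero ht).2 (by linarith [hnorm 0])), ha0, sub_sub_cancel_left, neg_smul,
      norm_smul_direction, edgeVec_zero]
    abel
  · refine ⟨t (Fin.last m) + ‖edgeVec (Fin.last (m + 1)) x‖, by linarith [hnorm (Fin.last (m + 1))],
      ?_⟩
    rw [hq _ _ ((mem_edge_last ht).2 (by linarith [hnorm (Fin.last (m + 1))])), hlast,
      add_sub_cancel_left, norm_smul_direction, edgeVec_last]
    abel

end Trajectories

/-! ### Open quotients by local lifting, relatively open subsets, dimension of images -/

theorem isOpenQuotientMap_imageFactorization {X Y : Type*} [TopologicalSpace X]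
    [TopologicalSpace Y] {f : X → Y} {s : Set X} (hf : ContinuousOn f s)
    (h : ∀ x ∈ s, ∀ V ∈ 𝓝 x, ∀ᶠ y in 𝓝[f '' s] f x, ∃ x' ∈ s, x' ∈ V ∧ f x' = y) :
    IsOpenQuotientMap (imageFactorization f s) := by
  refine ⟨imageFactorization_surjective, (hf.domRestrict).subtype_mk _,
    IsOpenMap.of_nhds_le fun a V hV => ?_⟩
  rw [mem_map, mem_nhds_subtype] at hV
  obtain ⟨V', hV', hsub⟩ := hV
  have h1 := h a a.2 V' hV'
  rw [eventually_nhdsWithin_iff] at h1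
  refine mem_nhds_subtype _ _ _ |>.2 ⟨_, h1, fun y hy => ?_⟩
  obtain ⟨x, hx, hxV, hxy⟩ := hy y.2
  have : (⟨x, hx⟩ : s) ∈ Subtype.val ⁻¹' V' := hxV
  have h2 := hsub this
  rwa [mem_preimage, show imageFactorization f s ⟨x, hx⟩ = y from Subtype.ext hxy] at h2

theorem exists_isOpen_eq_inter {X : Type*} [TopologicalSpace X] {S M : Set X} (hS : S ⊆ M)
    (h : ∀ x ∈ S, ∀ᶠ y in 𝓝[M] x, y ∈ S) : ∃ O, IsOpen O ∧ S = M ∩ O := by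
  refine ⟨interior {y | y ∈ M → y ∈ S}, isOpen_interior, subset_antisymm (fun x hx => ?_) ?_⟩
  · exact ⟨hS hx, mem_interior_iff_mem_nhds.2 (eventually_nhdsWithin_iff.1 (h x hx))⟩
  · exact fun x hx => interior_subset hx.2 hx.1

theorem tangentVectors_mono {W : Type*} [NormedAddCommGroup W] [NormedSpace ℝ W] {S M : Set W}
    (h : S ⊆ M) (x : W) : tangentVectors S x ⊆ tangentVectors M x := by
  rintro ξ ⟨γ, h0, hγ, hd⟩
  exact ⟨γ, h0, hγ.mono fun s hs => h hs, hd⟩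

/-- The upper bound holds because linear maps are Lipschitz; a single immersion point gives the
lower bound. -/
theorem HasCharts.dimH_image_eq {W Y : Type*} [NormedAddCommGroup W] [NormedSpace ℝ W]
    [FiniteDimensional ℝ W] [NormedAddCommGroup Y] [NormedSpace ℝ Y] [FiniteDimensional ℝ Y]
    {k : ℕ} {M : Set W} (h : HasCharts k M) (b : W →L[ℝ] Y) {x : W}
    (hx : x ∈ immersionPoints M b) : dimH (b '' M) = (k : ENNReal) := by
  obtain ⟨O, -, -, -, -, hdim⟩ := h.exists_image_isSubmanifold b hx
  refine le_antisymm ?_ (hdim.trans (dimH_mono (image_mono inter_subset_left)))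
  exact (b.lipschitz.dimH_image_le M).trans h.dimH_le

/-! ### The scattering relation and its stable part -/

section ScatteringRelation

variable {E : Type*} [NormedAddCommGroup E] [InnerProductSpace ℝ E] {m : ℕ}
  {𝓛 : Finset (Submodule ℝ E)} {L : Fin (m + 1) → Submodule ℝ E}

theorem smul_mem_collisionLocus {c : ℝ} (hc : c ≠ 0) {x : E} :
    c • x ∈ collisionLocus 𝓛 ↔ x ∈ collisionLocus 𝓛 := by
  refine exists_congr fun M => and_congr_right fun _ => M.smul_mem_iff hc

theorem smul_mem_cleanPaths {c : ℝ} (hc : c ≠ 0) {x : PathData L} :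
    c • x ∈ cleanPaths 𝓛 L ↔ x ∈ cleanPaths 𝓛 L := by
  have key : ∀ (a b : E) (s : ℝ), AffineMap.lineMap (c • a) (c • b) s ∉ collisionLocus 𝓛 ↔
      AffineMap.lineMap a b s ∉ collisionLocus 𝓛 := by
    intro a b s
    rw [← smul_mem_collisionLocus hc (x := AffineMap.lineMap a b s),
      AffineMap.lineMap_apply_module', AffineMap.lineMap_apply_module', smul_add, smul_comm c s,
      smul_sub c]
  simp only [cleanPaths, mem_ofPred_eq, Prod.smul_fst, Prod.smul_snd, Pi.smul_apply,
    Submodule.coe_smul, key]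

theorem smul_mem_interior_cleanPaths {c : ℝ} (hc : c ≠ 0) {x : PathData L}
    (hx : x ∈ interior (cleanPaths 𝓛 L)) : c • x ∈ interior (cleanPaths 𝓛 L) := by
  have h : (fun y : PathData L => c⁻¹ • y) ⁻¹' cleanPaths 𝓛 L = cleanPaths 𝓛 L := by
    ext y
    exact smul_mem_cleanPaths (inv_ne_zero hc)
  have hcont : Continuous fun y : PathData L => c⁻¹ • y := continuous_const_smul _
  have := preimage_interior_subset_interior_preimage hcont (t := cleanPaths 𝓛 L)
  rw [h] at this
  refine this ?_
  rwa [mem_preimage, inv_smul_smul₀ hc]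

variable [FiniteDimensional ℝ E]

theorem IsBilliardPath.exists_isTrajectory_endLines (hL : ∀ i, L i ∈ 𝓛) {x : PathData L}
    (hx : IsBilliardPath x) (hc : x ∈ cleanPaths 𝓛 L) :
    ∃ q t u, IsTrajectory 𝓛 L q t u ∧ (∀ i, (x.2.1 i : E) = q (t i)) ∧
      (∃ s < t 0, x.1 = q s) ∧ (∃ s > t (Fin.last m), x.2.2 = q s) ∧
      endLines x = (lineCoord (q (t 0)) (u 0),
        lineCoord (q (t (Fin.last m))) (u (Fin.last (m + 1)))) := by
  obtain ⟨q, t, h, hqt, ⟨s₀, h₀, e₀⟩, s₁, h₁, e₁⟩ := hx.exists_isTrajectory hc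
  refine ⟨q, t, _, h, fun i => (hqt i).symm, ⟨s₀, h₀, e₀⟩, ⟨s₁, h₁, e₁⟩, ?_⟩
  rw [← (h.isBilliardPath hL h₀ h₁).2]
  congr 1
  exact Prod.ext e₀ (Prod.ext (funext fun i => Subtype.ext (hqt i).symm) e₁)

/-- Replaces curves in time by finite-dimensional path data, to which the length functional applies.
-/
theorem scatteringRelation_eq (hL : ∀ i, L i ∈ 𝓛) : scatteringRelation 𝓛 L =
    endLines '' {x : PathData L | IsBilliardPath x ∧ x ∈ cleanPaths 𝓛 L} := by
  ext p
  constructor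
  · rintro ⟨q, t, u, h, rfl⟩
    have h₀ : t 0 - 1 < t 0 := by linarith
    have h₁ : t (Fin.last m) < t (Fin.last m) + 1 := by linarith
    obtain ⟨h1, h2⟩ := h.isBilliardPath hL h₀ h₁
    exact ⟨_, ⟨h1, h.pathData_mem_cleanPaths h₀ h₁⟩, h2⟩
  · rintro ⟨x, ⟨hx, hc⟩, rfl⟩
    obtain ⟨q, t, u, h, -, -, -, he⟩ := hx.exists_isTrajectory_endLines hL hc
    exact ⟨q, t, u, h, he⟩

theorem stableScatteringRelation_eq (hL : ∀ i, L i ∈ 𝓛) : stableScatteringRelation 𝓛 L =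
    endLines '' {x : PathData L | IsBilliardPath x ∧ x ∈ interior (cleanPaths 𝓛 L)} := by
  ext p
  constructor
  · rintro ⟨q, t, u, h, ⟨x, hx, hq, ⟨s₀, h₀, e₀⟩, s₁, h₁, e₁⟩, rfl⟩
    obtain ⟨h1, h2⟩ := h.isBilliardPath hL h₀ h₁
    have : x = h.pathData s₀ s₁ :=
      Prod.ext e₀ (Prod.ext (funext fun i => Subtype.ext (hq i)) e₁)
    exact ⟨_, ⟨h1, this ▸ hx⟩, h2⟩
  · rintro ⟨x, ⟨hx, hc⟩, rfl⟩
    obtain ⟨q, t, u, h, h1, h2, h3, he⟩ :=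
      hx.exists_isTrajectory_endLines hL (interior_subset hc)
    exact ⟨q, t, u, h, ⟨x, hc, h1, h2, h3⟩, he⟩

theorem scatteringRelation_subset (hL : ∀ i, L i ∈ 𝓛) :
    scatteringRelation 𝓛 L ⊆ billiardCovectors L := by
  rw [scatteringRelation_eq hL]
  rintro _ ⟨x, hx, rfl⟩
  exact ⟨x, hx.1, rfl⟩

theorem stableScatteringRelation_subset (hL : ∀ i, L i ∈ 𝓛) :
    stableScatteringRelation 𝓛 L ⊆ billiardCovectors L := by
  rw [stableScatteringRelation_eq hL]
  rintro _ ⟨x, hx, rfl⟩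
  exact ⟨x, hx.1, rfl⟩

theorem scale_mem_scatteringRelation (hL : ∀ i, L i ∈ 𝓛) {c : ℝ} (hc : 0 < c)
    {p : (E × E) × (E × E)} (hp : p ∈ scatteringRelation 𝓛 L) :
    scale c p ∈ scatteringRelation 𝓛 L := by
  rw [scatteringRelation_eq hL] at hp ⊢
  obtain ⟨x, ⟨hx, hx'⟩, rfl⟩ := hp
  exact ⟨c • x, ⟨(hx.smul hc).1, (smul_mem_cleanPaths hc.ne').2 hx'⟩, (hx.smul hc).2⟩

theorem scale_mem_stableScatteringRelation (hL : ∀ i, L i ∈ 𝓛) {c : ℝ} (hc : 0 < c)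
    {p : (E × E) × (E × E)} (hp : p ∈ stableScatteringRelation 𝓛 L) :
    scale c p ∈ stableScatteringRelation 𝓛 L := by
  rw [stableScatteringRelation_eq hL] at hp ⊢
  obtain ⟨x, ⟨hx, hx'⟩, rfl⟩ := hp
  exact ⟨c • x, ⟨(hx.smul hc).1, smul_mem_interior_cleanPaths hc.ne' hx'⟩, (hx.smul hc).2⟩

theorem chordLength_pos_of_mem (hm : 0 < m) {p : (E × E) × (E × E)}
    (hp : p ∈ billiardCovectors L) : 0 < chordLength L p := by
  obtain ⟨x, hx, rfl⟩ := hp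
  exact hx.chordLength_pos hm

/-- Equality of classes only gives a nonzero factor. It is positive, because the chord length is
homogeneous and positive on both covectors. -/
theorem projClass_eq_iff_exists_pos (hm : 0 < m) {p p' : (E × E) × (E × E)}
    (hp : p ∈ billiardCovectors L) (hp' : p' ∈ billiardCovectors L) :
    projClass p = projClass p' ↔ ∃ c : ℝ, 0 < c ∧ p' = scale c p := by
  constructor
  · intro h
    obtain ⟨c, -, rfl⟩ := (projClass_eq_iff (billiardCovectors_subset hm hp)
      (billiardCovectors_subset hm hp')).1 h
    have h1 := chordLength_pos_of_mem hm hp'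
    rw [chordLength_scale] at h1
    exact ⟨c, pos_of_mul_pos_left h1 (chordLength_pos_of_mem hm hp).le, rfl⟩
  · rintro ⟨c, hc, rfl⟩
    rw [projClass_scale hc.ne']

/-- `normLift` is a continuous local section, and positivity of the chord length makes its scaling
factor positive, so over the image it takes values in `R`. Since the fibres are orbits of the
positive scalings, the orbit space is then homeomorphic to the image. -/
theorem isOpenQuotientMap_projClass (hm : 0 < m) {R : Set ((E × E) × (E × E))}
    (hR : R ⊆ billiardCovectors L) (hscale : ∀ c : ℝ, 0 < c → ∀ p ∈ R, scale c p ∈ R) :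
    IsOpenQuotientMap (imageFactorization projClass R) := by
  refine isOpenQuotientMap_imageFactorization (fun p hp => ?_) fun p₀ hp₀ V hV => ?_
  · have h0 := cotangentNonzero.covec_ne_zero (billiardCovectors_subset hm (hR hp))
    exact (contDiffAt_projClass (n := 0) h0).continuousAt.continuousWithinAt
  · obtain ⟨x₀, hx, rfl⟩ := hR hp₀
    have h0 := cotangentNonzero.covec_ne_zero (hx.endLines_mem hm)
    have hN0 := hx.normLift_self hm
    have hN := (hx.contDiffAt_normLift_self hm).continuousAt
    have c1 : ∀ᶠ y in 𝓝 (projClass (endLines x₀)),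
        0 < chordLength L (normLift (endLines x₀) y) := by
      refine (ContinuousAt.comp (g := chordLength L) (f := normLift (endLines x₀))
        (by rw [hN0]; exact hx.continuousAt_chordLength) hN).eventually_const_lt ?_
      rw [Function.comp_apply, hN0]
      exact hx.chordLength_pos hm
    have c2 : ∀ᶠ y in 𝓝 (projClass (endLines x₀)), normLift (endLines x₀) y ∈ V :=
      hN.eventually_mem (by rwa [hN0])
    filter_upwards [self_mem_nhdsWithin, mem_nhdsWithin_of_mem_nhds c1,
      mem_nhdsWithin_of_mem_nhds c2,
      mem_nhdsWithin_of_mem_nhds (eventually_inner_projClass_ne_zero h0)]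
    rintro _ ⟨p, hp, rfl⟩ e1 e2 e3
    have hne := inner_covec_ne_zero_of_projClass e3
    rw [normLift_projClass hne] at e1 e2
    rw [chordLength_scale] at e1
    have hc := pos_of_mul_pos_left e1 (chordLength_pos_of_mem hm (hR hp)).le
    exact ⟨_, hscale _ hc p hp, e2, projClass_scale hc.ne' p⟩

/-- Classes near a stable one are represented by billiard paths near the stable path, and these stay
in the interior of the clean paths. -/
theorem exists_stableProjRelation_eq_inter (hL : ∀ i, L i ∈ 𝓛) (hm : 0 < m) :
    ∃ O, IsOpen O ∧ stableProjRelation 𝓛 L = projClass '' billiardCovectors L ∩ O := by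
  refine exists_isOpen_eq_inter (image_mono (stableScatteringRelation_subset hL)) ?_
  rw [stableProjRelation, stableScatteringRelation_eq hL]
  rintro _ ⟨_, ⟨x₀, ⟨hx, hx'⟩, rfl⟩, rfl⟩
  filter_upwards [hx.eventually_exists_path_mem hm (isOpen_interior.mem_nhds hx')]
  rintro y ⟨x, hxV, hx, rfl⟩
  exact ⟨_, ⟨x, ⟨hx, hxV⟩, rfl⟩, rfl⟩

variable (E) in
/-- The projection `baseProj` as a continuous linear map. -/
noncomputable def baseProjL : ProjAmbient E →L[ℝ] E × E :=
  (ContinuousLinearMap.fst ℝ _ _).prod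
    ((ContinuousLinearMap.fst ℝ _ _).comp (ContinuousLinearMap.snd ℝ _ _))

omit [FiniteDimensional ℝ E] in
theorem mem_immersionPoints_baseProjL {M : Set (ProjAmbient E)} {x : ProjAmbient E} :
    x ∈ immersionPoints M (baseProjL E) ↔ x ∈ M ∧ TransverseToFibre M x := Iff.rfl

/-- Two distinct subspaces of the same positive codimension exist only in dimension at least two. -/
theorem two_le_finrank_of_ne {K K' : Submodule ℝ E} {d : ℕ} (hd : 1 ≤ d)
    (h : Module.finrank ℝ K + d = Module.finrank ℝ E)
    (h' : Module.finrank ℝ K' + d = Module.finrank ℝ E) (hne : K ≠ K') :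
    2 ≤ Module.finrank ℝ E := by
  by_contra! hlt
  refine hne ?_
  rw [Submodule.finrank_eq_zero.1 (show Module.finrank ℝ K = 0 by omega),
    Submodule.finrank_eq_zero.1 (show Module.finrank ℝ K' = 0 by omega)]

end ScatteringRelation

end PointBilliard

/-! ### The theorem -/

open PointBilliard
theorem mainTheorem7 {E : Type*} [NormedAddCommGroup E] [InnerProductSpace ℝ E]
    [FiniteDimensional ℝ E]
    -- the collision subspaces, all of the same codimension `d ≥ 1`
    (𝓛 : Finset (Submodule ℝ E)) (d : ℕ) (hd : 1 ≤ d)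
    (hcodim : ∀ M ∈ 𝓛, Module.finrank ℝ M + d = Module.finrank ℝ E)
    -- the itinerary, of length `m + 1`, greater than one
    {m : ℕ} (L : Fin (m + 1) → Submodule ℝ E) (hL : ∀ i, L i ∈ 𝓛)
    (hne : ∀ i : Fin m, L i.castSucc ≠ L i.succ) (hlength : 1 < m + 1) :
    -- the projectivized cotangent bundle is a manifold on which `Θ` defines a contact structure:
    -- the differential of `Θ` is nondegenerate on the punctured cotangent bundle
    (IsSubmanifold (4 * Module.finrank ℝ E - 5) (projCotangent E) ∧
      ∀ p ∈ cotangentNonzero E, ∀ a ∈ tangentVectors (cotangentNonzero E) p,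
        (∀ b ∈ tangentVectors (cotangentNonzero E) p,
          contactForm a (b.1.1, b.2.1) - contactForm b (a.1.1, a.2.1) = 0) → a = 0) ∧
    -- `π₋ × π₊` is a Legendrian fibration
    (baseProj '' projCotangent E = sphereProd E ∧
      (∀ x ∈ projCotangent E, tangentVectors (sphereProd E) (baseProj x) ⊆
        baseProj '' tangentVectors (projCotangent E) x) ∧
      ∀ b ∈ sphereProd E, IsLegendrian (projCotangent E ∩ baseProj ⁻¹' {b})) ∧
    -- the relation misses the zero section, it is scale invariant, and its quotient by the positive
    -- scalings is a topological subspace of the projectivized cotangent bundle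
    (scatteringRelation 𝓛 L ⊆ cotangentNonzero E ∧
      (∀ c : ℝ, 0 < c → ∀ p ∈ scatteringRelation 𝓛 L, scale c p ∈ scatteringRelation 𝓛 L) ∧
      (∀ c : ℝ, 0 < c → ∀ p ∈ stableScatteringRelation 𝓛 L,
        scale c p ∈ stableScatteringRelation 𝓛 L) ∧
      (∀ p ∈ scatteringRelation 𝓛 L, ∀ p' ∈ scatteringRelation 𝓛 L,
        (projClass p = projClass p' ↔ ∃ c : ℝ, 0 < c ∧ p' = scale c p)) ∧
      IsOpenQuotientMap (Set.imageFactorization projClass (scatteringRelation 𝓛 L))) ∧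
    -- the quotient is Legendrian
    (IsLegendrian (stableProjRelation 𝓛 L) ∧
      ∃ M : Set (ProjAmbient E), IsLegendrian M ∧ projRelation 𝓛 L ⊆ M ∧
        ∃ O : Set (ProjAmbient E), IsOpen O ∧ stableProjRelation 𝓛 L = M ∩ O) ∧
    -- if it is transverse to the fibre somewhere, then its image in the product of the velocity
    -- spheres is a possibly singular hypersurface: it has the dimension of a hypersurface,
    ((∃ x ∈ stableProjRelation 𝓛 L, TransverseToFibre (stableProjRelation 𝓛 L) x) →
      dimH (baseProj '' stableProjRelation 𝓛 L)
        = ((2 * Module.finrank ℝ E - 3 : ℕ) : ENNReal)) ∧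
    -- and for every point of transversality the transverse points are dense in its connected
    -- component, and the image of a neighbourhood of it is a smooth embedded hypersurface
    (∀ x ∈ stableProjRelation 𝓛 L, TransverseToFibre (stableProjRelation 𝓛 L) x →
      connectedComponentIn (stableProjRelation 𝓛 L) x ⊆
        closure {y ∈ connectedComponentIn (stableProjRelation 𝓛 L) x |
          TransverseToFibre (stableProjRelation 𝓛 L) y} ∧
      ∃ O : Set (ProjAmbient E), IsOpen O ∧ x ∈ O ∧
        Set.InjOn baseProj (stableProjRelation 𝓛 L ∩ O) ∧
        IsSubmanifold (2 * Module.finrank ℝ E - 3)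
          (baseProj '' (stableProjRelation 𝓛 L ∩ O))) := by
  have hm : 0 < m := by omega
  have hn : 2 ≤ Module.finrank ℝ E := by
    refine two_le_finrank_of_ne hd (hcodim _ (hL _)) (hcodim _ (hL _)) (hne ⟨0, hm⟩)
  have hR := scatteringRelation_subset hL
  obtain ⟨O, hO, hS⟩ := exists_stableProjRelation_eq_inter hL hm
  have hLeg := projClass_billiardCovectors_isLegendrian (L := L) hn hm
  have hch : HasCharts (2 * Module.finrank ℝ E - 3) (stableProjRelation 𝓛 L) :=
    hS ▸ (projClass_billiardCovectors_hasCharts hn hm).inter_open hO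
  have hsub : stableProjRelation 𝓛 L ⊆ projClass '' billiardCovectors L :=
    hS ▸ Set.inter_subset_left
  refine ⟨⟨(projCotangent_hasCharts hn).isSubmanifold,
      fun p hp a ha h => contactForm_nondegenerate hp ha h⟩,
    ⟨baseProj_image_projCotangent hn, fun x hx => tangentVectors_sphereProd_subset hx,
      fun b _ => projCotangent_fibre_isLegendrian hn b⟩,
    ⟨hR.trans (billiardCovectors_subset hm), fun c hc p => scale_mem_scatteringRelation hL hc,
      fun c hc p => scale_mem_stableScatteringRelation hL hc,
      fun p hp p' hp' => projClass_eq_iff_exists_pos hm (hR hp) (hR hp'),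
      isOpenQuotientMap_projClass hm hR fun c hc p => scale_mem_scatteringRelation hL hc⟩,
    ⟨⟨hsub.trans hLeg.1, hch.isSubmanifold,
        fun x hx => (tangentVectors_mono hsub x).trans (hLeg.2.2 x (hsub hx))⟩,
      _, hLeg, Set.image_mono hR, O, hO, hS⟩,
    fun ⟨x, hx, ht⟩ => hch.dimH_image_eq (baseProjL E) (mem_immersionPoints_baseProjL.2 ⟨hx, ht⟩),
    fun x hx ht => ?_⟩
  have hi := mem_immersionPoints_baseProjL.2 ⟨hx, ht⟩
  refine ⟨(hch.connectedComponentIn_subset_closure (baseProjL E) hi).trans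
    (closure_mono fun y hy => ⟨hy.1, hy.2.2⟩), ?_⟩
  obtain ⟨O', hO', hxO', hinj, hsm, -⟩ := hch.exists_image_isSubmanifold (baseProjL E) hi
  exact ⟨O', hO', hxO', hinj, hsm⟩
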